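/- **Setting.** Fix $d\ge1$. For each $n$ let $Z_i=(Y_i,X_i,W_i)$, $i=1,\dots,2n$, be i.i.d., where $X$ has a continuous density on $\mathcal X=[0,1]^d$ bounded away from $0$ and $\infty$, and the law of $(Y,W)$ given $X=x$ (a regular version, for every $x\in\mathcal X$) may depend on $n$. Let $m(z;g)$ be a moment functional of an observation $z=(y,x,w)$ and of a function $g=g(x,\cdot)$ of $w$, let $h(w,\nu)$ be a known function, and let $V=V_n\subset\mathbb R^{d_\nu}$ be convex and bounded (in $\ell_2$, uniformly in $n$), where $d_\nu=d_\nu(n)$ grows at most polynomially in $n$. Assume $h(W,\nu)$ has finite second moment given $X=x$ for $\nu\in V$. Let $g_0(x,w)=\mathbb E[Y\mid W=w,X=x]=h(w,\nu_g(x))$ and let $\alpha_0(x,w)=h(w,\nu_\alpha(x))$ be the conditional Riesz representer: $\mathbb E[m(Z;g)\mid X=x]=\mathbb E[\alpha_0(x,W)g(W)\mid X=x]$ for all $g$ of the form $h(\cdot,\nu)$ with $\mathbb E[g(W)^2\mid X=x]<\infty$. Let $\nu_g(x),\nu_\alpha(x)\in V$ minimize $\nu\mapsto\mathbb E[l_g(Z;\nu)\mid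 X=x]$, resp. $\nu\mapsto\mathbb E[l_\alpha(Z;\nu)\mid X=x]$, over $V$, where $l_g,l_\alpha$ are known losses, twice continuously differentiable in $\nu$, whose gradients in $\nu$ have coordinates bounded on the data for $\nu\in V$, uniformly in $n$. The target is $\theta_0(x)=\mathbb E[m(Z;g_0(x,\cdot))\mid X=x]$. Put $\psi(z;\alpha,g)=m(z;g)+\alpha(w)(y-g(w))$. **Moment and nuisance regularity** (all constants independent of $n$). (M1) Given $X=x$, almost surely $|\psi(Z;\alpha,g)|\le\psi_{\max}$ for all $\alpha=h(\cdot,\nu')$, $g=h(\cdot,\nu)$ with $\nu,\nu'\in V$, for every $x\in\mathcal X$. (M2) For these $\alpha,g$, $x\mapsto\mathbb E[\psi(Z;\alpha,g)\mid X=x]$ is $L$-Lipschitz. (N1) $\nu_g(x)$ and $\nu_\alpha(x)$ have supports $S_g(x)$, $S_\alpha(x)$ with at most $k$ elements. (N2) $\nu_g,\nu_\alpha$ are $L$-Lipschitz, $h$ is $L$-Lipschitz in $\nu$, and for each $\nu\in V$ the maps $x\mapsto\mathbb E[\nabla_\nu l_g(Z;\nu)\mid X=x]$ and $x\mapsto\mathbb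 E[\nabla_\nu l_\alpha(Z;\nu)\mid X=x]$ are $L$-Lipschitz (Euclidean norms). (N3) For each $\bullet\in\{g,\alpha\}$ there are matrices $\mathcal H_\bullet(z)$ with bounded entries such that on the data $\nabla_{\nu\nu}l_\bullet(z;\nu)\succeq\mathcal H_\bullet(z)\succeq0$ for $\nu\in V$, and for some $\gamma>0$, $u^\top\mathbb E[\mathcal H_\bullet(Z)\mid X=x]u\ge\gamma\|u\|_2^2$ for all $x\in\mathcal X$ and all $u$ with $\|u_{S_\bullet(x)^c}\|_1\le3\|u_{S_\bullet(x)}\|_1$. **DRRF.** A forest on a sample of size $n$ consists of $B$ independently grown trees, each from a uniformly random subsample of size $s$ which is uniformly randomly partitioned into $S^1$ and $S^2$ of sizes $\lfloor s/2\rfloor$ and $\lceil s/2\rceil$. The tree is grown by axis-parallel splits of $\mathcal X$, which depend only on the observations of $S^1$, the covariates $X_i$ of $S^2$, and internal randomness drawn independently at each node. At a node $P$ one solves $\min_{\nu\in V}\frac1{|P\cap S^1|}\sum_{i\in P\cap S^1}l_\bullet(Z_i;\nu)+\lambda_\bullet\|\nu\|_1$ for $\bullet=g,\alpha$ and performs,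 among the potential splits (any set of splits examined at the node, possibly random), one that minimizes the sum over the two children of the squared deviations of the resulting $\psi_i$, $i\in S^1$, from their mean in the child. The forest is regular: for some fixed $0<\rho\le0.2$, integer $r\ge1$ and $0<\pi\le1$, each split leaves at least a fraction $\rho$ of the node's observations of $S^2$ on each side; each leaf contains between $r$ and $2r-1$ observations of $S^2$; and at each step, given the data and the tree grown so far, the next split is along feature $j$ with probability at least $\pi/d$, for every $j$. The weight $K(x,X_i)$ is the average over the trees of $\mathbf 1\{i\in S^2,\ X_i\in \text{leaf of }x\}/|S^2\cap\text{leaf of }x|$. A forest grown on $Z_{n+1},\dots,Z_{2n}$ gives $\hat\nu_\bullet(x)\in\arg\min_{\nu\in V}\sum_{i=n+1}^{2n}K(x,X_i)\,l_\bullet(Z_i;\nu)+\lambda_\bullet\|\nu\|_1$, $\hat g(x,w)=h(w,\hat\nu_g(x))$, $\hat\alpha(x,w)=h(w,\hat\nu_\alpha(x))$; an independently randomized forest grown on $Z_1,\dots,Z_n$ gives $$\hat\theta(x)=\sum_{i=1}^nK(x,X_i)\,\psi\big(Z_i;\hat\alpha(X_i,\cdot),\hat g(X_i,\cdot)\big).$$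 **Claim.** Let $a=\log(\rho^{-1})/(\pi\log((1-\rho)^{-1}))$ and $\left(1+\frac1{ad}\right)^{-1}<\beta<1$. There is a constant $C_0>0$ such that the following holds whenever $s=\Theta(n^\beta)$, $B\ge n/s$, and $$\lambda_g,\lambda_\alpha=\Theta\left(s^{-1/(2ad)}+\sqrt{\frac{s\ln(n^{\frac12(1-\beta)}d_\nu)}{n}}\right)$$ with implied lower constants at least $C_0$: for every fixed $x\in\mathcal X$, as $n\to\infty$, $$\hat\theta(x)-\theta_0(x)=O_p\left(n^{\frac12(\beta-1)}\right).$$ -/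

import Mathlib

open MeasureTheory ProbabilityTheory Filter Asymptotics
open scoped Matrix

noncomputable section

namespace DRRF

/-- Space of the target covariates `X` (they take values in the unit cube of it). -/
abbrev Cov (d : ℕ) : Type := EuclideanSpace ℝ (Fin d)

/-- Parameter space of the local nuisance parameters, with the Euclidean norm. -/
abbrev Param (p : ℕ) : Type := EuclideanSpace ℝ (Fin p)

/-- An observation `Z = (X, (Y, W))`. -/
abbrev Obs (d : ℕ) (𝒲 : Type*) : Type _ := Cov d × (ℝ × 𝒲)

/-- The target feature space `[0,1]^d`. -/
def cube (d : ℕ) : Set (Cov d) := {x | ∀ j, x j ∈ Set.Icc (0 : ℝ) 1}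

/-- The law on the unit cube with density `f`. -/
def covLaw {d : ℕ} (f : Cov d → ℝ) : Measure (Cov d) :=
  (volume.restrict (cube d)).withDensity fun x => ENNReal.ofReal (f x)

/-- The `ℓ¹` norm of a parameter. -/
def l1 {p : ℕ} (v : Param p) : ℝ := ∑ j, |v j|

/-! ### The conditional moment problem -/

/-- The ingredients of a conditional moment problem with nuisance functions parametrized by
`h(w, ν(x))`. -/
structure Problem (d p : ℕ) (𝒲 : Type*) [MeasurableSpace 𝒲] where
  /-- conditional law of `(Y, W)` given `X = x` -/
  condLaw : Kernel (Cov d) (ℝ × 𝒲)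
  /-- the moment functional `m(z; g(x, ·))` -/
  m : Obs d 𝒲 → (𝒲 → ℝ) → ℝ
  /-- the link function `h(w, ν)` -/
  h : 𝒲 → Param p → ℝ
  /-- the parameter set -/
  V : Set (Param p)
  /-- true local parameter of the regression function -/
  νg : Cov d → Param p
  /-- true local parameter of the conditional Riesz representer -/
  να : Cov d → Param p
  /-- local loss identifying `νg` -/
  lg : Obs d 𝒲 → Param p → ℝ
  /-- local loss identifying `να` -/
  lα : Obs d 𝒲 → Param p → ℝ
  /-- lower bound for the Hessian of `lg` -/
  Hg : Obs d 𝒲 → Matrix (Fin p) (Fin p) ℝ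
  /-- lower bound for the Hessian of `lα` -/
  Hα : Obs d 𝒲 → Matrix (Fin p) (Fin p) ℝ

section Problem

variable {d p : ℕ} {𝒲 : Type*} [MeasurableSpace 𝒲]

/-- Conditional expectation `E[F(Z) | X = x]`. -/
def Problem.cexp (M : Problem d p 𝒲) (x : Cov d) (F : Obs d 𝒲 → ℝ) : ℝ :=
  ∫ q, F (x, q) ∂M.condLaw x

/-- The law of one observation when `X` has density `f`. -/
def Problem.obsLaw (M : Problem d p 𝒲) (f : Cov d → ℝ) : Measure (Obs d 𝒲) :=
  covLaw f ⊗ₘ M.condLaw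

/-- The regression function `g₀(x, w) = h(w, νg(x))`. -/
def Problem.g0 (M : Problem d p 𝒲) (x : Cov d) (w : 𝒲) : ℝ := M.h w (M.νg x)

/-- The target `θ₀(x) = E[m(Z; g₀(x, W)) | X = x]`. -/
def Problem.θ0 (M : Problem d p 𝒲) (x : Cov d) : ℝ := M.cexp x fun z => M.m z (M.g0 x)

/-- The debiased moment `ψ(z; α, g) = m(z; g) + α(w) (y - g(w))`; `α` and `g` are the sections
of the nuisance functions at the covariate of `z`. -/
def Problem.ψ (M : Problem d p 𝒲) (z : Obs d 𝒲) (α g : 𝒲 → ℝ) : ℝ :=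
  M.m z g + α z.2.2 * (z.2.1 - g z.2.2)

/-- `h(·, v)` belongs to `L²` of the conditional law of `W` given `X = x`. -/
def Problem.MemG (M : Problem d p 𝒲) (x : Cov d) (v : Param p) : Prop :=
  MemLp (fun q : ℝ × 𝒲 => M.h q.2 v) 2 (M.condLaw x)

/-- Local population risk `L(x; ν) = E[l(Z; ν) | X = x]`. -/
def Problem.risk (M : Problem d p 𝒲) (l : Obs d 𝒲 → Param p → ℝ) (x : Cov d) (v : Param p) : ℝ :=
  M.cexp x fun z => l z v

/-- Conditions on one of the two losses: regularity, bounded gradients, and identification of the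
true parameter `ν(x)` as minimizer over `V` of the local risk. -/
structure LossOK (M : Problem d p 𝒲) (l : Obs d 𝒲 → Param p → ℝ) (ν : Cov d → Param p)
    (C : ℝ) : Prop where
  meas : ∀ v, Measurable fun z => l z v
  smooth : ∀ z, ContDiff ℝ 2 (l z)
  integrable : ∀ x ∈ cube d, ∀ v ∈ M.V, Integrable (fun q => l (x, q) v) (M.condLaw x)
  grad_bdd : ∀ x ∈ cube d, ∀ᵐ q ∂M.condLaw x, ∀ v ∈ M.V, ∀ j, |gradient (l (x, q)) v j| ≤ C
  mem : ∀ x ∈ cube d, ν x ∈ M.V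
  argmin : ∀ x ∈ cube d, IsMinOn (M.risk l x) M.V (ν x)

/-- `h(·, να(x))` represents `g ↦ E[m(Z; g) | X = x]` on the space of all
`g = h(·, ν)` in `L²`: it is the conditional Riesz representer (projected onto that space). -/
def Problem.IsCondRiesz (M : Problem d p 𝒲) : Prop :=
  ∀ x ∈ cube d, ∀ v, M.MemG x v →
    Integrable (fun q => M.m (x, q) fun w => M.h w v) (M.condLaw x) ∧
    M.cexp x (fun z => M.m z fun w => M.h w v) =
      M.cexp x fun z => M.h z.2.2 v * M.h z.2.2 (M.να x)

/-- `g₀(x, W)` is the conditional expectation of `Y` given `W`, under the law given `X = x`. -/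
def Problem.IsRegression (M : Problem d p 𝒲) : Prop :=
  ∀ x ∈ cube d, Integrable (fun q : ℝ × 𝒲 => q.1) (M.condLaw x) ∧
    (M.condLaw x)[fun q : ℝ × 𝒲 => q.1 | MeasurableSpace.comap Prod.snd inferInstance]
      =ᵐ[M.condLaw x] fun q => M.g0 x q.2

/-- Setting of the estimation problem; `C` bounds the parameter set, the gradients of the losses
and the entries of the Hessian lower bounds. -/
structure Setting (M : Problem d p 𝒲) (C : ℝ) : Prop where
  markov : IsMarkovKernel M.condLaw
  meas_h : ∀ v, Measurable fun w => M.h w v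
  meas_m : Measurable fun q : Obs d 𝒲 × Param p => M.m q.1 fun w => M.h w q.2
  convex_V : Convex ℝ M.V
  bdd_V : ∀ v ∈ M.V, ‖v‖ ≤ C
  memG : ∀ x ∈ cube d, ∀ v ∈ M.V, M.MemG x v
  regression : M.IsRegression
  riesz : M.IsCondRiesz
  loss_g : LossOK M M.lg M.νg C
  loss_α : LossOK M M.lα M.να C

/-- Boundedness and smoothness of the debiased moment, uniformly over the nuisance class. -/
structure MomentRegularity (M : Problem d p 𝒲) (ψmax L : ℝ) : Prop where
  bdd : ∀ x ∈ cube d, ∀ᵐ q ∂M.condLaw x, ∀ a ∈ M.V, ∀ b ∈ M.V,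
    |M.ψ (x, q) (fun w => M.h w a) (fun w => M.h w b)| ≤ ψmax
  smooth : ∀ a ∈ M.V, ∀ b ∈ M.V, ∀ x ∈ cube d, ∀ x' ∈ cube d,
    |M.cexp x (fun z => M.ψ z (fun w => M.h w a) (fun w => M.h w b)) -
      M.cexp x' (fun z => M.ψ z (fun w => M.h w a) (fun w => M.h w b))| ≤ L * ‖x - x'‖

/-- The support of a parameter. -/
def supp (v : Param p) : Finset (Fin p) := {j | v j ≠ 0}

/-- The cone `C(S; 3)`. -/
def cone (S : Finset (Fin p)) : Set (Param p) :=
  {u | ∑ j ∈ Sᶜ, |u j| ≤ 3 * ∑ j ∈ S, |u j|}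

/-- The quadratic form of a matrix. -/
def quad (A : Matrix (Fin p) (Fin p) ℝ) (u : Param p) : ℝ := u.ofLp ⬝ᵥ (A *ᵥ u.ofLp)

/-- Entrywise conditional expectation of a matrix. -/
def Problem.cexpMat (M : Problem d p 𝒲) (x : Cov d) (H : Obs d 𝒲 → Matrix (Fin p) (Fin p) ℝ) :
    Matrix (Fin p) (Fin p) ℝ :=
  Matrix.of fun i j => M.cexp x fun z => H z i j

/-- Sparsity, Lipschitz continuity and the conditional restricted eigenvalue condition for one of
the two nuisance parameters, with loss `l`, true parameter `ν` and Hessian lower bound `H`. -/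
structure SparseRegular (M : Problem d p 𝒲) (l : Obs d 𝒲 → Param p → ℝ) (ν : Cov d → Param p)
    (H : Obs d 𝒲 → Matrix (Fin p) (Fin p) ℝ) (k : ℕ) (γ L C : ℝ) : Prop where
  sparse : ∀ x ∈ cube d, (supp (ν x)).card ≤ k
  lip : ∀ x ∈ cube d, ∀ x' ∈ cube d, ‖ν x - ν x'‖ ≤ L * ‖x - x'‖
  lip_grad : ∀ v ∈ M.V, ∀ x ∈ cube d, ∀ x' ∈ cube d,
    ‖(∫ q, gradient (l (x, q)) v ∂M.condLaw x) - ∫ q, gradient (l (x', q)) v ∂M.condLaw x'‖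
      ≤ L * ‖x - x'‖
  meas_H : ∀ i j, Measurable fun z => H z i j
  bdd_H : ∀ x ∈ cube d, ∀ᵐ q ∂M.condLaw x, ∀ i j, |H (x, q) i j| ≤ C
  hessian : ∀ x ∈ cube d, ∀ᵐ q ∂M.condLaw x, (H (x, q)).PosSemidef ∧
    ∀ v ∈ M.V, ∀ u, quad (H (x, q)) u ≤ fderiv ℝ (fderiv ℝ (l (x, q))) v u u
  restricted_eigenvalue : ∀ x ∈ cube d, ∀ u ∈ cone (supp (ν x)),
    γ * ‖u‖ ^ 2 ≤ quad (M.cexpMat x H) u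

/-- Nuisance regularity. -/
structure NuisanceRegularity (M : Problem d p 𝒲) (k : ℕ) (γ L C : ℝ) : Prop where
  g : SparseRegular M M.lg M.νg M.Hg k γ L C
  α : SparseRegular M M.lα M.να M.Hα k γ L C
  lip_h : ∀ w, ∀ v v' : Param p, |M.h w v - M.h w v'| ≤ L * ‖v - v'‖

end Problem

/-! ### Trees and forests -/

/-- A split `(j, t)`: left is `x j ≤ t`, right is `x j > t`. -/
abbrev Split (d : ℕ) : Type := Fin d × ℝ

/-- The side of a split (`true` for left). -/
def side {d : ℕ} (c : Split d) (left : Bool) : Set (Cov d) :=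
  if left then {x | x c.1 ≤ c.2} else {x | c.2 < x c.1}

/-- Node of a binary tree, encoded by the sequence of directions that lead to it, the last
direction at the head of the list; `σ q` is the split performed at node `q`. The cell of a node is
the part of the feature space that reaches it. -/
def cell {d : ℕ} (σ : List Bool → Split d) : List Bool → Set (Cov d)
  | [] => Set.univ
  | b :: q => cell σ q ∩ side (σ q) b

/-- A subsample of size `s`, partitioned into two halves `S¹` and `S²`. -/
def Halves (n s : ℕ) : Type :=
  {S : Finset (Fin n) × Finset (Fin n) //
    Disjoint S.1 S.2 ∧ S.1.card = s / 2 ∧ S.2.card = s - s / 2}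

instance (n s : ℕ) : MeasurableSpace (Halves n s) := ⊤

/-- Internal randomness of a tree: one uniform variable per node. -/
abbrev TreeRand : Type := List Bool → unitInterval

/-- The internal randomness of a forest of `B` trees: for every tree a subsample with its
partition, and the randomness used to grow the tree. -/
abbrev ForestRand (n s B : ℕ) : Type := Fin B → Halves n s × TreeRand

/-- Subsamples and partitions are uniformly distributed, everything is independent. -/
def forestRandLaw (n s B : ℕ) : Measure (ForestRand n s B) :=
  Measure.pi fun _ => (uniformOn (Set.univ : Set (Halves n s))).prod
    (Measure.infinitePi fun _ : List Bool => (volume : Measure unitInterval))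

section Forest

variable {d p n s : ℕ} {𝒲 : Type*} [MeasurableSpace 𝒲]

open scoped Classical in
/-- The observations of index set `S` whose covariates lie in `A`. -/
def within (Z : Fin n → Obs d 𝒲) (S : Finset (Fin n)) (A : Set (Cov d)) : Finset (Fin n) :=
  S.filter fun i => (Z i).1 ∈ A

/-- A tree learner: for every partitioned subsample, data set and internal randomness, the set of
potential splits examined at every node, and the split that is performed there. -/
structure TreeLearner (d n s : ℕ) (𝒲 : Type*) where
  potential : Halves n s → (Fin n → Obs d 𝒲) → TreeRand → List Bool → Set (Split d)
  split : Halves n s → (Fin n → Obs d 𝒲) → TreeRand → List Bool → Split d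

/-- A node is split as long as it contains at least `2 r` observations of `S²`. -/
def TreeLearner.Internal (T : TreeLearner d n s 𝒲) (r : ℕ) (S : Halves n s)
    (Z : Fin n → Obs d 𝒲) (ξ : TreeRand) (q : List Bool) : Prop :=
  2 * r ≤ (within Z S.1.2 (cell (T.split S Z ξ) q)).card

/-- The leaf of the tree that contains `x`: all `y` that stay together with `x` at every internal
node that `x` reaches. -/
def TreeLearner.leaf (T : TreeLearner d n s 𝒲) (r : ℕ) (S : Halves n s)
    (Z : Fin n → Obs d 𝒲) (ξ : TreeRand) (x : Cov d) : Set (Cov d) :=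
  {y | ∀ q, T.Internal r S Z ξ q → x ∈ cell (T.split S Z ξ) q →
    (y ∈ side (T.split S Z ξ q) true ↔ x ∈ side (T.split S Z ξ q) true)}

open scoped Classical in
/-- The base kernel: uniform weights on the observations of `S²` in the leaf of `x`. -/
def TreeLearner.baseKernel (T : TreeLearner d n s 𝒲) (r : ℕ) (S : Halves n s)
    (Z : Fin n → Obs d 𝒲) (ξ : TreeRand) (x : Cov d) (i : Fin n) : ℝ :=
  if i ∈ within Z S.1.2 (T.leaf r S Z ξ x) then
    ((within Z S.1.2 (T.leaf r S Z ξ x)).card : ℝ)⁻¹ else 0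

/-- The forest kernel: average of the base kernels of the `B` trees. -/
def TreeLearner.kernel (T : TreeLearner d n s 𝒲) (r : ℕ) {B : ℕ} (R : ForestRand n s B)
    (Z : Fin n → Obs d 𝒲) (x : Cov d) (i : Fin n) : ℝ :=
  (B : ℝ)⁻¹ * ∑ b, T.baseKernel r (R b).1 Z (R b).2 x i

/-- `v` solves the lasso problem over `V` with weights `K`, loss `l` and penalty `lam`. -/
def IsLasso (V : Set (Param p)) (Z : Fin n → Obs d 𝒲) (l : Obs d 𝒲 → Param p → ℝ)
    (K : Fin n → ℝ) (lam : ℝ) (v : Param p) : Prop :=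
  v ∈ V ∧ IsMinOn (fun u => ∑ i, K i * l (Z i) u + lam * l1 u) V v

/-- Equal weights on the index set `S`. -/
def equalWeights (S : Finset (Fin n)) (i : Fin n) : ℝ := if i ∈ S then (S.card : ℝ)⁻¹ else 0

/-- Sum of squared deviations of `a` from its mean over `S`. -/
def sumSq (a : Fin n → ℝ) (S : Finset (Fin n)) : ℝ :=
  ∑ i ∈ S, ((S.card : ℝ)⁻¹ * ∑ k ∈ S, a k - a i) ^ 2

/-- Sum of squared errors of the two children of the cell `A` produced by the split `c`. -/
def SSE (Z : Fin n → Obs d 𝒲) (S : Finset (Fin n)) (A : Set (Cov d)) (a : Fin n → ℝ)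
    (c : Split d) : ℝ :=
  sumSq a (within Z S (A ∩ side c true)) + sumSq a (within Z S (A ∩ side c false))

/-- The tree learner follows the splitting algorithm: trees are grown from `S¹` (and, in order to
maintain the balance of the tree, the covariates of `S²`) and from the randomness attached to
the nodes met so far; at every node, the split minimizes over the potential splits the sum of
squared errors of the debiased moments, the nuisance parameters being estimated by equally
weighted lasso problems in the node. -/
structure FollowsAlgorithm (M : Problem d p 𝒲) (f : Cov d → ℝ) (r : ℕ) (lamg lamα : ℝ)
    (T : TreeLearner d n s 𝒲) : Prop where
  meas : ∀ S q, Measurable fun a : (Fin n → Obs d 𝒲) × TreeRand => T.split S a.1 a.2 q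
  adapted : ∀ (S : Halves n s) (Z Z' : Fin n → Obs d 𝒲) (ξ ξ' : TreeRand) (q : List Bool),
    (∀ i ∈ S.1.1, Z i = Z' i) → (∀ i ∈ S.1.2, (Z i).1 = (Z' i).1) →
    (∀ q', q' <:+ q → ξ q' = ξ' q') → T.split S Z ξ q = T.split S Z' ξ' q
  optimal : ∀ᵐ Z ∂Measure.pi (fun _ : Fin n => M.obsLaw f), ∀ (S : Halves n s) (ξ : TreeRand)
      (q : List Bool), T.Internal r S Z ξ q →
    T.split S Z ξ q ∈ T.potential S Z ξ q ∧
    ((within Z S.1.1 (cell (T.split S Z ξ) q)).Nonempty →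
      ∃ v u : Param p,
        IsLasso M.V Z M.lg (equalWeights (within Z S.1.1 (cell (T.split S Z ξ) q))) lamg v ∧
        IsLasso M.V Z M.lα (equalWeights (within Z S.1.1 (cell (T.split S Z ξ) q))) lamα u ∧
        ∀ c ∈ T.potential S Z ξ q,
          SSE Z S.1.1 (cell (T.split S Z ξ) q)
              (fun i => M.ψ (Z i) (fun w => M.h w u) fun w => M.h w v) (T.split S Z ξ q) ≤
            SSE Z S.1.1 (cell (T.split S Z ξ) q)
              (fun i => M.ψ (Z i) (fun w => M.h w u) fun w => M.h w v) c)

/-- Forest regularity: every split leaves at least a fraction `ρ` of the observations of `S²` in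
the node, and at least `r` of them, on each side (nodes being split exactly when they contain
`2 r` or more of them, all leaves then have between `r` and `2 r - 1`); and given the data and the
growth of the tree so far, the next split occurs along each feature with probability at least
`ϖ / d`. -/
def ForestRegular (M : Problem d p 𝒲) (f : Cov d → ℝ) (ρ ϖ : ℝ) (r : ℕ)
    (T : TreeLearner d n s 𝒲) : Prop :=
  ∀ᵐ Z ∂Measure.pi (fun _ : Fin n => M.obsLaw f), ∀ (S : Halves n s) (ξ : TreeRand)
      (q : List Bool), T.Internal r S Z ξ q →
    (∀ b : Bool,
      ρ * (within Z S.1.2 (cell (T.split S Z ξ) q)).card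
        ≤ (within Z S.1.2 (cell (T.split S Z ξ) (b :: q))).card ∧
      r ≤ (within Z S.1.2 (cell (T.split S Z ξ) (b :: q))).card) ∧
    ∀ j : Fin d, ENNReal.ofReal (ϖ / d) ≤
      volume {u : unitInterval | (T.split S Z (Function.update ξ q u) q).1 = j}

/-- One half of the data set together with the randomness of the forest grown on it. -/
abbrev HalfSample (d n s B : ℕ) (𝒲 : Type*) : Type _ := (Fin n → Obs d 𝒲) × ForestRand n s B

/-- The law of one half. -/
def halfLaw (M : Problem d p 𝒲) (f : Cov d → ℝ) (n s B : ℕ) :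
    Measure (HalfSample d n s B 𝒲) :=
  (Measure.pi fun _ : Fin n => M.obsLaw f).prod (forestRandLaw n s B)

/-- The law of the `2 n` observations and of the randomness of the two forests. -/
def sampleLaw (M : Problem d p 𝒲) (f : Cov d → ℝ) (n s B : ℕ) :
    Measure (HalfSample d n s B 𝒲 × HalfSample d n s B 𝒲) :=
  (halfLaw M f n s B).prod (halfLaw M f n s B)

/-- `est` is a forest lasso estimator with loss `l` and penalty `lam`. -/
structure IsForestLasso (M : Problem d p 𝒲) (f : Cov d → ℝ) (r B : ℕ) (T : TreeLearner d n s 𝒲)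
    (l : Obs d 𝒲 → Param p → ℝ) (lam : ℝ) (est : HalfSample d n s B 𝒲 → Cov d → Param p) :
    Prop where
  meas : Measurable fun a : HalfSample d n s B 𝒲 × Cov d => est a.1 a.2
  lasso : ∀ᵐ ω ∂halfLaw M f n s B, ∀ x ∈ cube d,
    IsLasso M.V ω.1 l (T.kernel r ω.2 ω.1 x) lam (est ω x)

/-- The estimator of `θ₀(x)`: kernel weights and debiased moments from the first half of the data,
nuisance estimates from the second half. -/
def thetaHat (M : Problem d p 𝒲) (r : ℕ) {B : ℕ} (T : TreeLearner d n s 𝒲)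
    (estg estα : HalfSample d n s B 𝒲 → Cov d → Param p)
    (ω : HalfSample d n s B 𝒲 × HalfSample d n s B 𝒲) (x : Cov d) : ℝ :=
  ∑ i, T.kernel r ω.1.2 ω.1.1 x i *
    M.ψ (ω.1.1 i) (fun w => M.h w (estα ω.2 (ω.1.1 i).1)) (fun w => M.h w (estg ω.2 (ω.1.1 i).1))

end Forest

/-- `X n = O_p(rate n)`. -/
def IsBigOp {Ω : ℕ → Type*} [∀ n, MeasurableSpace (Ω n)] (P : ∀ n, Measure (Ω n))
    (X : ∀ n, Ω n → ℝ) (rate : ℕ → ℝ) : Prop :=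
  ∀ ε > 0, ∃ K : ℝ, ∀ᶠ n in atTop, P n {ω | K * rate n < |X n ω|} ≤ ENNReal.ofReal ε

/-- The exponent parameter `a = log(ρ⁻¹) / (ϖ log((1 - ρ)⁻¹))`. -/
def rateParam (ρ ϖ : ℝ) : ℝ := Real.log ρ⁻¹ / (ϖ * Real.log (1 - ρ)⁻¹)

/-- The order of the lasso penalties for sample size `n`, subsample size `s` and parameter
dimension `p`. -/
def lassoRate (a β : ℝ) (d n s p : ℕ) : ℝ :=
  (s : ℝ) ^ (-(1 / (2 * a * d))) +
    Real.sqrt (s * Real.log ((n : ℝ) ^ ((1 - β) / 2) * p) / n)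

end DRRF

end

/-! Condition on the second half of the data. The nuisance estimates become fixed functions `a`, `b`
of the covariate, and the error at `x` is a sum of three kernel averages: the noise `ψ_i - E[ψ |
X_i]`, the nuisance bias `E[ψ | X_i] - θ₀(X_i)`, and the smoothing bias `θ₀(X_i) - θ₀(x)`. The
target rate `n^((β-1)/2)` is of the order of `√(s/n)`.

Noise. Given the data, a forest averages `B` independent trees. Integrating out the trees leaves a
complete average over subsamples, which by Hoeffding's device is an average over permutations of
means over `⌊n/s⌋` disjoint blocks. Both layers are sub-Gaussian, with total variance proxy of order
`s/n` (`forest_tail`). Honesty centres the noise: the weights do not see the responses of `S²`, so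
each response may be replaced by its conditional mean (`integral_stat_eq`).

Smoothing bias. All boxes simultaneously contain about the expected number of observations
(`measure_not_boxRegular_le`), so a child holding a fraction `ρ` of the observations of its parent
has a comparable share of its width. Each split along a feature therefore shortens the cell of `x`
in that direction by a fixed factor. Such splits have conditional probability at least `ϖ/d`, and a
path is at least of logarithmic length; hence the expected distance to the neighbours is at most
`s^(-1/(2ad))` (`eventually_stat_dist_le`). The lower bound on `β` says that this is within the
target rate.

Nuisance bias. The debiased moment is orthogonal: its conditional bias is the expected product of
the two nuisance errors (`cexp_ψ_sub_θ0`), so only squared errors matter and the nuisances may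
converge at the square root of the target rate. The forest lasso achieves this in mean square at
every fixed point (`lasso_error_le`, `exists_lassoFail`, `lintegral_sq_error_le`). The two halves
are independent and the weights sum to one, so by Fubini the risk averaged over the random points
`X_i` obeys the same pointwise bound; no control uniform in the covariate is required
(`sampleLaw_thetaHat_tail`). -/

namespace DRRF

/-! ### Paths, leaves and weights of a single tree. -/

section Tree

variable {d n s : ℕ} {𝒲 : Type*}

open scoped Classical in
/-- The side of a split on which a point lies. -/
noncomputable def dir (c : Split d) (x : Cov d) : Bool := decide (x c.1 ≤ c.2)

theorem mem_side_iff (c : Split d) (x : Cov d) (b : Bool) : x ∈ side c b ↔ b = dir c x := by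
  cases b <;> simp [side, dir]

theorem mem_side_true_iff (c : Split d) (x y : Cov d) :
    (y ∈ side c true ↔ x ∈ side c true) ↔ dir c y = dir c x := by
  rw [mem_side_iff, mem_side_iff]
  cases dir c x <;> cases dir c y <;> simp

/-- The node of depth `k` on the path of `x`. -/
noncomputable def node (σ : List Bool → Split d) (x : Cov d) : ℕ → List Bool
  | 0 => []
  | k + 1 => dir (σ (node σ x k)) x :: node σ x k

theorem node_length (σ : List Bool → Split d) (x : Cov d) (k : ℕ) : (node σ x k).length = k := by
  induction k with
  | zero => rfl
  | succ k ih => simp [node, ih]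

theorem mem_cell_node (σ : List Bool → Split d) (x : Cov d) (k : ℕ) : x ∈ cell σ (node σ x k) := by
  induction k with
  | zero => simp [node, cell]
  | succ k ih => exact ⟨ih, (mem_side_iff _ _ _).2 rfl⟩

/-- Sibling cells are disjoint, so membership of `x` forces the direction at every step: the nodes
whose cells contain `x` form one chain. -/
theorem eq_node_of_mem_cell {σ : List Bool → Split d} {x : Cov d} {q : List Bool}
    (h : x ∈ cell σ q) : q = node σ x q.length := by
  induction q with
  | nil => rfl
  | cons b q ih =>
    have h1 := ih h.1
    have h2 := (mem_side_iff _ _ _).1 h.2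
    simp only [List.length_cons, node]
    rw [← h1, ← h2]

theorem cell_cons_subset (σ : List Bool → Split d) (q : List Bool) (b : Bool) :
    cell σ (b :: q) ⊆ cell σ q := Set.inter_subset_left

theorem cell_node_antitone (σ : List Bool → Split d) (x : Cov d) :
    Antitone fun k => cell σ (node σ x k) :=
  antitone_nat_of_succ_le fun _ => cell_cons_subset _ _ _

theorem mem_cell_node_succ {σ : List Bool → Split d} {x y : Cov d} {k : ℕ} :
    y ∈ cell σ (node σ x (k + 1)) ↔
      y ∈ cell σ (node σ x k) ∧ dir (σ (node σ x k)) y = dir (σ (node σ x k)) x := by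
  change _ ∧ _ ↔ _
  rw [mem_side_iff, eq_comm]

theorem within_mono (Z : Fin n → Obs d 𝒲) (S : Finset (Fin n)) {A A' : Set (Cov d)} (h : A ⊆ A') :
    within Z S A ⊆ within Z S A' := by
  intro i hi
  simp only [within, Finset.mem_filter] at hi ⊢
  exact ⟨hi.1, h hi.2⟩

theorem mem_within {Z : Fin n → Obs d 𝒲} {S : Finset (Fin n)} {A : Set (Cov d)} {i : Fin n} :
    i ∈ within Z S A ↔ i ∈ S ∧ (Z i).1 ∈ A := by
  simp [within]

theorem within_univ (Z : Fin n → Obs d 𝒲) (S : Finset (Fin n)) :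
    within Z S Set.univ = S := by
  ext; simp [mem_within]

theorem card_within_cell_cons (Z : Fin n → Obs d 𝒲) (S : Finset (Fin n))
    (σ : List Bool → Split d) (q : List Bool) (b : Bool) :
    (within Z S (cell σ (b :: q))).card + (within Z S (cell σ ((!b) :: q))).card =
      (within Z S (cell σ q)).card := by
  classical
  rw [← Finset.card_union_of_disjoint]
  · congr 1
    ext i
    simp only [Finset.mem_union, mem_within, cell, Set.mem_inter_iff, mem_side_iff]
    cases b <;> cases dir (σ q) (Z i).1 <;> simp
  · rw [Finset.disjoint_left]
    intro i h1 h2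
    simp only [mem_within, cell, Set.mem_inter_iff, mem_side_iff] at h1 h2
    have := h1.2.2.trans h2.2.2.symm
    cases b <;> simp at this

/-- Regularity of the splits of one tree on one data set. -/
def TreeLearner.RegularAt (T : TreeLearner d n s 𝒲) (ρ ϖ : ℝ) (r : ℕ) (Z : Fin n → Obs d 𝒲) :
    Prop :=
  ∀ (S : Halves n s) (ξ : TreeRand) (q : List Bool), T.Internal r S Z ξ q →
    (∀ b : Bool,
      ρ * (within Z S.1.2 (cell (T.split S Z ξ) q)).card
        ≤ (within Z S.1.2 (cell (T.split S Z ξ) (b :: q))).card ∧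
      r ≤ (within Z S.1.2 (cell (T.split S Z ξ) (b :: q))).card) ∧
    ∀ j : Fin d, ENNReal.ofReal (ϖ / d) ≤
      volume {u : unitInterval | (T.split S Z (Function.update ξ q u) q).1 = j}

variable (T : TreeLearner d n s 𝒲) (r : ℕ) (S : Halves n s) (Z : Fin n → Obs d 𝒲) (ξ : TreeRand)
  (x : Cov d)

theorem leaf_subset_cell {k : ℕ}
    (h : ∀ k' < k, T.Internal r S Z ξ (node (T.split S Z ξ) x k')) :
    T.leaf r S Z ξ x ⊆ cell (T.split S Z ξ) (node (T.split S Z ξ) x k) := by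
  intro y hy
  induction k with
  | zero => simp [node, cell]
  | succ k ih =>
    refine mem_cell_node_succ.2 ⟨ih fun k' hk' => h k' (by omega), ?_⟩
    exact (mem_side_true_iff _ _ _).1 (hy _ (h k (by omega)) (mem_cell_node _ _ _))

/-- Counts of `S²` decrease along the path. Once a node of the path is too small to be split, every
internal node containing `x` is a strict ancestor of it, and points of its cell have agreed with `x`
at all of those. -/
theorem cell_subset_leaf {k : ℕ}
    (h : ¬ T.Internal r S Z ξ (node (T.split S Z ξ) x k)) :
    cell (T.split S Z ξ) (node (T.split S Z ξ) x k) ⊆ T.leaf r S Z ξ x := by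
  intro y hy q hq hx
  rw [mem_side_true_iff]
  have hq' := eq_node_of_mem_cell hx
  have hk : q.length < k := by
    by_contra! hcon
    apply h
    refine le_trans hq (Finset.card_le_card (within_mono _ _ ?_))
    rw [hq']
    exact cell_node_antitone _ _ hcon
  have hy' := cell_node_antitone _ _ (Nat.succ_le_of_lt hk) hy
  rw [hq']
  exact (mem_cell_node_succ.1 hy').2

variable {T r S Z ξ x}

theorem le_card_within_node {ρ ϖ : ℝ} (hZ : T.RegularAt ρ ϖ r Z) (hr : r ≤ S.1.2.card) (k : ℕ)
    (h : ∀ k' < k, T.Internal r S Z ξ (node (T.split S Z ξ) x k')) :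
    r ≤ (within Z S.1.2 (cell (T.split S Z ξ) (node (T.split S Z ξ) x k))).card := by
  cases k with
  | zero => simpa [node, cell, within_univ] using hr
  | succ k => exact (((hZ S ξ _ (h k (by omega))).1 _).2)

/-- Each split sends at least `r ≥ 1` observations of `S²` to the side away from `x`, so the path
stops after at most as many steps as `S²` has elements. -/
theorem exists_not_internal {ρ ϖ : ℝ} (hZ : T.RegularAt ρ ϖ r Z) (hr0 : 1 ≤ r) :
    ∃ k, ¬ T.Internal r S Z ξ (node (T.split S Z ξ) x k) := by
  by_contra! hcon
  have key : ∀ k, (within Z S.1.2 (cell (T.split S Z ξ) (node (T.split S Z ξ) x k))).card + k ≤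
      S.1.2.card := by
    intro k
    induction k with
    | zero => simp [node, cell, within_univ]
    | succ k ih =>
      have h1 := ((hZ S ξ _ (hcon k)).1 (!(dir (T.split S Z ξ (node (T.split S Z ξ) x k)) x))).2
      have h2 := card_within_cell_cons Z S.1.2 (T.split S Z ξ) (node (T.split S Z ξ) x k)
        (dir (T.split S Z ξ (node (T.split S Z ξ) x k)) x)
      simp only [node]
      omega
  have := key (S.1.2.card + 1)
  omega

theorem leaf_nonempty {ρ ϖ : ℝ} (hZ : T.RegularAt ρ ϖ r Z) (hr0 : 1 ≤ r) (hr : r ≤ S.1.2.card) :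
    (within Z S.1.2 (T.leaf r S Z ξ x)).Nonempty := by
  classical
  have hex := exists_not_internal (S := S) (ξ := ξ) (x := x) hZ hr0
  have h1 := le_card_within_node (ξ := ξ) (x := x) hZ hr (Nat.find hex) fun k' hk' =>
    not_not.1 (Nat.find_min hex hk')
  refine Finset.Nonempty.mono (within_mono _ _ (cell_subset_leaf T r S Z ξ x (Nat.find_spec hex))) ?_
  rw [← Finset.card_pos]
  omega

theorem baseKernel_nonneg (i : Fin n) : 0 ≤ T.baseKernel r S Z ξ x i := by
  unfold TreeLearner.baseKernel
  split_ifs <;> positivity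

theorem sum_baseKernel_eq (F : Fin n → ℝ) : ∑ i, T.baseKernel r S Z ξ x i * F i =
    ((within Z S.1.2 (T.leaf r S Z ξ x)).card : ℝ)⁻¹ *
      ∑ i ∈ within Z S.1.2 (T.leaf r S Z ξ x), F i := by
  classical
  simp only [TreeLearner.baseKernel, ite_mul, zero_mul, Finset.sum_ite_mem, Finset.univ_inter,
    Finset.mul_sum]

theorem sum_baseKernel_le_one : ∑ i, T.baseKernel r S Z ξ x i ≤ 1 := by
  have := sum_baseKernel_eq (T := T) (r := r) (S := S) (Z := Z) (ξ := ξ) (x := x) fun _ => 1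
  simp only [mul_one, Finset.sum_const, nsmul_eq_mul] at this
  rw [this]
  -- An empty leaf is covered as well: `0⁻¹ = 0`, so the sum is then zero.
  exact inv_mul_le_one

theorem sum_baseKernel_eq_one (h : (within Z S.1.2 (T.leaf r S Z ξ x)).Nonempty) :
    ∑ i, T.baseKernel r S Z ξ x i = 1 := by
  have := sum_baseKernel_eq (T := T) (r := r) (S := S) (Z := Z) (ξ := ξ) (x := x) fun _ => 1
  simp only [mul_one, Finset.sum_const, nsmul_eq_mul] at this
  rw [this]
  exact inv_mul_cancel₀ (by exact_mod_cast (Finset.card_pos.2 h).ne')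

theorem baseKernel_eq_zero {i : Fin n} (hi : i ∉ S.1.2) : T.baseKernel r S Z ξ x i = 0 := by
  unfold TreeLearner.baseKernel
  rw [if_neg]
  rw [mem_within]
  tauto

variable (T r S Z ξ x) in
/-- The prediction of one tree for the values `F`. -/
noncomputable def TreeLearner.stat (F : Obs d 𝒲 → ℝ) : ℝ :=
  ∑ i, T.baseKernel r S Z ξ x i * F (Z i)

theorem abs_stat_le {F : Obs d 𝒲 → ℝ} {c : ℝ} (hc : 0 ≤ c) (hF : ∀ z, |F z| ≤ c) :
    |T.stat r S Z ξ x F| ≤ c := by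
  unfold TreeLearner.stat
  calc _ ≤ ∑ i, |T.baseKernel r S Z ξ x i * F (Z i)| := Finset.abs_sum_le_sum_abs _ _
    _ ≤ ∑ i, T.baseKernel r S Z ξ x i * c := by
        refine Finset.sum_le_sum fun i _ => ?_
        rw [abs_mul, abs_of_nonneg (baseKernel_nonneg i)]
        exact mul_le_mul_of_nonneg_left (hF _) (baseKernel_nonneg i)
    _ = (∑ i, T.baseKernel r S Z ξ x i) * c := by rw [Finset.sum_mul]
    _ ≤ 1 * c := mul_le_mul_of_nonneg_right sum_baseKernel_le_one hc
    _ = c := one_mul c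

theorem kernel_nonneg {B : ℕ} (R : ForestRand n s B) (i : Fin n) : 0 ≤ T.kernel r R Z x i :=
  mul_nonneg (by positivity) (Finset.sum_nonneg fun _ _ => baseKernel_nonneg i)

theorem sum_kernel_mul {B : ℕ} (R : ForestRand n s B) (F : Obs d 𝒲 → ℝ) :
    ∑ i, T.kernel r R Z x i * F (Z i) = (B : ℝ)⁻¹ * ∑ b, T.stat r (R b).1 Z (R b).2 x F := by
  simp only [TreeLearner.kernel, TreeLearner.stat, Finset.mul_sum, Finset.sum_mul]
  rw [Finset.sum_comm]
  simp only [mul_assoc]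

theorem sum_kernel_eq_one {ρ ϖ : ℝ} (hZ : T.RegularAt ρ ϖ r Z) (hr0 : 1 ≤ r) (hr : r ≤ s - s / 2)
    {B : ℕ} (hB : B ≠ 0) (R : ForestRand n s B) : ∑ i, T.kernel r R Z x i = 1 := by
  have h := sum_kernel_mul (T := T) (r := r) (Z := Z) (x := x) R fun _ => 1
  simp only [mul_one, TreeLearner.stat] at h
  rw [h, Finset.sum_congr rfl fun b _ => sum_baseKernel_eq_one (leaf_nonempty hZ hr0
    (by rw [(R b).1.2.2.2]; exact hr))]
  simp [hB]

end Tree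

end DRRF

namespace DRRF

/-! ### Resampling one coordinate of a product measure -/

theorem measurable_update_prod {ι : Type*} [DecidableEq ι] {X : ι → Type*}
    [∀ i, MeasurableSpace (X i)] (i : ι) :
    Measurable fun a : (∀ i, X i) × X i => Function.update a.1 i a.2 := by
  refine measurable_pi_iff.2 fun j => ?_
  by_cases h : j = i
  · subst h
    simpa using measurable_snd
  · simp only [Function.update_of_ne h]
    fun_prop

/-- Resampling a coordinate takes the place of conditioning on all the others. It serves for one
observation (honesty), for one covariate coordinate (slices of a box) and for the variable of one
tree node (split directions). On a finite-dimensional box, coordinate `i` is either constrained and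
contributes its own factor, or free and contributes total mass one. -/
theorem map_update_infinitePi {ι : Type*} [DecidableEq ι] {X : ι → Type*}
    [∀ i, MeasurableSpace (X i)] (μ : ∀ i, Measure (X i)) [∀ i, IsProbabilityMeasure (μ i)]
    (i : ι) :
    ((Measure.infinitePi μ).prod (μ i)).map (fun a => Function.update a.1 i a.2) =
      Measure.infinitePi μ := by
  refine Measure.eq_infinitePi μ fun s t ht => ?_
  rw [Measure.map_apply (measurable_update_prod i) (MeasurableSet.pi s.countable_toSet fun i _ => ht i)]
  by_cases hi : i ∈ s
  · have : (fun a : (∀ i, X i) × X i => Function.update a.1 i a.2) ⁻¹' ((s : Set ι).pi t) =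
        (((s.erase i : Finset ι) : Set ι).pi t) ×ˢ t i := by
      ext a
      simp only [Set.mem_preimage, Set.mem_pi, Set.mem_prod, Finset.coe_erase, Set.mem_sdiff,
        Set.mem_singleton_iff, Finset.mem_coe]
      constructor
      · intro h
        refine ⟨fun j hj => ?_, by simpa using h i hi⟩
        have := h j hj.1
        rwa [Function.update_of_ne hj.2] at this
      · rintro ⟨h1, h2⟩ j hj
        by_cases hji : j = i
        · subst hji; simpa using h2
        · rw [Function.update_of_ne hji]; exact h1 j ⟨hj, hji⟩
    rw [this, Measure.prod_prod, Measure.infinitePi_pi μ fun j _ => ht j, mul_comm,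
      Finset.mul_prod_erase s (fun j => μ j (t j)) hi]
  · have : (fun a : (∀ i, X i) × X i => Function.update a.1 i a.2) ⁻¹' ((s : Set ι).pi t) =
        ((s : Set ι).pi t) ×ˢ Set.univ := by
      ext a
      simp only [Set.mem_preimage, Set.mem_pi, Set.mem_prod, Set.mem_univ, and_true,
        Finset.mem_coe]
      refine forall₂_congr fun j hj => ?_
      rw [Function.update_of_ne (by rintro rfl; exact hi hj)]
    rw [this, Measure.prod_prod, Measure.infinitePi_pi μ fun j _ => ht j, measure_univ, mul_one]

theorem measurePreserving_update_infinitePi {ι : Type*} [DecidableEq ι] {X : ι → Type*}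
    [∀ i, MeasurableSpace (X i)] (μ : ∀ i, Measure (X i)) [∀ i, IsProbabilityMeasure (μ i)]
    (i : ι) :
    MeasurePreserving (fun a : (∀ i, X i) × X i => Function.update a.1 i a.2)
      ((Measure.infinitePi μ).prod (μ i)) (Measure.infinitePi μ) :=
  ⟨measurable_update_prod i, map_update_infinitePi μ i⟩

theorem lintegral_infinitePi_update {ι : Type*} [DecidableEq ι] {X : ι → Type*}
    [∀ i, MeasurableSpace (X i)] (μ : ∀ i, Measure (X i)) [∀ i, IsProbabilityMeasure (μ i)]
    (i : ι) {Φ : (∀ i, X i) → ENNReal} (hΦ : Measurable Φ) :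
    ∫⁻ a, Φ a ∂Measure.infinitePi μ =
      ∫⁻ a, ∫⁻ z, Φ (Function.update a i z) ∂μ i ∂Measure.infinitePi μ := by
  rw [← (measurePreserving_update_infinitePi μ i).lintegral_comp hΦ]
  exact lintegral_prod _ (hΦ.comp (measurable_update_prod i)).aemeasurable

theorem integral_infinitePi_update {ι : Type*} [DecidableEq ι] {X : ι → Type*}
    [∀ i, MeasurableSpace (X i)] (μ : ∀ i, Measure (X i)) [∀ i, IsProbabilityMeasure (μ i)]
    (i : ι) {Φ : (∀ i, X i) → ℝ} (hΦ : Integrable Φ (Measure.infinitePi μ)) :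
    ∫ a, Φ a ∂Measure.infinitePi μ =
      ∫ a, ∫ z, Φ (Function.update a i z) ∂μ i ∂Measure.infinitePi μ := by
  have h := measurePreserving_update_infinitePi μ i
  rw [← integral_prod (f := fun a : (∀ i, X i) × X i => Φ (Function.update a.1 i a.2))
    (h.integrable_comp_of_integrable hΦ)]
  conv_lhs => rw [← h.map_eq]
  refine integral_map h.aemeasurable ?_
  rw [h.map_eq]
  exact hΦ.aestronglyMeasurable

/-! ### Measurability of trees -/

section Measurability

variable {d n s : ℕ} {𝒲 : Type*} {Ω : Type*} [MeasurableSpace Ω]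

theorem measurable_mem_side_true {c : Ω → Split d} (hc : Measurable c) {y : Ω → Cov d}
    (hy : Measurable y) : Measurable fun a => y a ∈ side (c a) true := by
  -- The split feature is itself random; a disjunction over its finitely many values reduces to
  -- fixed coordinates.
  have : (fun a => y a ∈ side (c a) true) = fun a => ∃ j, (c a).1 = j ∧ y a j ≤ (c a).2 := by
    ext a; simp [side]
  rw [this]
  refine Measurable.exists fun j => ?_
  refine Measurable.and ?_ ?_
  · exact measurableSet_setOfPred.1 (measurableSet_eq_fun (measurable_fst.comp hc) measurable_const)
  · exact measurableSet_setOfPred.1 (measurableSet_le (by fun_prop) (measurable_snd.comp hc))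

theorem measurable_mem_side {c : Ω → Split d} (hc : Measurable c) {y : Ω → Cov d}
    (hy : Measurable y) (b : Bool) : Measurable fun a => y a ∈ side (c a) b := by
  cases b
  · have : (fun a => y a ∈ side (c a) false) = fun a => ¬ y a ∈ side (c a) true := by
      ext a; simp [side]
    rw [this]
    exact (measurable_mem_side_true hc hy).not
  · exact measurable_mem_side_true hc hy

theorem measurable_mem_cell {σ : Ω → List Bool → Split d} (hσ : ∀ q, Measurable fun a => σ a q)
    {y : Ω → Cov d} (hy : Measurable y) (q : List Bool) :
    Measurable fun a => y a ∈ cell (σ a) q := by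
  induction q with
  | nil => simp [cell]
  | cons b q ih => exact ih.and (measurable_mem_side (hσ q) hy b)

theorem card_within (Z : Fin n → Obs d 𝒲) (S : Finset (Fin n)) (A : Set (Cov d)) :
    (within Z S A).card = ∑ i ∈ S, A.indicator (fun _ => 1) (Z i).1 := by
  classical
  rw [within, Finset.card_filter]
  simp [Set.indicator_apply]

theorem measurable_card_within (S : Finset (Fin n)) {Z : Ω → Fin n → Obs d 𝒲}
    {A : Ω → Set (Cov d)} (hA : ∀ i, Measurable fun a => (Z a i).1 ∈ A a) :
    Measurable fun a => (within (Z a) S (A a)).card := by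
  classical
  simp only [within, Finset.card_filter]
  exact Finset.measurable_sum _ fun i _ =>
    Measurable.ite (measurableSet_setOfPred.2 (hA i)) measurable_const measurable_const

variable [MeasurableSpace 𝒲] {T : TreeLearner d n s 𝒲}

/-- The splits of a tree learner are measurable. -/
def TreeLearner.Meas (T : TreeLearner d n s 𝒲) : Prop :=
  ∀ S q, Measurable fun a : (Fin n → Obs d 𝒲) × TreeRand => T.split S a.1 a.2 q

theorem measurable_internal (hT : T.Meas) (r : ℕ) (S : Halves n s) (q : List Bool) :
    Measurable fun a : (Fin n → Obs d 𝒲) × TreeRand => T.Internal r S a.1 a.2 q := by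
  refine measurableSet_setOfPred.1 (measurableSet_le measurable_const ?_)
  exact measurable_card_within _ fun i => measurable_mem_cell (hT S) (by fun_prop) q

theorem measurable_mem_leaf (hT : T.Meas) (r : ℕ) (S : Halves n s) (x : Cov d)
    {y : (Fin n → Obs d 𝒲) × TreeRand → Cov d} (hy : Measurable y) :
    Measurable fun a : (Fin n → Obs d 𝒲) × TreeRand => y a ∈ T.leaf r S a.1 a.2 x := by
  refine Measurable.forall fun q => Measurable.imp (measurable_internal hT r S q) ?_
  refine Measurable.imp (measurable_mem_cell (hT S) measurable_const q) ?_
  exact Measurable.iff (measurable_mem_side (hT S q) hy true)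
    (measurable_mem_side (hT S q) measurable_const true)

theorem measurable_baseKernel (hT : T.Meas) (r : ℕ) (S : Halves n s) (x : Cov d) (i : Fin n) :
    Measurable fun a : (Fin n → Obs d 𝒲) × TreeRand => T.baseKernel r S a.1 a.2 x i := by
  have h : ∀ i, Measurable fun a : (Fin n → Obs d 𝒲) × TreeRand =>
      (a.1 i).1 ∈ T.leaf r S a.1 a.2 x := fun i => measurable_mem_leaf hT r S x (by fun_prop)
  unfold TreeLearner.baseKernel
  refine Measurable.ite ?_ ?_ measurable_const
  · simp only [mem_within]
    exact measurableSet_setOfPred.2 (measurable_const.and (h i))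
  · exact (measurable_from_top.comp (measurable_card_within _ h)).inv

theorem measurable_stat (hT : T.Meas) (r : ℕ) (S : Halves n s) (x : Cov d)
    {F : Obs d 𝒲 → ℝ} (hF : Measurable F) :
    Measurable fun a : (Fin n → Obs d 𝒲) × TreeRand => T.stat r S a.1 a.2 x F :=
  Finset.measurable_sum _ fun i _ => (measurable_baseKernel hT r S x i).mul
    (hF.comp ((measurable_pi_apply i).comp measurable_fst))

instance (n s : ℕ) : DiscreteMeasurableSpace (Halves n s) := ⟨fun _ => trivial⟩

instance (n s : ℕ) : Finite (Halves n s) := inferInstanceAs (Finite (Subtype _))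

theorem measurable_kernel (hT : T.Meas) (r : ℕ) {B : ℕ} (x : Cov d) (i : Fin n) :
    Measurable fun ω : HalfSample d n s B 𝒲 => T.kernel r ω.2 ω.1 x i := by
  unfold TreeLearner.kernel
  refine measurable_const.mul (Finset.measurable_sum _ fun b _ => ?_)
  have h : Measurable fun a : Halves n s × ((Fin n → Obs d 𝒲) × TreeRand) =>
      T.baseKernel r a.1 a.2.1 a.2.2 x i :=
    measurable_from_prod_countable_right fun S => measurable_baseKernel hT r S x i
  exact h.comp (f := fun ω : HalfSample d n s B 𝒲 => ((ω.2 b).1, (ω.1, (ω.2 b).2)))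
    (by fun_prop)

end Measurability

/-! ### Locality and honesty -/

section Honesty

variable {d n s p : ℕ} {𝒲 : Type*} {T : TreeLearner d n s 𝒲}

/-- Trees depend only on the observations of `S¹` and the covariates of `S²`. -/
def TreeLearner.Adapted (T : TreeLearner d n s 𝒲) : Prop :=
  ∀ (S : Halves n s) (Z Z' : Fin n → Obs d 𝒲) (ξ ξ' : TreeRand) (q : List Bool),
    (∀ i ∈ S.1.1, Z i = Z' i) → (∀ i ∈ S.1.2, (Z i).1 = (Z' i).1) →
    (∀ q', q' <:+ q → ξ q' = ξ' q') → T.split S Z ξ q = T.split S Z' ξ' q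

theorem within_congr {Z Z' : Fin n → Obs d 𝒲} {S : Finset (Fin n)}
    (h : ∀ i ∈ S, (Z i).1 = (Z' i).1) (A : Set (Cov d)) : within Z S A = within Z' S A := by
  ext i
  simp only [mem_within]
  exact and_congr_right fun hi => by rw [h i hi]

/-- This is honesty: splits read `S¹` and the covariates of `S²`, while node sizes and leaf
membership read covariates of `S²` only. Responses of `S²` never enter the weights. -/
theorem baseKernel_congr (hT : T.Adapted) {S : Halves n s} {Z Z' : Fin n → Obs d 𝒲}
    (h1 : ∀ i ∈ S.1.1, Z i = Z' i) (h2 : ∀ i ∈ S.1.2, (Z i).1 = (Z' i).1) (r : ℕ) (ξ : TreeRand)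
    (x : Cov d) : T.baseKernel r S Z ξ x = T.baseKernel r S Z' ξ x := by
  have hs : T.split S Z ξ = T.split S Z' ξ := by
    ext1 q
    exact hT S Z Z' ξ ξ q h1 h2 fun _ _ => rfl
  have hl : T.leaf r S Z ξ x = T.leaf r S Z' ξ x := by
    simp only [TreeLearner.leaf, TreeLearner.Internal, hs, within_congr h2]
  ext i
  simp only [TreeLearner.baseKernel, hl, within_congr h2]

theorem stat_congr (hT : T.Adapted) {S : Halves n s} {Z Z' : Fin n → Obs d 𝒲}
    (h : ∀ i ∈ S.1.1 ∪ S.1.2, Z i = Z' i) (r : ℕ) (ξ : TreeRand) (x : Cov d) (F : Obs d 𝒲 → ℝ) :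
    T.stat r S Z ξ x F = T.stat r S Z' ξ x F := by
  unfold TreeLearner.stat
  rw [baseKernel_congr hT (fun i hi => h i (Finset.mem_union_left _ hi))
    (fun i hi => by rw [h i (Finset.mem_union_right _ hi)])]
  refine Finset.sum_congr rfl fun i _ => ?_
  by_cases hi : i ∈ S.1.2
  · rw [h i (Finset.mem_union_right _ hi)]
  · rw [baseKernel_eq_zero hi, zero_mul, zero_mul]

variable [MeasurableSpace 𝒲]

theorem isProbabilityMeasure_obsLaw (M : Problem d p 𝒲) [IsMarkovKernel M.condLaw] (f : Cov d → ℝ)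
    [IsProbabilityMeasure (covLaw f)] : IsProbabilityMeasure (M.obsLaw f) := by
  unfold Problem.obsLaw; infer_instance

theorem measurable_cexp (M : Problem d p 𝒲) [IsMarkovKernel M.condLaw] {F : Obs d 𝒲 → ℝ}
    (hF : Measurable F) : Measurable fun x => M.cexp x F :=
  (hF.stronglyMeasurable.integral_kernel_prod_right' (κ := M.condLaw)).measurable

theorem abs_cexp_le (M : Problem d p 𝒲) [IsMarkovKernel M.condLaw] {F : Obs d 𝒲 → ℝ} {c : ℝ}
    (hF : ∀ z, |F z| ≤ c) (x : Cov d) : |M.cexp x F| ≤ c := by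
  have := norm_integral_le_of_norm_le_const (μ := M.condLaw x) (f := fun q => F (x, q)) (C := c)
    (Eventually.of_forall fun q => hF (x, q))
  simpa [Problem.cexp] using this

theorem integrable_of_abs_le {Ω : Type*} [MeasurableSpace Ω] {μ : Measure Ω} [IsFiniteMeasure μ]
    {F : Ω → ℝ} (hF : Measurable F) {c : ℝ} (hc : ∀ z, |F z| ≤ c) : Integrable F μ :=
  Integrable.of_bound hF.aestronglyMeasurable c (Eventually.of_forall hc)

theorem integral_obsLaw (M : Problem d p 𝒲) [IsMarkovKernel M.condLaw] (f : Cov d → ℝ)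
    [IsProbabilityMeasure (covLaw f)] {F : Obs d 𝒲 → ℝ} (hF : Measurable F) {c : ℝ}
    (hc : ∀ z, |F z| ≤ c) : ∫ z, F z ∂M.obsLaw f = ∫ x, M.cexp x F ∂covLaw f := by
  have := isProbabilityMeasure_obsLaw M f
  exact Measure.integral_compProd (integrable_of_abs_le hF hc)

/-- Given the tree, responses are centered at their conditional means. -/
theorem integral_stat_eq (hT : T.Meas) (hA : T.Adapted) (M : Problem d p 𝒲)
    [IsMarkovKernel M.condLaw] (f : Cov d → ℝ) [IsProbabilityMeasure (covLaw f)] (r : ℕ)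
    (S : Halves n s) (ξ : TreeRand) (x : Cov d) {F : Obs d 𝒲 → ℝ} (hF : Measurable F) {c : ℝ}
    (hc : ∀ z, |F z| ≤ c) :
    ∫ Z, T.stat r S Z ξ x F ∂Measure.pi (fun _ : Fin n => M.obsLaw f) =
      ∫ Z, T.stat r S Z ξ x (fun z => M.cexp z.1 F) ∂Measure.pi (fun _ : Fin n => M.obsLaw f) := by
  have := isProbabilityMeasure_obsLaw M f
  have hm : ∀ i, Measurable fun Z : Fin n → Obs d 𝒲 => T.baseKernel r S Z ξ x i := fun i =>
    Measurable.comp (f := fun Z : Fin n → Obs d 𝒲 => (Z, ξ)) (measurable_baseKernel hT r S x i)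
      measurable_prodMk_right
  have hK : ∀ i Z, |T.baseKernel r S Z ξ x i| ≤ 1 := fun i Z => by
    rw [abs_of_nonneg (baseKernel_nonneg i)]
    exact (Finset.single_le_sum (fun j _ => baseKernel_nonneg j) (Finset.mem_univ i)).trans
      sum_baseKernel_le_one
  have hint : ∀ {G : Obs d 𝒲 → ℝ}, Measurable G → (∀ z, |G z| ≤ c) → ∀ i,
      Integrable (fun Z => T.baseKernel r S Z ξ x i * G (Z i))
        (Measure.pi fun _ : Fin n => M.obsLaw f) := fun {G} hG hGc i => by
    refine integrable_of_abs_le (c := 1 * c) ((hm i).mul (hG.comp (measurable_pi_apply i)))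
      fun Z => ?_
    rw [abs_mul]
    exact mul_le_mul (hK i Z) (hGc _) (abs_nonneg _) zero_le_one
  have hFm : Measurable fun z : Obs d 𝒲 => M.cexp z.1 F := (measurable_cexp M hF).comp measurable_fst
  have hFb : ∀ z : Obs d 𝒲, |M.cexp z.1 F| ≤ c := fun z => abs_cexp_le M hc z.1
  unfold TreeLearner.stat
  rw [integral_finsetSum _ fun i _ => hint hF hc i, integral_finsetSum _ fun i _ => hint hFm hFb i]
  refine Finset.sum_congr rfl fun i _ => ?_
  by_cases hi : i ∈ S.1.2
  swap
  · simp [baseKernel_eq_zero hi]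
  have h1 := hint hF hc i
  have h2 := hint hFm hFb i
  rw [← Measure.infinitePi_eq_pi] at h1 h2 ⊢
  rw [integral_infinitePi_update _ i h1, integral_infinitePi_update _ i h2]
  congr 1
  ext Z
  have hi1 : i ∉ S.1.1 := fun h => Finset.disjoint_left.1 S.2.1 h hi
  simp only [Function.update_self]
  -- A dummy response `q₀` allows the weight to be written as a function of the covariate alone.
  rcases isEmpty_or_nonempty (ℝ × 𝒲) with he | ⟨⟨q₀⟩⟩
  · have : IsEmpty (Obs d 𝒲) := ⟨fun z => he.elim z.2⟩
    rw [integral_of_isEmpty, integral_of_isEmpty]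
  -- Observation `i` lies in `S²`, hence not in `S¹`, and the weight ignores its response.
  -- Integrating the response first then replaces `F` by its conditional mean.
  have hk : ∀ z : Obs d 𝒲, T.baseKernel r S (Function.update Z i z) ξ x i =
      T.baseKernel r S (Function.update Z i (z.1, q₀)) ξ x i := by
    intro z
    rw [baseKernel_congr hA]
    · intro j hj
      rw [Function.update_of_ne (by rintro rfl; exact hi1 hj),
        Function.update_of_ne (by rintro rfl; exact hi1 hj)]
    · intro j hj
      by_cases hji : j = i
      · subst hji; simp
      · rw [Function.update_of_ne hji, Function.update_of_ne hji]
  have hup : ∀ z : Obs d 𝒲 → Obs d 𝒲, Measurable z → Measurable fun a => Function.update Z i (z a) :=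
    fun z hz => (measurable_update Z).comp hz
  have hκ : Measurable fun z : Obs d 𝒲 =>
      T.baseKernel r S (Function.update Z i (z.1, q₀)) ξ x i :=
    (hm i).comp (hup _ (by fun_prop))
  have hprod : ∀ {G : Obs d 𝒲 → ℝ}, Measurable G → (∀ z, |G z| ≤ c) →
      ∫ z, T.baseKernel r S (Function.update Z i z) ξ x i * G z ∂M.obsLaw f =
        ∫ x', T.baseKernel r S (Function.update Z i (x', q₀)) ξ x i * M.cexp x' G ∂covLaw f := by
    intro G hG hGc
    have h0 : (fun z => T.baseKernel r S (Function.update Z i z) ξ x i * G z) =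
        fun z => T.baseKernel r S (Function.update Z i (z.1, q₀)) ξ x i * G z :=
      funext fun z => congrArg (· * G z) (hk z)
    rw [h0]
    refine (integral_obsLaw M f (c := 1 * c) (hκ.mul hG) fun z => ?_).trans ?_
    · rw [Pi.mul_apply, abs_mul]
      exact mul_le_mul (hK i _) (hGc _) (abs_nonneg _) zero_le_one
    · congr 1
      ext x'
      simp only [Problem.cexp, Pi.mul_apply]
      rw [integral_const_mul]
  rw [hprod hF hc, hprod hFm hFb]
  congr 1
  ext x'
  congr 1
  simp [Problem.cexp]

end Honesty

end DRRF

/-! ### Exponential moments of bounded variables. -/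

namespace DRRF

/-- Hoeffding's lemma: half the length of `[-c, c]` is `c`, so the variance proxy about the mean is
`c ^ 2`. -/
theorem integral_exp_le_of_abs_le {Ω : Type*} [MeasurableSpace Ω] {μ : Measure Ω}
    [IsProbabilityMeasure μ] {X : Ω → ℝ} (hX : Measurable X) {c : ℝ} (hc : ∀ a, |X a| ≤ c)
    (θ : ℝ) : ∫ a, Real.exp (θ * X a) ∂μ ≤ Real.exp (θ * ∫ a, X a ∂μ + c ^ 2 * θ ^ 2 / 2) := by
  have hΩ : Nonempty Ω := μ.nonempty_of_neZero
  have hc0 : 0 ≤ c := (abs_nonneg _).trans (hc hΩ.some)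
  have h := hasSubgaussianMGF_of_mem_Icc (μ := μ) hX.aemeasurable
    (Eventually.of_forall fun a => abs_le.1 (hc a))
  have h1 := h.mgf_le θ
  have hn : (((‖c - -c‖₊ / 2) ^ 2 : NNReal) : ℝ) = c ^ 2 := by
    push_cast
    rw [Real.norm_eq_abs, sub_neg_eq_add, abs_of_nonneg (by linarith)]
    ring
  rw [hn] at h1
  unfold mgf at h1
  have : ∀ a, Real.exp (θ * X a) =
      Real.exp (θ * ∫ a, X a ∂μ) * Real.exp (θ * (X a - ∫ a, X a ∂μ)) := fun a => by
    rw [← Real.exp_add]; ring_nf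
  simp_rw [this]
  rw [integral_const_mul, Real.exp_add]
  exact mul_le_mul_of_nonneg_left h1 (Real.exp_pos _).le

theorem integrable_exp_of_abs_le {Ω : Type*} [MeasurableSpace Ω] {μ : Measure Ω}
    [IsFiniteMeasure μ] {X : Ω → ℝ} (hX : Measurable X) {c : ℝ} (hc : ∀ a, |X a| ≤ c)
    (θ : ℝ) : Integrable (fun a => Real.exp (θ * X a)) μ := by
  refine integrable_of_abs_le (c := Real.exp (|θ| * c)) (by fun_prop) fun a => ?_
  rw [abs_of_pos (Real.exp_pos _)]
  refine Real.exp_le_exp.2 ((le_abs_self _).trans ?_)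
  rw [abs_mul]
  exact mul_le_mul_of_nonneg_left (hc a) (abs_nonneg _)

/-! ### Permutations of partitioned subsamples -/

section Perm

variable {n s : ℕ}

/-- The image of a partitioned subsample under a permutation. -/
def Halves.perm (σ : Equiv.Perm (Fin n)) (S : Halves n s) : Halves n s :=
  ⟨(S.1.1.map σ.toEmbedding, S.1.2.map σ.toEmbedding),
    (Finset.disjoint_map _).2 S.2.1, by simpa using S.2.2.1, by simpa using S.2.2.2⟩

theorem Halves.perm_mul (σ τ : Equiv.Perm (Fin n)) (S : Halves n s) :
    Halves.perm (σ * τ) S = Halves.perm σ (Halves.perm τ S) := by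
  refine Subtype.ext (Prod.ext ?_ ?_) <;> simp [Halves.perm, Finset.map_map] <;> rfl

theorem Halves.perm_bijective (σ : Equiv.Perm (Fin n)) :
    Function.Bijective (Halves.perm σ : Halves n s → Halves n s) := by
  rw [← Finite.injective_iff_bijective]
  intro S S' h
  have h1 := congrArg (Halves.perm σ⁻¹) h
  rw [← Halves.perm_mul, ← Halves.perm_mul, inv_mul_cancel] at h1
  have h2 : ∀ S : Halves n s, Halves.perm 1 S = S := fun S => by
    refine Subtype.ext (Prod.ext ?_ ?_) <;> ext <;> simp [Halves.perm, ← Equiv.Perm.inv_def]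
  rwa [h2, h2] at h1

open scoped Classical in
/-- The part of a partitioned subsample to which an index belongs. -/
noncomputable def Halves.color (S : Halves n s) (i : Fin n) : Fin 3 :=
  if i ∈ S.1.1 then 0 else if i ∈ S.1.2 then 1 else 2

theorem Halves.color_eq_zero (S : Halves n s) (i : Fin n) : S.color i = 0 ↔ i ∈ S.1.1 := by
  unfold Halves.color
  split_ifs <;> simp_all

theorem Halves.color_eq_one (S : Halves n s) (i : Fin n) : S.color i = 1 ↔ i ∈ S.1.2 := by
  unfold Halves.color
  split_ifs with h1 h2
  · simpa using Finset.disjoint_left.1 S.2.1 h1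
  · simp_all
  · simp_all

theorem Halves.color_eq_two (S : Halves n s) (i : Fin n) :
    S.color i = 2 ↔ i ∈ (S.1.1 ∪ S.1.2)ᶜ := by
  unfold Halves.color
  split_ifs <;> simp_all

/-- A partitioned subsample is a colouring of the indices by three colours with prescribed class
sizes. Bijections between classes of the same colour, glued along the fibres, form the permutation.
-/
theorem Halves.exists_perm (S S' : Halves n s) : ∃ σ, Halves.perm σ S = S' := by
  classical
  have hcard : ∀ y, Nat.card {i // S.color i = y} = Nat.card {i // S'.color i = y} := by
    intro y
    fin_cases y
    · have h : ∀ S : Halves n s, Nat.card {i // S.color i = 0} = s / 2 := fun S => by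
        simp only [Halves.color_eq_zero]
        simpa using S.2.2.1
      exact (h S).trans (h S').symm
    · have h : ∀ S : Halves n s, Nat.card {i // S.color i = 1} = s - s / 2 := fun S => by
        simp only [Halves.color_eq_one]
        simpa using S.2.2.2
      exact (h S).trans (h S').symm
    · have h : ∀ S : Halves n s, Nat.card {i // S.color i = 2} = n - (s / 2 + (s - s / 2)) :=
        fun S => by
          simp only [Halves.color_eq_two]
          rw [Nat.card_eq_fintype_card, Fintype.card_coe, Finset.card_compl,
            Finset.card_union_of_disjoint S.2.1, S.2.2.1, S.2.2.2, Fintype.card_fin]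
      exact (h S).trans (h S').symm
  let e : ∀ y, {i // S.color i = y} ≃ {i // S'.color i = y} := fun y =>
    (Finite.card_eq.1 (hcard y)).some
  let σ : Equiv.Perm (Fin n) := (Equiv.sigmaFiberEquiv S.color).symm.trans
    ((Equiv.sigmaCongrRight e).trans (Equiv.sigmaFiberEquiv S'.color))
  have hσ : ∀ i, S'.color (σ i) = S.color i := fun i => (e _ ⟨i, rfl⟩).2
  refine ⟨σ, Subtype.ext (Prod.ext ?_ ?_)⟩
  · ext i
    obtain ⟨i, rfl⟩ := σ.surjective i
    have h : σ i ∈ S'.1.1 ↔ i ∈ S.1.1 := by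
      rw [← Halves.color_eq_zero, hσ, Halves.color_eq_zero]
    rw [h]
    simp [Halves.perm]
  · ext i
    obtain ⟨i, rfl⟩ := σ.surjective i
    have h : σ i ∈ S'.1.2 ↔ i ∈ S.1.2 := by
      rw [← Halves.color_eq_one, hσ, Halves.color_eq_one]
    rw [h]
    simp [Halves.perm]

/-- By transitivity the sum over permutations does not depend on the starting subsample. Summing
over all starting points and exchanging the sums identifies it, each permutation acting bijectively.
This is Hoeffding's representation of a U-statistic. -/
theorem Halves.average_perm [Fintype (Halves n s)] (f : Halves n s → ℝ) (S : Halves n s) :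
    (Fintype.card (Equiv.Perm (Fin n)) : ℝ)⁻¹ * ∑ σ, f (Halves.perm σ S) =
      (Fintype.card (Halves n s) : ℝ)⁻¹ * ∑ S', f S' := by
  have h1 : ∀ S', ∑ σ, f (Halves.perm σ S') = ∑ σ, f (Halves.perm σ S) := fun S' => by
    obtain ⟨τ, rfl⟩ := Halves.exists_perm S S'
    simp_rw [← Halves.perm_mul]
    exact Equiv.sum_comp (Equiv.mulRight τ) fun σ => f (Halves.perm σ S)
  have h2 : ∑ S', ∑ σ, f (Halves.perm σ S') =
      (Fintype.card (Equiv.Perm (Fin n)) : ℝ) * ∑ S', f S' := by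
    rw [Finset.sum_comm]
    rw [Finset.sum_congr rfl fun σ _ => (Halves.perm_bijective σ).sum_comp f]
    simp
  rw [Finset.sum_congr rfl fun S' _ => h1 S'] at h2
  simp only [Finset.sum_const, Finset.card_univ, nsmul_eq_mul] at h2
  have h3 : (Fintype.card (Equiv.Perm (Fin n)) : ℝ) ≠ 0 := by positivity
  have h4 : (Fintype.card (Halves n s) : ℝ) ≠ 0 := by
    have : Nonempty (Halves n s) := ⟨S⟩
    positivity
  field_simp
  linarith

/-- Consecutive disjoint subsamples. -/
def Halves.block {K : ℕ} (h : K * s ≤ n) (k : Fin K) : Halves n s :=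
  have hb : k * s + s ≤ n := by
    have : (k : ℕ) + 1 ≤ K := k.2
    calc k * s + s = (k + 1) * s := by ring
      _ ≤ K * s := Nat.mul_le_mul_right _ this
      _ ≤ n := h
  ⟨((Finset.Ico (k * s) (k * s + s / 2)).attachFin fun i hi => by
      rw [Finset.mem_Ico] at hi; omega,
    (Finset.Ico (k * s + s / 2) (k * s + s)).attachFin fun i hi => by
      rw [Finset.mem_Ico] at hi; omega), by
    rw [Finset.disjoint_left]
    intro i h1 h2
    simp only [Finset.mem_attachFin, Finset.mem_Ico] at h1 h2
    omega, by simp, by simp; omega⟩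

/-- All indices of a partitioned subsample. -/
def Halves.all (S : Halves n s) : Finset (Fin n) := S.1.1 ∪ S.1.2

theorem Halves.mem_all_block {K : ℕ} (h : K * s ≤ n) (k : Fin K) {i : Fin n}
    (hi : i ∈ (Halves.block h k).all) : (i : ℕ) / s = k := by
  simp only [Halves.all, Halves.block, Finset.mem_union, Finset.mem_attachFin,
    Finset.mem_Ico] at hi
  have : 0 < s := by omega
  rw [Nat.div_eq_iff this]
  constructor
  · omega
  · omega

theorem Halves.all_perm (σ : Equiv.Perm (Fin n)) (S : Halves n s) :
    (Halves.perm σ S).all = S.all.map σ.toEmbedding := by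
  simp [Halves.all, Halves.perm, Finset.map_union]

theorem Halves.disjoint_all_block {K : ℕ} (h : K * s ≤ n) (σ : Equiv.Perm (Fin n)) {k k' : Fin K}
    (hk : k ≠ k') :
    Disjoint (Halves.perm σ (Halves.block h k)).all (Halves.perm σ (Halves.block h k')).all := by
  rw [Halves.all_perm, Halves.all_perm, Finset.disjoint_map, Finset.disjoint_left]
  intro i hi hi'
  exact hk (Fin.ext ((Halves.mem_all_block h k hi).symm.trans (Halves.mem_all_block h k' hi')))

end Perm

/-! ### Functions of disjoint groups of coordinates -/

section Disjoint

variable {n : ℕ} {E : Type*} [MeasurableSpace E] {μ : Measure E} [IsProbabilityMeasure μ]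

/-- A function of the coordinates in `A` only. -/
def DependsOnly (A : Finset (Fin n)) (f : (Fin n → E) → ℝ) : Prop :=
  ∀ Z Z' : Fin n → E, (∀ i ∈ A, Z i = Z' i) → f Z = f Z'

theorem integral_mul_of_dependsOnly {A A' : Finset (Fin n)} (hAA' : Disjoint A A')
    {f g : (Fin n → E) → ℝ} (hf : Measurable f) (hg : Measurable g) (hfA : DependsOnly A f)
    (hgA : DependsOnly A' g) :
    ∫ Z, f Z * g Z ∂Measure.pi (fun _ : Fin n => μ) =
      (∫ Z, f Z ∂Measure.pi fun _ : Fin n => μ) * ∫ Z, g Z ∂Measure.pi fun _ : Fin n => μ := by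
  classical
  have hE : Nonempty E := μ.nonempty_of_neZero
  have hind : iIndepFun (fun i (Z : Fin n → E) => Z i) (Measure.pi fun _ : Fin n => μ) :=
    iIndepFun_pi (X := fun _ => id) fun _ => aemeasurable_id
  have h2 := hind.indepFun_finset A A' hAA' fun i => measurable_pi_apply i
  -- Filling the coordinates outside `B` with a default value makes a function that depends only on
  -- `B` factor through the coordinates in `B`, where independence of disjoint families applies.
  let ext : (B : Finset (Fin n)) → (B → E) → Fin n → E := fun B y i =>
    if h : i ∈ B then y ⟨i, h⟩ else hE.some
  have hext : ∀ B, Measurable (ext B) := fun B => by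
    refine measurable_pi_iff.2 fun i => ?_
    by_cases h : i ∈ B
    · simpa [ext, h] using measurable_pi_apply (X := fun _ : B => E) ⟨i, h⟩
    · simp [ext, h]
  have hfe : ∀ {B : Finset (Fin n)} {f : (Fin n → E) → ℝ}, DependsOnly B f →
      ∀ Z, f (ext B fun i => Z i) = f Z := fun {B f} hf Z => hf _ _ fun i hi => by simp [ext, hi]
  have h3 := h2.comp (hf.comp (hext A)) (hg.comp (hext A'))
  have h4 := h3.integral_fun_mul_eq_mul_integral
    ((hf.comp (hext A)).comp (by fun_prop)).aestronglyMeasurable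
    ((hg.comp (hext A')).comp (by fun_prop)).aestronglyMeasurable
  simpa [Function.comp_def, hfe hfA, hfe hgA] using h4

theorem integral_prod_of_dependsOnly {κ : Type*} [DecidableEq κ] (A : κ → Finset (Fin n))
    (hA : Pairwise fun k k' => Disjoint (A k) (A k')) (f : κ → (Fin n → E) → ℝ)
    (hf : ∀ k, Measurable (f k)) (hfA : ∀ k, DependsOnly (A k) (f k)) (I : Finset κ) :
    ∫ Z, ∏ k ∈ I, f k Z ∂Measure.pi (fun _ : Fin n => μ) =
      ∏ k ∈ I, ∫ Z, f k Z ∂Measure.pi fun _ : Fin n => μ := by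
  induction I using Finset.induction_on with
  | empty => simp
  | insert k I hk ih =>
    simp only [Finset.prod_insert hk]
    rw [← ih]
    refine integral_mul_of_dependsOnly (A := A k) (A' := I.biUnion A) ?_ (hf k)
      (Finset.measurable_fun_prod _ fun k _ => hf k) (hfA k) ?_
    · rw [Finset.disjoint_biUnion_right]
      exact fun k' hk' => hA (by rintro rfl; exact hk hk')
    · intro Z Z' h
      exact Finset.prod_congr rfl fun k' hk' => hfA k' _ _ fun i hi =>
        h i (Finset.mem_biUnion.2 ⟨k', hk', hi⟩)

variable {s : ℕ}

/-- Exponential moments of complete averages over subsamples. -/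
theorem integral_exp_average_le [Fintype (Halves n s)] {K : ℕ} (hK : K ≠ 0) (hKs : K * s ≤ n)
    {τ : Halves n s → (Fin n → E) → ℝ} (hτ : ∀ S, Measurable (τ S)) {c b θ : ℝ} (hθ : 0 ≤ θ)
    (hc : ∀ S Z, |τ S Z| ≤ c) (hloc : ∀ S, DependsOnly S.all (τ S))
    (hb : ∀ S, ∫ Z, τ S Z ∂Measure.pi (fun _ : Fin n => μ) ≤ b) :
    ∫ Z, Real.exp (θ * ((Fintype.card (Halves n s) : ℝ)⁻¹ * ∑ S, τ S Z))
        ∂Measure.pi (fun _ : Fin n => μ) ≤ Real.exp (θ * b + c ^ 2 * θ ^ 2 / (2 * K)) := by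
  classical
  have hK0 : (K : ℝ) ≠ 0 := by exact_mod_cast hK
  set P : ℝ := (Fintype.card (Equiv.Perm (Fin n)) : ℝ) with hP
  have hP0 : 0 < P := by positivity
  -- For fixed `σ` this is a mean over `K` disjoint blocks, hence over independent terms. Averaging
  -- it over `σ` recovers the complete average.
  let X : Equiv.Perm (Fin n) → (Fin n → E) → ℝ := fun σ Z =>
    ∑ k : Fin K, (K : ℝ)⁻¹ * τ (Halves.perm σ (Halves.block hKs k)) Z
  have hXm : ∀ σ, Measurable (X σ) := fun σ =>
    Finset.measurable_sum _ fun k _ => (hτ _).const_mul _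
  have hXc : ∀ σ Z, |X σ Z| ≤ K * ((K : ℝ)⁻¹ * c) := fun σ Z => by
    refine (Finset.abs_sum_le_sum_abs _ _).trans ?_
    refine (Finset.sum_le_sum (g := fun _ => (K : ℝ)⁻¹ * c) fun k _ => ?_).trans (le_of_eq ?_)
    · rw [abs_mul, abs_of_nonneg (by positivity)]
      exact mul_le_mul_of_nonneg_left (hc _ _) (by positivity)
    · simp
  have havg : ∀ Z, (Fintype.card (Halves n s) : ℝ)⁻¹ * ∑ S, τ S Z = ∑ σ, P⁻¹ • X σ Z := fun Z => by
    have h1 : ∀ k, P⁻¹ * ∑ σ, τ (Halves.perm σ (Halves.block hKs k)) Z =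
        (Fintype.card (Halves n s) : ℝ)⁻¹ * ∑ S, τ S Z := fun k =>
      Halves.average_perm (fun S => τ S Z) _
    simp only [X, smul_eq_mul, Finset.mul_sum]
    rw [Finset.sum_comm]
    have h2 : ∀ k : Fin K, ∑ σ, P⁻¹ * ((K : ℝ)⁻¹ * τ (Halves.perm σ (Halves.block hKs k)) Z) =
        (K : ℝ)⁻¹ * ((Fintype.card (Halves n s) : ℝ)⁻¹ * ∑ S, τ S Z) := fun k => by
      rw [← h1 k, Finset.mul_sum, Finset.mul_sum]
      exact Finset.sum_congr rfl fun σ _ => by ring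
    rw [Finset.sum_congr rfl fun k _ => h2 k]
    simp only [Finset.sum_const, Finset.card_univ, Fintype.card_fin, nsmul_eq_mul]
    rw [mul_inv_cancel_left₀ hK0, Finset.mul_sum]
  -- Jensen's inequality moves the exponential inside the average over permutations, whose terms
  -- depend on one another.
  have hjen : ∀ Z, Real.exp (θ * ((Fintype.card (Halves n s) : ℝ)⁻¹ * ∑ S, τ S Z)) ≤
      ∑ σ, P⁻¹ * Real.exp (θ * X σ Z) := fun Z => by
    rw [havg, Finset.mul_sum]
    have := convexOn_exp.map_sum_le (t := Finset.univ) (w := fun _ : Equiv.Perm (Fin n) => P⁻¹)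
      (p := fun σ => θ * X σ Z) (fun _ _ => by positivity) (by simp [hP]) (fun _ _ => Set.mem_univ _)
    refine le_trans (le_of_eq ?_) this
    congr 1
    exact Finset.sum_congr rfl fun σ _ => by simp only [smul_eq_mul]; ring
  -- The `K` independent factors each have parameter `θ / K`, so the quadratic terms add up to `c ^
  -- 2 * θ ^ 2 / (2 * K)`.
  have hexp : ∀ σ, ∫ Z, Real.exp (θ * X σ Z) ∂Measure.pi (fun _ : Fin n => μ) ≤
      Real.exp (θ * b + c ^ 2 * θ ^ 2 / (2 * K)) := fun σ => by
    have h1 : ∀ Z, Real.exp (θ * X σ Z) = ∏ k : Fin K,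
        Real.exp ((θ * (K : ℝ)⁻¹) * τ (Halves.perm σ (Halves.block hKs k)) Z) := fun Z => by
      rw [← Real.exp_sum, Finset.mul_sum]
      congr 1
      exact Finset.sum_congr rfl fun k _ => by ring
    simp_rw [h1]
    rw [integral_prod_of_dependsOnly (fun k => (Halves.perm σ (Halves.block hKs k)).all)
      (fun k k' hk => Halves.disjoint_all_block hKs σ hk) _ (fun k => by have := hτ (Halves.perm σ (Halves.block hKs k)); fun_prop)
      (fun k Z Z' h => by rw [hloc _ Z Z' h])]
    refine (Finset.prod_le_prod (fun k _ => integral_nonneg fun _ => (Real.exp_pos _).le)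
      fun k _ => (integral_exp_le_of_abs_le (hτ _) (hc _) _).trans
        (Real.exp_le_exp.2 (add_le_add_left (mul_le_mul_of_nonneg_left (hb _)
          (by positivity)) _))).trans ?_
    rw [← Real.exp_sum]
    refine Real.exp_le_exp.2 (le_of_eq ?_)
    simp only [Finset.sum_const, Finset.card_univ, Fintype.card_fin, nsmul_eq_mul]
    field_simp
  calc _ ≤ ∫ Z, ∑ σ, P⁻¹ * Real.exp (θ * X σ Z) ∂Measure.pi (fun _ : Fin n => μ) := by
        refine integral_mono_of_nonneg (Eventually.of_forall fun _ => (Real.exp_pos _).le)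
          (integrable_finsetSum _ fun σ _ =>
            (integrable_exp_of_abs_le (hXm σ) (hXc σ) θ).const_mul _) (Eventually.of_forall hjen)
    _ = ∑ σ, P⁻¹ * ∫ Z, Real.exp (θ * X σ Z) ∂Measure.pi (fun _ : Fin n => μ) := by
        rw [integral_finsetSum _ fun σ _ =>
            (integrable_exp_of_abs_le (hXm σ) (hXc σ) θ).const_mul _]
        simp_rw [integral_const_mul]
    _ ≤ ∑ σ : Equiv.Perm (Fin n), P⁻¹ * Real.exp (θ * b + c ^ 2 * θ ^ 2 / (2 * K)) :=
        Finset.sum_le_sum fun σ _ => mul_le_mul_of_nonneg_left (hexp σ) (by positivity)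
    _ = _ := by
        simp only [Finset.sum_const, Finset.card_univ, nsmul_eq_mul]
        rw [← hP, mul_inv_cancel_left₀ hP0.ne']

end Disjoint

end DRRF

namespace DRRF

/-! ### Concentration of forest averages. -/

section ForestTail

variable {d n s p : ℕ} {𝒲 : Type*}

/-- The law of the internal randomness used to grow a tree. -/
noncomputable abbrev treeLaw : Measure TreeRand :=
  Measure.infinitePi fun _ : List Bool => (volume : Measure unitInterval)

theorem integral_uniformOn_univ {α : Type*} [Fintype α] [Nonempty α] [MeasurableSpace α]
    [MeasurableSingletonClass α] (g : α → ℝ) :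
    ∫ a, g a ∂uniformOn (Set.univ : Set α) = (Fintype.card α : ℝ)⁻¹ * ∑ a, g a := by
  have h : uniformOn (Set.univ : Set α) = (Fintype.card α : ENNReal)⁻¹ • Measure.count := by
    ext A hA
    rw [uniformOn_univ, Measure.smul_apply, smul_eq_mul, ENNReal.div_eq_inv_mul]
  rw [h, integral_smul_measure, integral_count]
  simp

theorem halves_nonempty (h : s ≤ n) : Nonempty (Halves n s) :=
  ⟨Halves.block (K := 1) (by simpa using h) 0⟩

theorem isProbabilityMeasure_uniformOn_halves (h : s ≤ n) :
    IsProbabilityMeasure (uniformOn (Set.univ : Set (Halves n s))) := by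
  have := halves_nonempty h
  exact isProbabilityMeasure_uniformOn Set.finite_univ Set.univ_nonempty

theorem isProbabilityMeasure_forestRandLaw (h : s ≤ n) (B : ℕ) :
    IsProbabilityMeasure (forestRandLaw n s B) := by
  have := isProbabilityMeasure_uniformOn_halves h
  unfold forestRandLaw
  infer_instance

variable [MeasurableSpace 𝒲] {T : TreeLearner d n s 𝒲}

theorem isProbabilityMeasure_halfLaw (h : s ≤ n) (M : Problem d p 𝒲) [IsMarkovKernel M.condLaw]
    (f : Cov d → ℝ) [IsProbabilityMeasure (covLaw f)] (B : ℕ) :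
    IsProbabilityMeasure (halfLaw M f n s B) := by
  have := isProbabilityMeasure_obsLaw M f
  have := isProbabilityMeasure_forestRandLaw h B
  unfold halfLaw
  infer_instance

/-- There are two sources of randomness. Given the data the trees are i.i.d., and Hoeffding's lemma
costs `c ^ 2 * θ ^ 2 / (2 * B)`. Their conditional mean is a complete average over subsamples of a
function of the `s` observations in each, which costs `c ^ 2 * θ ^ 2 / (2 * K)`. -/
theorem integral_exp_forest_le (hT : T.Meas) (hA : T.Adapted) (M : Problem d p 𝒲)
    [IsMarkovKernel M.condLaw] (f : Cov d → ℝ) [IsProbabilityMeasure (covLaw f)] (r : ℕ)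
    (x : Cov d) {F : Obs d 𝒲 → ℝ} (hF : Measurable F) {c b θ : ℝ} (hc : 0 ≤ c)
    (hFc : ∀ z, |F z| ≤ c) (hθ : 0 ≤ θ) {B K : ℕ} (hB : B ≠ 0) (hK : K ≠ 0) (hs : s ≤ n)
    (hKs : K * s ≤ n)
    (hb : ∀ S, ∫ Z, ∫ ξ, T.stat r S Z ξ x F ∂treeLaw ∂Measure.pi (fun _ : Fin n => M.obsLaw f) ≤ b) :
    ∫ ω, Real.exp (θ * ∑ i, T.kernel r ω.2 ω.1 x i * F (ω.1 i)) ∂halfLaw M f n s B ≤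
      Real.exp (θ * b + c ^ 2 * θ ^ 2 / 2 * ((B : ℝ)⁻¹ + (K : ℝ)⁻¹)) := by
  have := isProbabilityMeasure_obsLaw M f
  have := isProbabilityMeasure_uniformOn_halves hs
  have := isProbabilityMeasure_forestRandLaw hs B
  have := isProbabilityMeasure_halfLaw hs M f B
  have := halves_nonempty hs
  have := Fintype.ofFinite (Halves n s)
  have hB0 : (B : ℝ) ≠ 0 := by exact_mod_cast hB
  have hK0 : (K : ℝ) ≠ 0 := by exact_mod_cast hK
  have hst : ∀ S, Measurable fun a : (Fin n → Obs d 𝒲) × TreeRand => T.stat r S a.1 a.2 x F :=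
    fun S => measurable_stat hT r S x hF
  have hsc : ∀ S Z ξ, |T.stat r S Z ξ x F| ≤ c := fun S Z ξ => abs_stat_le hc hFc
  let τ : Halves n s → (Fin n → Obs d 𝒲) → ℝ := fun S Z => ∫ ξ, T.stat r S Z ξ x F ∂treeLaw
  have hτm : ∀ S, Measurable (τ S) := fun S =>
    (hst S).stronglyMeasurable.integral_prod_right'.measurable
  have hτc : ∀ S Z, |τ S Z| ≤ c := fun S Z => by
    simpa using norm_integral_le_of_norm_le_const (μ := treeLaw)
      (f := fun ξ => T.stat r S Z ξ x F) (C := c) (Eventually.of_forall fun ξ => hsc S Z ξ)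
  have hjoint : ∀ Z, Measurable fun a : Halves n s × TreeRand => T.stat r a.1 Z a.2 x F := fun Z =>
    measurable_from_prod_countable_right fun S =>
      Measurable.comp (f := fun ξ : TreeRand => (Z, ξ)) (hst S) measurable_prodMk_left
  have hkm : Measurable fun ω : HalfSample d n s B 𝒲 => ∑ i, T.kernel r ω.2 ω.1 x i * F (ω.1 i) :=
    Finset.measurable_sum _ fun i _ => (measurable_kernel hT r x i).mul
      (hF.comp ((measurable_pi_apply i).comp measurable_fst))
  have hkc : ∀ ω : HalfSample d n s B 𝒲, |∑ i, T.kernel r ω.2 ω.1 x i * F (ω.1 i)| ≤ c := fun ω => by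
    rw [sum_kernel_mul, abs_mul, abs_of_nonneg (by positivity)]
    refine (mul_le_mul_of_nonneg_left ((Finset.abs_sum_le_sum_abs _ _).trans
      (Finset.sum_le_sum (g := fun _ => c) fun b _ => hsc _ _ _)) (by positivity)).trans (le_of_eq ?_)
    simp [hB0]
  have hmean : ∀ Z, ∫ a, T.stat r a.1 Z a.2 x F
      ∂(uniformOn (Set.univ : Set (Halves n s))).prod treeLaw =
      (Fintype.card (Halves n s) : ℝ)⁻¹ * ∑ S, τ S Z := fun Z => by
    rw [integral_prod _ (integrable_of_abs_le (hjoint Z) fun a => hsc _ _ _),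
      integral_uniformOn_univ]
  have hcond : ∀ Z, ∫ R, Real.exp (θ * ∑ i, T.kernel r R Z x i * F (Z i)) ∂forestRandLaw n s B ≤
      Real.exp (c ^ 2 * θ ^ 2 / 2 * (B : ℝ)⁻¹) *
        Real.exp (θ * ((Fintype.card (Halves n s) : ℝ)⁻¹ * ∑ S, τ S Z)) := fun Z => by
    have h1 : ∀ R : ForestRand n s B, Real.exp (θ * ∑ i, T.kernel r R Z x i * F (Z i)) =
        ∏ b, Real.exp ((θ * (B : ℝ)⁻¹) * T.stat r (R b).1 Z (R b).2 x F) := fun R => by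
      rw [← Real.exp_sum, sum_kernel_mul, ← mul_assoc, Finset.mul_sum]
    simp_rw [h1]
    unfold forestRandLaw
    rw [integral_fintype_prod_eq_prod (𝕜 := ℝ) (fun (_ : Fin B) (a : Halves n s × TreeRand) =>
      Real.exp ((θ * (B : ℝ)⁻¹) * T.stat r a.1 Z a.2 x F))]
    refine (Finset.prod_le_prod (fun k _ => integral_nonneg fun _ => (Real.exp_pos _).le)
      fun k _ => integral_exp_le_of_abs_le (hjoint Z) (fun _ => hsc _ _ _) _).trans ?_
    rw [hmean, ← Real.exp_sum, ← Real.exp_add]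
    refine Real.exp_le_exp.2 (le_of_eq ?_)
    simp only [Finset.sum_const, Finset.card_univ, Fintype.card_fin, nsmul_eq_mul]
    field_simp
    ring
  unfold halfLaw at *
  rw [integral_prod _ (integrable_exp_of_abs_le hkm hkc θ)]
  have havgm : Measurable fun Z => (Fintype.card (Halves n s) : ℝ)⁻¹ * ∑ S, τ S Z := by fun_prop
  have havgc : ∀ Z, |(Fintype.card (Halves n s) : ℝ)⁻¹ * ∑ S, τ S Z| ≤ c := fun Z => by
    rw [abs_mul, abs_of_nonneg (by positivity)]
    refine (mul_le_mul_of_nonneg_left ((Finset.abs_sum_le_sum_abs _ _).trans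
      (Finset.sum_le_sum (g := fun _ => c) fun b _ => hτc _ _)) (by positivity)).trans (le_of_eq ?_)
    simp
  calc _ ≤ ∫ Z, Real.exp (c ^ 2 * θ ^ 2 / 2 * (B : ℝ)⁻¹) *
        Real.exp (θ * ((Fintype.card (Halves n s) : ℝ)⁻¹ * ∑ S, τ S Z))
          ∂Measure.pi (fun _ : Fin n => M.obsLaw f) :=
        integral_mono_of_nonneg
          (Eventually.of_forall fun Z => integral_nonneg fun _ => (Real.exp_pos _).le)
          ((integrable_exp_of_abs_le havgm havgc θ).const_mul _) (Eventually.of_forall hcond)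
    _ ≤ Real.exp (c ^ 2 * θ ^ 2 / 2 * (B : ℝ)⁻¹) *
          Real.exp (θ * b + c ^ 2 * θ ^ 2 / (2 * K)) := by
        rw [integral_const_mul]
        refine mul_le_mul_of_nonneg_left ?_ (Real.exp_pos _).le
        refine integral_exp_average_le hK hKs hτm hθ hτc (fun S Z Z' h => ?_) hb
        simp only [τ, stat_congr hA h]
    _ = _ := by
        rw [← Real.exp_add]
        congr 1
        field_simp
        ring

theorem forest_tail (hT : T.Meas) (hA : T.Adapted) (M : Problem d p 𝒲)
    [IsMarkovKernel M.condLaw] (f : Cov d → ℝ) [IsProbabilityMeasure (covLaw f)] (r : ℕ)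
    (x : Cov d) {F : Obs d 𝒲 → ℝ} (hF : Measurable F) {c b u : ℝ} (hc : 0 < c)
    (hFc : ∀ z, |F z| ≤ c) (hu : 0 ≤ u) {B : ℕ} (hs0 : 1 ≤ s) (hs : s ≤ n) (hB : (n : ℝ) / s ≤ B)
    (hb : ∀ S, ∫ Z, ∫ ξ, T.stat r S Z ξ x F ∂treeLaw ∂Measure.pi (fun _ : Fin n => M.obsLaw f) ≤ b) :
    halfLaw M f n s B {ω | b + u ≤ ∑ i, T.kernel r ω.2 ω.1 x i * F (ω.1 i)} ≤
      ENNReal.ofReal (Real.exp (-(u ^ 2 * n / (6 * c ^ 2 * s)))) := by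
  have := isProbabilityMeasure_halfLaw hs M f B
  have hs0' : (0 : ℝ) < s := by exact_mod_cast hs0
  have hn0' : (0 : ℝ) < n := lt_of_lt_of_le hs0' (by exact_mod_cast hs)
  have hB0' : (0 : ℝ) < B := lt_of_lt_of_le (by positivity) hB
  have hB0 : B ≠ 0 := by rintro rfl; simp at hB0'
  have hK0 : n / s ≠ 0 := (Nat.div_pos hs hs0).ne'
  have hK1 : (1 : ℝ) ≤ ((n / s : ℕ) : ℝ) := by exact_mod_cast Nat.one_le_iff_ne_zero.2 hK0
  have hK2 : (n : ℝ) < (((n / s : ℕ) : ℝ) + 1) * s := by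
    exact_mod_cast (Nat.div_lt_iff_lt_mul hs0).1 (Nat.lt_succ_self _)
  have hkm : Measurable fun ω : HalfSample d n s B 𝒲 => ∑ i, T.kernel r ω.2 ω.1 x i * F (ω.1 i) :=
    Finset.measurable_sum _ fun i _ => (measurable_kernel hT r x i).mul
      (hF.comp ((measurable_pi_apply i).comp measurable_fst))
  have hkc : ∀ ω : HalfSample d n s B 𝒲, |∑ i, T.kernel r ω.2 ω.1 x i * F (ω.1 i)| ≤ c := fun ω => by
    rw [sum_kernel_mul, abs_mul, abs_of_nonneg (by positivity)]
    refine (mul_le_mul_of_nonneg_left ((Finset.abs_sum_le_sum_abs _ _).trans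
      (Finset.sum_le_sum (g := fun _ => c) fun b _ => abs_stat_le hc.le hFc))
        (by positivity)).trans (le_of_eq ?_)
    simp [hB0]
  -- The trees contribute `s / n`; the rounded-down number of blocks is at least half of `n / s` and
  -- contributes `2 * s / n`.
  have hV : (B : ℝ)⁻¹ + ((n / s : ℕ) : ℝ)⁻¹ ≤ 3 * s / n := by
    have h1 : (B : ℝ)⁻¹ ≤ s / n := by
      rw [← inv_div]
      exact inv_anti₀ (by positivity) hB
    have h2 : ((n / s : ℕ) : ℝ)⁻¹ ≤ 2 * s / n := by
      rw [inv_le_comm₀ (by positivity) (by positivity), inv_div, div_le_iff₀ (by positivity)]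
      nlinarith
    calc _ ≤ (s : ℝ) / n + 2 * s / n := add_le_add h1 h2
      _ = _ := by ring
  -- The minimizer of `-θ * u + 3 * c ^ 2 * θ ^ 2 * s / (2 * n)`.
  set θ : ℝ := u * n / (3 * c ^ 2 * s) with hθ
  have hθ0 : 0 ≤ θ := by positivity
  have hmgf := integral_exp_forest_le hT hA M f r x hF hc.le hFc hθ0 hB0 hK0 hs
    (Nat.div_mul_le_self n s) hb
  have hch := measure_ge_le_exp_mul_mgf (μ := halfLaw M f n s B) (b + u) hθ0
    (integrable_exp_of_abs_le hkm hkc θ)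
  rw [← ofReal_measureReal]
  refine ENNReal.ofReal_le_ofReal (hch.trans ((mul_le_mul_of_nonneg_left hmgf
    (Real.exp_pos _).le).trans ?_))
  rw [← Real.exp_add]
  refine Real.exp_le_exp.2 ?_
  have h3 : c ^ 2 * θ ^ 2 / 2 * ((B : ℝ)⁻¹ + ((n / s : ℕ) : ℝ)⁻¹) ≤
      c ^ 2 * θ ^ 2 / 2 * (3 * s / n) := mul_le_mul_of_nonneg_left hV (by positivity)
  have h4 : -θ * (b + u) + (θ * b + c ^ 2 * θ ^ 2 / 2 * (3 * s / n)) =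
      -(u ^ 2 * n / (6 * c ^ 2 * s)) := by
    rw [hθ]
    field_simp
    ring
  linarith

end ForestTail

end DRRF

namespace DRRF

/-! ### Masses of boxes -/

section Box

variable {d : ℕ}

/-- Half-open boxes. -/
def box (lo hi : Fin d → ℝ) : Set (Cov d) := {y | ∀ j, lo j < y j ∧ y j ≤ hi j}

theorem measurableSet_slab (j : Fin d) (a b : ℝ) :
    MeasurableSet {y : Cov d | a < y j ∧ y j ≤ b} := by
  have h : {y : Cov d | a < y j ∧ y j ≤ b} = (fun y : Cov d => y j) ⁻¹' Set.Ioc a b := by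
    ext; simp
  rw [h]
  exact measurableSet_Ioc.preimage (by fun_prop)

theorem measurableSet_box (lo hi : Fin d → ℝ) : MeasurableSet (box lo hi) := by
  unfold box
  simp only [Set.ofPred_forall]
  exact MeasurableSet.iInter fun j => measurableSet_slab j _ _

theorem isClosed_cube : IsClosed (cube d) := by
  unfold cube
  simp only [Set.ofPred_forall]
  exact isClosed_iInter fun j => isClosed_Icc.preimage (by fun_prop)

theorem measurableSet_cube : MeasurableSet (cube d) := isClosed_cube.measurableSet

theorem isCompact_cube : IsCompact (cube d) := by
  have h : IsCompact (Set.univ.pi fun _ : Fin d => Set.Icc (0 : ℝ) 1) :=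
    isCompact_univ_pi fun _ => isCompact_Icc
  have h2 := h.image (PiLp.continuous_toLp 2 fun _ : Fin d => ℝ)
  convert h2 using 1
  ext x
  simp only [cube, Set.mem_ofPred_eq, Set.mem_image, Set.mem_pi, Set.mem_univ, true_imp_iff]
  constructor
  · exact fun hx => ⟨x.ofLp, hx, rfl⟩
  · rintro ⟨y, hy, rfl⟩
    exact hy

/-- Lebesgue measure on the unit interval. -/
noncomputable abbrev unitLaw : Measure ℝ := volume.restrict (Set.Icc 0 1)

instance : IsProbabilityMeasure unitLaw := ⟨by simp⟩

theorem map_toLp_pi_unitLaw :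
    (Measure.pi fun _ : Fin d => unitLaw).map (WithLp.toLp 2) =
      (volume : Measure (Cov d)).restrict (cube d) := by
  have h1 : (Measure.pi fun _ : Fin d => unitLaw) =
      (volume : Measure (Fin d → ℝ)).restrict (Set.univ.pi fun _ => Set.Icc 0 1) := by
    rw [volume_pi, Measure.restrict_pi_pi]
  have h2 : (Set.univ.pi fun _ : Fin d => Set.Icc (0 : ℝ) 1) = WithLp.toLp 2 ⁻¹' cube d := by
    ext y; simp [cube, -Set.pi_univ_Icc]
  rw [h1, h2]
  exact ((PiLp.volume_preserving_toLp (Fin d)).restrict_preimage measurableSet_cube).map_eq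

theorem covLaw_apply {f g : Cov d → ℝ} (hg : Measurable g) (hfg : ∀ x ∈ cube d, g x = f x)
    {A : Set (Cov d)} (hA : MeasurableSet A) :
    covLaw f A = ∫⁻ y, A.indicator (fun y => ENNReal.ofReal (g y)) (WithLp.toLp 2 y)
      ∂Measure.pi fun _ : Fin d => unitLaw := by
  have h0 : covLaw f = covLaw g := by
    unfold covLaw
    refine withDensity_congr_ae ?_
    filter_upwards [ae_restrict_mem measurableSet_cube] with x hx
    rw [hfg x hx]
  rw [h0]
  unfold covLaw
  rw [withDensity_apply _ hA, ← lintegral_indicator hA, ← map_toLp_pi_unitLaw,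
    lintegral_map (hg.ennreal_ofReal.indicator hA) (by fun_prop)]

theorem exists_measurable_extension {f : Cov d → ℝ} (hfc : ContinuousOn f (cube d)) :
    ∃ g : Cov d → ℝ, Measurable g ∧ ∀ x ∈ cube d, g x = f x := by
  classical
  refine ⟨(cube d).piecewise f 0, ?_, fun x hx => Set.piecewise_eq_of_mem _ _ _ hx⟩
  exact hfc.measurable_piecewise continuousOn_const measurableSet_cube

theorem ae_mem_cube (f : Cov d → ℝ) : ∀ᵐ x ∂covLaw f, x ∈ cube d := by
  unfold covLaw
  exact (withDensity_absolutelyContinuous _ _).ae_le (ae_restrict_mem measurableSet_cube)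

theorem covLaw_slab_le {f : Cov d → ℝ} {fmax : ℝ} (hf : ∀ x ∈ cube d, f x ≤ fmax) (j : Fin d)
    (a b : ℝ) (hfm : 0 ≤ fmax) :
    covLaw f {y | a < y j ∧ y j ≤ b} ≤ ENNReal.ofReal (fmax * (b - a)) := by
  have hm := measurableSet_slab j a b
  unfold covLaw
  rw [withDensity_apply _ hm]
  calc _ ≤ ∫⁻ y in {y : Cov d | a < y j ∧ y j ≤ b}, ENNReal.ofReal fmax
          ∂(volume.restrict (cube d)) := by
        refine lintegral_mono_ae (ae_restrict_of_ae ?_)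
        filter_upwards [ae_restrict_mem measurableSet_cube] with x hx
        exact ENNReal.ofReal_le_ofReal (hf x hx)
    _ = ENNReal.ofReal fmax * (volume.restrict (cube d)) {y : Cov d | a < y j ∧ y j ≤ b} := by
        rw [setLIntegral_const]
    _ ≤ ENNReal.ofReal fmax * ENNReal.ofReal (b - a) := by
        gcongr
        rw [← map_toLp_pi_unitLaw, Measure.map_apply (by fun_prop) hm]
        have h1 : WithLp.toLp 2 ⁻¹' {y : Cov d | a < y j ∧ y j ≤ b} =
            Function.eval j ⁻¹' Set.Ioc a b := by ext; simp
        rw [h1, (measurePreserving_eval (fun _ : Fin d => unitLaw) j).measure_preimage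
          measurableSet_Ioc.nullMeasurableSet]
        exact (Measure.restrict_apply_le _ _).trans (by simp)
    _ = _ := by rw [ENNReal.ofReal_mul hfm]

/-- Along every line parallel to axis `j`, the density at two points of the box differs by a factor
of at most `Q`. The mass of a slice per unit of width is therefore at most `Q` times the mean over
the whole box. Only ratios along such lines enter, so `Q` can improve once the box is thin in
direction `j` alone. -/
theorem covLaw_slice_le {f : Cov d → ℝ} (hfc : ContinuousOn f (cube d)) {lo hi : Fin d → ℝ}
    (h0 : ∀ i, 0 ≤ lo i) (h1 : ∀ i, hi i ≤ 1) (j : Fin d) {a b Q : ℝ} (ha : lo j ≤ a)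
    (hb : b ≤ hi j) (hQ0 : 0 ≤ Q)
    (hQ : ∀ y ∈ cube d, ∀ y' ∈ cube d, |y j - y' j| ≤ hi j - lo j → (∀ i, i ≠ j → y i = y' i) →
      f y ≤ Q * f y') :
    ENNReal.ofReal (hi j - lo j) * covLaw f (box (Function.update lo j a) (Function.update hi j b)) ≤
      ENNReal.ofReal ((b - a) * Q) * covLaw f (box lo hi) := by
  obtain ⟨g, hg, hgf⟩ := exists_measurable_extension hfc
  have hupd : ∀ lo hi : Fin d → ℝ, covLaw f (box lo hi) =
      ∫⁻ y, ∫⁻ t, (box lo hi).indicator (fun y => ENNReal.ofReal (g y))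
        (WithLp.toLp 2 (Function.update y j t)) ∂unitLaw ∂Measure.pi fun _ : Fin d => unitLaw := by
    intro lo hi
    rw [covLaw_apply hg hgf (measurableSet_box _ _), ← Measure.infinitePi_eq_pi]
    refine lintegral_infinitePi_update (fun _ : Fin d => unitLaw) j
      (Φ := fun y => (box lo hi).indicator (fun y => ENNReal.ofReal (g y)) (WithLp.toLp 2 y)) ?_
    exact (hg.ennreal_ofReal.indicator (measurableSet_box _ _)).comp (by fun_prop)
  rw [hupd, hupd, ← lintegral_const_mul' _ _ ENNReal.ofReal_ne_top,
    ← lintegral_const_mul' _ _ ENNReal.ofReal_ne_top]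
  refine lintegral_mono fun y => ?_
  -- After resampling coordinate `j` the claim is one-dimensional. A line whose other coordinates
  -- violate `O` misses the slice, and the left-hand side vanishes.
  let O : Prop := ∀ i, i ≠ j → lo i < y i ∧ y i ≤ hi i
  have hmem : ∀ (lo' hi' : Fin d → ℝ) (_ : ∀ i, i ≠ j → lo' i = lo i) (_ : ∀ i, i ≠ j → hi' i = hi i)
      (t : ℝ), WithLp.toLp 2 (Function.update y j t) ∈ box lo' hi' ↔
        O ∧ t ∈ Set.Ioc (lo' j) (hi' j) := by
    intro lo' hi' hl hh t
    simp only [box, Set.mem_ofPred_eq]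
    constructor
    · intro h
      refine ⟨fun i hi => ?_, by simpa using h j⟩
      have := h i
      rwa [Function.update_of_ne hi, hl i hi, hh i hi] at this
    · rintro ⟨h, ht⟩ i
      by_cases hij : i = j
      · subst hij; simpa using ht
      · rw [Function.update_of_ne hij, hl i hij, hh i hij]; exact h i hij
  by_cases hO : O
  swap
  · have h2 : ∀ t, WithLp.toLp 2 (Function.update y j t) ∉
        box (Function.update lo j a) (Function.update hi j b) := fun t ht =>
      hO ((hmem _ _ (fun i hi => Function.update_of_ne hi _ _)
        (fun i hi' => Function.update_of_ne hi' _ _) t).1 ht).1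
    simp [Set.indicator_of_notMem (h2 _)]
  set G : ℝ → ENNReal := fun t => ENNReal.ofReal (g (WithLp.toLp 2 (Function.update y j t))) with hG
  have hGm : Measurable G := by
    have : Measurable fun t : ℝ => Function.update y j t := measurable_update y
    fun_prop
  have e1 : ∀ t, (box (Function.update lo j a) (Function.update hi j b)).indicator
      (fun y => ENNReal.ofReal (g y)) (WithLp.toLp 2 (Function.update y j t)) =
      (Set.Ioc a b).indicator G t := fun t => by
    have := hmem _ _ (fun i hi => Function.update_of_ne hi a lo)
      (fun i hi' => Function.update_of_ne hi' b hi) t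
    simp only [Function.update_self, hO, true_and] at this
    by_cases h : WithLp.toLp 2 (Function.update y j t) ∈ box (Function.update lo j a) (Function.update hi j b)
    · rw [Set.indicator_of_mem h, Set.indicator_of_mem (this.1 h)]
    · rw [Set.indicator_of_notMem h, Set.indicator_of_notMem fun h' => h (this.2 h')]
  have e2 : ∀ t, (box lo hi).indicator
      (fun y => ENNReal.ofReal (g y)) (WithLp.toLp 2 (Function.update y j t)) =
      (Set.Ioc (lo j) (hi j)).indicator G t := fun t => by
    have := hmem _ _ (fun i _ => rfl) (fun i _ => rfl) t
    simp only [hO, true_and] at this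
    by_cases h : WithLp.toLp 2 (Function.update y j t) ∈ box lo hi
    · rw [Set.indicator_of_mem h, Set.indicator_of_mem (this.1 h)]
    · rw [Set.indicator_of_notMem h, Set.indicator_of_notMem fun h' => h (this.2 h')]
  simp_rw [e1, e2]
  have hsub : Set.Ioc (lo j) (hi j) ⊆ Set.Icc 0 1 := fun t ht =>
    ⟨(h0 j).trans ht.1.le, ht.2.trans (h1 j)⟩
  have hsub' : Set.Ioc a b ⊆ Set.Ioc (lo j) (hi j) := Set.Ioc_subset_Ioc ha hb
  rw [lintegral_indicator measurableSet_Ioc, lintegral_indicator measurableSet_Ioc,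
    Measure.restrict_restrict measurableSet_Ioc, Measure.restrict_restrict measurableSet_Ioc,
    Set.inter_eq_left.2 hsub, Set.inter_eq_left.2 (hsub'.trans hsub)]
  have hcube : ∀ t ∈ Set.Ioc (lo j) (hi j), WithLp.toLp 2 (Function.update y j t) ∈ cube d := by
    intro t ht i
    by_cases hij : i = j
    · subst hij; simpa using hsub ht
    · simp only [Function.update_of_ne hij]
      exact ⟨(h0 i).trans (hO i hij).1.le, (hO i hij).2.trans (h1 i)⟩
  -- The width is written as an integral over a second point `t'`, so that `G t ≤ Q * G t'` can be
  -- used pointwise.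
  calc ENNReal.ofReal (hi j - lo j) * ∫⁻ t in Set.Ioc a b, G t
      = ∫⁻ _ in Set.Ioc (lo j) (hi j), ∫⁻ t in Set.Ioc a b, G t := by
        rw [setLIntegral_const, Real.volume_Ioc, mul_comm]
    _ ≤ ∫⁻ t' in Set.Ioc (lo j) (hi j), ∫⁻ t in Set.Ioc a b, ENNReal.ofReal Q * G t' := by
        refine setLIntegral_mono' measurableSet_Ioc fun t' ht' => ?_
        refine setLIntegral_mono' measurableSet_Ioc fun t ht => ?_
        rw [hG, ← ENNReal.ofReal_mul hQ0]
        refine ENNReal.ofReal_le_ofReal ?_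
        rw [hgf _ (hcube t (hsub' ht)), hgf _ (hcube t' ht')]
        refine hQ _ (hcube t (hsub' ht)) _ (hcube t' ht') ?_ ?_
        · have := hsub' ht
          simp only [Function.update_self]
          rw [abs_le]
          constructor <;> linarith [this.1, this.2, ht'.1, ht'.2]
        · intro i hi
          simp [Function.update_of_ne hi]
    _ = ENNReal.ofReal ((b - a) * Q) * ∫⁻ t in Set.Ioc (lo j) (hi j), G t := by
        simp_rw [setLIntegral_const, Real.volume_Ioc]
        rw [lintegral_mul_const _ (by fun_prop), lintegral_const_mul _ hGm,
          ENNReal.ofReal_mul' hQ0]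
        ring

end Box

/-! ### Chernoff bounds for counts -/

section Chernoff

variable {n : ℕ} {E : Type*} [MeasurableSpace E] {μ : Measure E} [IsProbabilityMeasure μ]

/-- The moment generating function of a binomial count, with `1 + y ≤ exp y` in each factor; indices
outside `S` contribute one. -/
theorem integral_exp_count_le (S : Finset (Fin n)) {D : Set E} (hD : MeasurableSet D) (θ : ℝ) :
    ∫ Z, Real.exp (θ * ∑ i ∈ S, D.indicator (fun _ => (1 : ℝ)) (Z i))
      ∂Measure.pi (fun _ : Fin n => μ) ≤ Real.exp (S.card * (μ.real D * (Real.exp θ - 1))) := by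
  classical
  have h1 : ∀ Z : Fin n → E, Real.exp (θ * ∑ i ∈ S, D.indicator (fun _ => (1 : ℝ)) (Z i)) =
      ∏ i, (fun (i : Fin n) (z : E) =>
        if i ∈ S then 1 + D.indicator (fun _ => (1 : ℝ)) z * (Real.exp θ - 1) else 1) i (Z i) := by
    intro Z
    rw [Finset.mul_sum, Real.exp_sum, Finset.prod_ite_mem, Finset.univ_inter]
    refine Finset.prod_congr rfl fun i _ => ?_
    by_cases h : Z i ∈ D <;> simp [h]
  simp_rw [h1]
  rw [integral_fintype_prod_eq_prod (𝕜 := ℝ) (fun (i : Fin n) (z : E) =>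
        if i ∈ S then 1 + D.indicator (fun _ => (1 : ℝ)) z * (Real.exp θ - 1) else 1)]
  have h2 : ∀ i, ∫ z, (if i ∈ S then 1 + D.indicator (fun _ => (1 : ℝ)) z * (Real.exp θ - 1)
      else 1) ∂μ = if i ∈ S then 1 + μ.real D * (Real.exp θ - 1) else 1 := by
    intro i
    split_ifs
    · rw [integral_add (integrable_const _), integral_mul_const, integral_indicator hD]
      · simp
      · exact ((integrable_const _).indicator hD).mul_const _
    · simp
  simp_rw [h2]
  rw [Finset.prod_ite_mem, Finset.univ_inter, Finset.prod_const, Real.exp_nat_mul]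
  have h3 : 0 ≤ 1 + μ.real D * (Real.exp θ - 1) := by
    have := Real.exp_pos θ
    have h4 : μ.real D ≤ 1 := measureReal_le_one
    have h5 : 0 ≤ μ.real D := measureReal_nonneg
    nlinarith
  refine pow_le_pow_left₀ h3 ?_ _
  rw [add_comm]
  exact Real.add_one_le_exp _

/-- Chernoff with `θ = ±δ` and `exp θ - 1 ≤ θ + θ ^ 2`. The part of the deviation proportional to
the mean cancels the quadratic term, and the additive part leaves the exponent `-δ ^ 2 * N₀`,
whatever the mass of the set. -/
theorem measure_count_deviation_le (S : Finset (Fin n)) {D : Set E} (hD : MeasurableSet D)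
    {δ N₀ : ℝ} (hδ0 : 0 ≤ δ) (hδ : δ ≤ 1) :
    Measure.pi (fun _ : Fin n => μ) {Z | δ * (S.card * μ.real D + N₀) <
        |∑ i ∈ S, D.indicator (fun _ => (1 : ℝ)) (Z i) - S.card * μ.real D|} ≤
      ENNReal.ofReal (2 * Real.exp (-(δ ^ 2 * N₀))) := by
  set X : (Fin n → E) → ℝ := fun Z => ∑ i ∈ S, D.indicator (fun _ => (1 : ℝ)) (Z i) with hX
  have hXm : Measurable X := Finset.measurable_sum _ fun i _ =>
    (measurable_const.indicator hD).comp (measurable_pi_apply i)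
  have hXc : ∀ Z, |X Z| ≤ S.card := fun Z => by
    refine (Finset.abs_sum_le_sum_abs _ _).trans
      ((Finset.sum_le_sum (g := fun _ => (1 : ℝ)) fun i _ => ?_).trans (le_of_eq (by simp)))
    by_cases h : Z i ∈ D <;> simp [h]
  set q : ℝ := S.card * μ.real D with hq
  have hq0 : 0 ≤ q := by positivity
  have hmgf : ∀ θ : ℝ, |θ| ≤ 1 → mgf X (Measure.pi fun _ : Fin n => μ) θ ≤
      Real.exp (q * (θ + θ ^ 2)) := fun θ hθ => by
    refine (integral_exp_count_le S hD θ).trans (Real.exp_le_exp.2 ?_)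
    rw [← mul_assoc]
    refine mul_le_mul_of_nonneg_left ?_ hq0
    have := (abs_le.1 (Real.abs_exp_sub_one_sub_id_le hθ)).2
    linarith
  have hup := measure_ge_le_exp_mul_mgf (μ := Measure.pi fun _ : Fin n => μ)
    (q + δ * (q + N₀)) hδ0 (integrable_exp_of_abs_le hXm hXc δ)
  have hlow := measure_le_le_exp_mul_mgf (μ := Measure.pi fun _ : Fin n => μ)
    (q - δ * (q + N₀)) (neg_nonpos.2 hδ0) (integrable_exp_of_abs_le hXm hXc (-δ))
  have hup' : (Measure.pi fun _ : Fin n => μ).real {Z | q + δ * (q + N₀) ≤ X Z} ≤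
      Real.exp (-(δ ^ 2 * N₀)) := by
    refine hup.trans ((mul_le_mul_of_nonneg_left (hmgf δ (by rwa [abs_of_nonneg hδ0]))
      (Real.exp_pos _).le).trans ?_)
    rw [← Real.exp_add]
    exact Real.exp_le_exp.2 (le_of_eq (by ring))
  have hlow' : (Measure.pi fun _ : Fin n => μ).real {Z | X Z ≤ q - δ * (q + N₀)} ≤
      Real.exp (-(δ ^ 2 * N₀)) := by
    refine hlow.trans ((mul_le_mul_of_nonneg_left (hmgf (-δ) (by rwa [abs_neg, abs_of_nonneg hδ0]))
      (Real.exp_pos _).le).trans ?_)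
    rw [← Real.exp_add]
    exact Real.exp_le_exp.2 (le_of_eq (by ring))
  have hsub : {Z | δ * (q + N₀) < |X Z - q|} ⊆
      {Z | q + δ * (q + N₀) ≤ X Z} ∪ {Z | X Z ≤ q - δ * (q + N₀)} := by
    intro Z hZ
    rcases lt_abs.1 hZ.out with h | h
    · exact Or.inl (by simp only [Set.mem_ofPred_eq]; linarith)
    · exact Or.inr (by simp only [Set.mem_ofPred_eq]; linarith)
  refine (measure_mono hsub).trans ((measure_union_le _ _).trans ?_)
  rw [two_mul, ENNReal.ofReal_add (Real.exp_pos _).le (Real.exp_pos _).le]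
  exact add_le_add
    (by rw [← ofReal_measureReal]; exact ENNReal.ofReal_le_ofReal hup')
    (by rw [← ofReal_measureReal]; exact ENNReal.ofReal_le_ofReal hlow')

end Chernoff

end DRRF

namespace DRRF

/-! ### Uniform concentration over boxes -/

section BoxRegular

variable {d n s p : ℕ} {𝒲 : Type*}

/-- Number of observations in a box, as a real number. -/
noncomputable def boxCount (S : Finset (Fin n)) (Z : Fin n → Obs d 𝒲) (lo hi : Fin d → ℝ) : ℝ :=
  ∑ i ∈ S, (box lo hi).indicator (fun _ => (1 : ℝ)) (Z i).1

/-- All boxes contain about as many observations as expected. -/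
def BoxRegular (f : Cov d → ℝ) (δ N₀ : ℝ) (S : Finset (Fin n)) (Z : Fin n → Obs d 𝒲) : Prop :=
  ∀ lo hi : Fin d → ℝ, (∀ j, 0 ≤ lo j) → (∀ j, lo j ≤ hi j) → (∀ j, hi j ≤ 1) →
    |boxCount S Z lo hi - S.card * (covLaw f).real (box lo hi)| ≤
      δ * (S.card * (covLaw f).real (box lo hi) + N₀)

theorem boxCount_mono (S : Finset (Fin n)) (Z : Fin n → Obs d 𝒲) {lo hi lo' hi' : Fin d → ℝ}
    (h1 : ∀ j, lo' j ≤ lo j) (h2 : ∀ j, hi j ≤ hi' j) :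
    boxCount S Z lo hi ≤ boxCount S Z lo' hi' :=
  Finset.sum_le_sum fun _ _ => Set.indicator_le_indicator_of_subset
    (fun _ hy j => ⟨(h1 j).trans_lt (hy j).1, (hy j).2.trans (h2 j)⟩) (fun _ => zero_le_one) _

theorem covLaw_box_le_add {f : Cov d → ℝ} [IsProbabilityMeasure (covLaw f)] {fmax : ℝ}
    (hf : ∀ x ∈ cube d, f x ≤ fmax) (hfm : 0 ≤ fmax) {lo hi lo' hi' : Fin d → ℝ} {η : ℝ}
    (h1 : ∀ j, lo j - lo' j ≤ η) (h2 : ∀ j, hi' j - hi j ≤ η) (hη : 0 ≤ η) :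
    (covLaw f).real (box lo' hi') ≤ (covLaw f).real (box lo hi) + 2 * d * fmax * η := by
  have hsub : box lo' hi' ⊆ box lo hi ∪ ⋃ j, ({y : Cov d | lo' j < y j ∧ y j ≤ lo j} ∪
      {y : Cov d | hi j < y j ∧ y j ≤ hi' j}) := by
    intro y hy
    by_cases h : y ∈ box lo hi
    · exact Or.inl h
    · right
      simp only [box, Set.mem_ofPred_eq, not_forall, not_and_or, not_lt, not_le] at h
      obtain ⟨j, hj⟩ := h
      refine Set.mem_iUnion.2 ⟨j, ?_⟩
      rcases hj with hj | hj
      · exact Or.inl ⟨(hy j).1, hj⟩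
      · exact Or.inr ⟨hj, (hy j).2⟩
  have hslab : ∀ (j : Fin d) (a b : ℝ), b - a ≤ η →
      (covLaw f).real {y : Cov d | a < y j ∧ y j ≤ b} ≤ fmax * η := fun j a b hab => by
    refine ENNReal.toReal_le_of_le_ofReal (by positivity) ((covLaw_slab_le hf j a b hfm).trans ?_)
    exact ENNReal.ofReal_le_ofReal (mul_le_mul_of_nonneg_left hab hfm)
  refine (measureReal_mono hsub).trans ((measureReal_union_le _ _).trans (add_le_add_right ?_ _))
  refine (measureReal_iUnion_fintype_le _).trans ?_
  calc _ ≤ ∑ _j : Fin d, (fmax * η + fmax * η) :=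
        Finset.sum_le_sum fun j _ => (measureReal_union_le _ _).trans
          (add_le_add (hslab j _ _ (h1 j)) (hslab j _ _ (h2 j)))
    _ = _ := by simp; ring

variable [MeasurableSpace 𝒲]

theorem obsLaw_fst_preimage (M : Problem d p 𝒲) [IsMarkovKernel M.condLaw] (f : Cov d → ℝ)
    [IsProbabilityMeasure (covLaw f)] {A : Set (Cov d)} (hA : MeasurableSet A) :
    M.obsLaw f (Prod.fst ⁻¹' A) = covLaw f A := by
  unfold Problem.obsLaw
  rw [← Measure.fst_apply hA, Measure.fst_compProd]

/-- A union bound over the boxes with corners on a grid of mesh `1 / G`. Any other box lies between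
an inner and an outer grid box, and the mesh is fine enough for the expected counts to differ by at
most `δ * N₀`. Rounding together with the deviation at the grid turns `δ` into `3 * δ`. -/
theorem measure_not_boxRegular_le (M : Problem d p 𝒲) [IsMarkovKernel M.condLaw] {f : Cov d → ℝ}
    [IsProbabilityMeasure (covLaw f)] {fmax : ℝ} (hf : ∀ x ∈ cube d, f x ≤ fmax) (hfm : 0 ≤ fmax)
    (S : Finset (Fin n)) {δ N₀ : ℝ} (hδ0 : 0 < δ) (hδ : δ ≤ 1) {G : ℕ} (hG : 1 ≤ G)
    (hGN : 2 * d * fmax * S.card ≤ δ * N₀ * G) :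
    Measure.pi (fun _ : Fin n => M.obsLaw f) {Z | ¬ BoxRegular f (3 * δ) N₀ S Z} ≤
      ENNReal.ofReal (((G : ℝ) + 1) ^ (2 * d) * (2 * Real.exp (-(δ ^ 2 * N₀)))) := by
  have := isProbabilityMeasure_obsLaw M f
  have hG0 : (0 : ℝ) < G := by exact_mod_cast hG
  let gr : (Fin d → Fin (G + 1)) → Fin d → ℝ := fun a j => (a j : ℝ) / G
  have hsub : {Z : Fin n → Obs d 𝒲 | ¬ BoxRegular f (3 * δ) N₀ S Z} ⊆
      ⋃ ab : (Fin d → Fin (G + 1)) × (Fin d → Fin (G + 1)),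
        {Z | δ * (S.card * (M.obsLaw f).real (Prod.fst ⁻¹' box (gr ab.1) (gr ab.2)) + N₀) <
          |∑ i ∈ S, (Prod.fst ⁻¹' box (gr ab.1) (gr ab.2)).indicator (fun _ => (1 : ℝ)) (Z i) -
            S.card * (M.obsLaw f).real (Prod.fst ⁻¹' box (gr ab.1) (gr ab.2))|} := by
    intro Z hZ
    by_contra hcon
    apply hZ
    simp only [Set.mem_iUnion, Set.mem_ofPred_eq, not_exists, not_lt, Prod.forall] at hcon
    have hgrid : ∀ a b, |boxCount S Z (gr a) (gr b) -
        S.card * (covLaw f).real (box (gr a) (gr b))| ≤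
        δ * (S.card * (covLaw f).real (box (gr a) (gr b)) + N₀) := fun a b => by
      have h1 : (M.obsLaw f).real (Prod.fst ⁻¹' box (gr a) (gr b)) =
          (covLaw f).real (box (gr a) (gr b)) :=
        congrArg ENNReal.toReal (obsLaw_fst_preimage M f (measurableSet_box _ _))
      have h2 := hcon a b
      rw [h1] at h2
      exact h2
    intro lo hi h0 hle h1
    have hlo1 : ∀ j, lo j ≤ 1 := fun j => (hle j).trans (h1 j)
    have hhi0 : ∀ j, 0 ≤ hi j := fun j => (h0 j).trans (hle j)
    have hfl : ∀ t : ℝ, 0 ≤ t → t ≤ 1 → ∃ a : Fin (G + 1), (a : ℝ) / G ≤ t ∧ t - (a : ℝ) / G ≤ 1 / G := by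
      intro t ht0 ht1
      have hle : ⌊t * G⌋₊ < G + 1 := by
        have h := Nat.floor_le_floor (mul_le_mul_of_nonneg_right ht1 hG0.le)
        rw [one_mul, Nat.floor_natCast] at h
        omega
      refine ⟨⟨⌊t * G⌋₊, hle⟩, ?_, ?_⟩
      · rw [div_le_iff₀ hG0]
        exact Nat.floor_le (by positivity)
      · rw [sub_le_iff_le_add, ← add_div, le_div_iff₀ hG0]
        have := (Nat.lt_floor_add_one (t * G)).le
        simp only
        linarith
    have hcl : ∀ t : ℝ, 0 ≤ t → t ≤ 1 → ∃ a : Fin (G + 1), t ≤ (a : ℝ) / G ∧ (a : ℝ) / G - t ≤ 1 / G := by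
      intro t ht0 ht1
      have hle : ⌈t * G⌉₊ < G + 1 := by
        have h := Nat.ceil_le_ceil (mul_le_mul_of_nonneg_right ht1 hG0.le)
        rw [one_mul, Nat.ceil_natCast] at h
        omega
      refine ⟨⟨⌈t * G⌉₊, hle⟩, ?_, ?_⟩
      · rw [le_div_iff₀ hG0]
        exact Nat.le_ceil _
      · rw [sub_le_iff_le_add, div_le_iff₀ hG0, add_mul, div_mul_cancel₀ _ hG0.ne']
        have := (Nat.ceil_lt_add_one (show 0 ≤ t * G by positivity)).le
        simp only
        linarith
    choose al hal1 hal2 using fun j => hfl (lo j) (h0 j) (hlo1 j)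
    choose bu hbu1 hbu2 using fun j => hcl (hi j) (hhi0 j) (h1 j)
    -- Inner corners are rounded inwards and may cross; the inner box is then empty and the
    -- estimates below remain valid.
    choose au hau1 hau2 using fun j => hcl (lo j) (h0 j) (hlo1 j)
    choose bl hbl1 hbl2 using fun j => hfl (hi j) (hhi0 j) (h1 j)
    have hη : (0 : ℝ) ≤ 1 / G := by positivity
    have hPout := covLaw_box_le_add hf hfm (lo := lo) (hi := hi) (lo' := gr al) (hi' := gr bu)
      hal2 hbu2 hη
    have hPin := covLaw_box_le_add hf hfm (lo := gr au) (hi := gr bl) (lo' := lo) (hi' := hi)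
      hau2 hbl2 hη
    have hCout := boxCount_mono S Z (lo := lo) (hi := hi) (lo' := gr al) (hi' := gr bu) hal1 hbu1
    have hCin := boxCount_mono S Z (lo := gr au) (hi := gr bl) (lo' := lo) (hi' := hi) hau1 hbl1
    have hout := (abs_le.1 (hgrid al bu)).2
    have hin := (abs_le.1 (hgrid au bl)).1
    set P := (covLaw f).real (box lo hi)
    set Po := (covLaw f).real (box (gr al) (gr bu))
    set Pi := (covLaw f).real (box (gr au) (gr bl))
    have hP0 : 0 ≤ P := measureReal_nonneg
    have hPi0 : 0 ≤ Pi := measureReal_nonneg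
    have hη2 : S.card * (2 * d * fmax * (1 / (G : ℝ))) ≤ δ * N₀ := by
      have : (S.card : ℝ) * (2 * d * fmax * (1 / (G : ℝ))) = 2 * d * fmax * S.card / G := by ring
      rw [this, div_le_iff₀ hG0]
      exact hGN
    have hm0 : (0 : ℝ) ≤ S.card := by positivity
    have e1 : S.card * Po ≤ S.card * P + δ * N₀ := by
      have := mul_le_mul_of_nonneg_left hPout hm0
      rw [mul_add] at this
      linarith
    have e2 : S.card * P ≤ S.card * Pi + δ * N₀ := by
      have := mul_le_mul_of_nonneg_left hPin hm0
      rw [mul_add] at this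
      linarith
    have hN0 : 0 ≤ δ * N₀ := le_trans (by positivity) hη2
    have hmP : 0 ≤ S.card * P := by positivity
    have hmPi : (S.card : ℝ) * Pi ≤ S.card * P := by
      refine mul_le_mul_of_nonneg_left (measureReal_mono ?_) hm0
      exact fun y hy j => ⟨(hau1 j).trans_lt (hy j).1, (hy j).2.trans (hbl1 j)⟩
    rw [abs_le]
    constructor
    · nlinarith
    · nlinarith
  refine (measure_mono hsub).trans ((measure_iUnion_fintype_le _ _).trans
    ((Finset.sum_le_sum fun ab _ => measure_count_deviation_le S
      (measurable_fst (measurableSet_box (gr ab.1) (gr ab.2))) hδ0.le hδ).trans (le_of_eq ?_)))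
  simp only [Finset.sum_const, Finset.card_univ, Fintype.card_prod, Fintype.card_fun,
    Fintype.card_fin, nsmul_eq_mul]
  conv_rhs => rw [ENNReal.ofReal_mul (by positivity)]
  congr 1
  rw [← ENNReal.ofReal_natCast]
  congr 1
  push_cast
  ring

end BoxRegular

/-! ### Widths of the cells on the path of a point -/

section Path

variable {d n s p : ℕ} {𝒲 : Type*}

/-- Number of splits along a feature on the path of `x`. -/
noncomputable def splitCount (σ : List Bool → Split d) (x : Cov d) (j : Fin d) : ℕ → ℕ
  | 0 => 0
  | k + 1 => splitCount σ x j k + if (σ (node σ x k)).1 = j then 1 else 0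

theorem boxCount_eq_card {S : Finset (Fin n)} {Z : Fin n → Obs d 𝒲}
    (hZ : ∀ i ∈ S, ∀ j, 0 < (Z i).1 j ∧ (Z i).1 j ≤ 1) {A : Set (Cov d)} {lo hi : Fin d → ℝ}
    (hA : ∀ y : Cov d, (∀ j, 0 < y j ∧ y j ≤ 1) → (y ∈ A ↔ y ∈ box lo hi)) :
    boxCount S Z lo hi = (within Z S A).card := by
  classical
  rw [card_within, boxCount]
  push_cast
  refine Finset.sum_congr rfl fun i hi' => ?_
  simp only [Set.indicator_apply, hA _ (hZ i hi')]
  split_ifs <;> simp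

/-- Box regularity converts the share `ρ` of the count into a share `0.9 * ρ` of the mass. The
density ratio then converts mass into width. The condition on `N₀` makes its additive error small
relative to the count of the child. -/
theorem slice_width_ge {f : Cov d → ℝ} [IsProbabilityMeasure (covLaw f)]
    (hfc : ContinuousOn f (cube d)) {ρ : ℝ} (hρ0 : 0 < ρ) (hρ : ρ ≤ 0.2) {N₀ : ℝ} (hN₀ : 0 < N₀)
    {S : Finset (Fin n)} {Z : Fin n → Obs d 𝒲} (hreg : BoxRegular f (ρ / 100) N₀ S Z)
    {lo hi : Fin d → ℝ} (h0 : ∀ i, 0 ≤ lo i) (hle : ∀ i, lo i ≤ hi i) (h1 : ∀ i, hi i ≤ 1)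
    (j : Fin d) {a b Q : ℝ} (ha : lo j ≤ a) (hab : a ≤ b) (hb : b ≤ hi j) (hQ0 : 0 ≤ Q)
    (hQ : ∀ y ∈ cube d, ∀ y' ∈ cube d, |y j - y' j| ≤ hi j - lo j → (∀ i, i ≠ j → y i = y' i) →
      f y ≤ Q * f y')
    (hN : N₀ ≤ ρ / 100 * boxCount S Z lo hi)
    (hchild : ρ * boxCount S Z lo hi ≤
      boxCount S Z (Function.update lo j a) (Function.update hi j b)) :
    0.9 * ρ * (hi j - lo j) ≤ Q * (b - a) := by
  have hslice := covLaw_slice_le hfc h0 h1 j ha hb hQ0 hQ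
  have hA := hreg lo hi h0 hle h1
  have hA' := hreg (Function.update lo j a) (Function.update hi j b)
    (fun i => by
      rcases eq_or_ne i j with rfl | hij
      · rw [Function.update_self]; exact (h0 i).trans ha
      · rw [Function.update_of_ne hij]; exact h0 i)
    (fun i => by
      rcases eq_or_ne i j with rfl | hij
      · rw [Function.update_self, Function.update_self]; exact hab
      · rw [Function.update_of_ne hij, Function.update_of_ne hij]; exact hle i)
    (fun i => by
      rcases eq_or_ne i j with rfl | hij
      · rw [Function.update_self]; exact hb.trans (h1 i)
      · rw [Function.update_of_ne hij]; exact h1 i)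
  set N := boxCount S Z lo hi
  set N' := boxCount S Z (Function.update lo j a) (Function.update hi j b)
  have hslice' : (hi j - lo j) *
      (covLaw f).real (box (Function.update lo j a) (Function.update hi j b)) ≤
      (b - a) * Q * (covLaw f).real (box lo hi) := by
    have := ENNReal.toReal_mono (by finiteness) hslice
    rwa [ENNReal.toReal_mul, ENNReal.toReal_mul, ENNReal.toReal_ofReal (by linarith [hle j]),
      ENNReal.toReal_ofReal (mul_nonneg (by linarith) hQ0)] at this
  set P := (covLaw f).real (box lo hi)
  set P' := (covLaw f).real (box (Function.update lo j a) (Function.update hi j b))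
  have hP0 : 0 ≤ P := measureReal_nonneg
  have hP0' : 0 ≤ P' := measureReal_nonneg
  set m : ℝ := (S.card : ℝ)
  have hm : 0 ≤ m := by positivity
  have hA1 := (abs_le.1 hA).1
  have hA2 := (abs_le.1 hA).2
  have hA3 := (abs_le.1 hA').2
  -- In units of `δ`, the child has share `100 * δ` of the count; a share `90 * δ` of the mass
  -- survives the deviations.
  set δ := ρ / 100 with hδ
  have hδρ : ρ = 100 * δ := by rw [hδ]; ring
  have hδ0 : 0 < δ := by positivity
  have hδ1 : δ ≤ 0.002 := by rw [hδ]; linarith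
  have hNpos : 0 < N := by
    by_contra! hcon
    nlinarith
  have hδN : δ * N₀ ≤ δ * (δ * N) := mul_le_mul_of_nonneg_left hN hδ0.le
  have hδN' : δ * (δ * N) ≤ 0.002 * (δ * N) := mul_le_mul_of_nonneg_right hδ1 (by positivity)
  have hδN2 : δ * N ≤ 0.002 * N := mul_le_mul_of_nonneg_right hδ1 hNpos.le
  have hmP0 : 0 ≤ m * P := mul_nonneg hm hP0
  have hmP0' : 0 ≤ m * P' := mul_nonneg hm hP0'
  have i1 : δ * (m * P') ≤ 0.002 * (m * P') := mul_le_mul_of_nonneg_right hδ1 hmP0'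
  have i2 : δ * (m * P) ≤ 0.002 * (m * P) := mul_le_mul_of_nonneg_right hδ1 hmP0
  have k1 : 99.998 * (δ * N) ≤ 1.002 * (m * P') := by
    rw [hδρ] at hchild
    nlinarith
  have k2 : 0.998 * (m * P) ≤ 1.00001 * N := by nlinarith
  have k3 : N ≤ 1.01 * (m * P) := by nlinarith
  have hmPpos : 0 < m * P := by linarith
  have hmpos : 0 < m := by
    rcases hm.lt_or_eq with h | h
    · exact h
    · rw [← h] at hmPpos; simp at hmPpos
  have hPpos : 0 < P := by
    rcases hP0.lt_or_eq with h | h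
    · exact h
    · rw [← h] at hmPpos; simp at hmPpos
  have k4 : 90 * δ * (m * P) ≤ m * P' := by
    have := mul_le_mul_of_nonneg_left k2 hδ0.le
    nlinarith
  have k5 : 90 * δ * P ≤ P' := by
    by_contra! hcon
    have := mul_lt_mul_of_pos_left hcon hmpos
    linarith
  have k6 : (hi j - lo j) * (90 * δ * P) ≤ (b - a) * Q * P :=
    (mul_le_mul_of_nonneg_left k5 (by linarith [hle j])).trans hslice'
  have k7 : (hi j - lo j) * (90 * δ) ≤ (b - a) * Q := by
    by_contra! hcon
    have := mul_lt_mul_of_pos_right hcon hPpos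
    linarith
  rw [hδρ]
  linarith

end Path

end DRRF

namespace DRRF

/-! ### Contraction of the cells along the path of a point. -/

section Width

variable {d n s p : ℕ} {𝒲 : Type*}

/-- Oscillation of the density: `Q₁` bounds all ratios, `9 / 8` those at distance at most `w₀`. -/
structure DensityRatio (f : Cov d → ℝ) (Q₁ w₀ : ℝ) : Prop where
  one_le : 1 ≤ Q₁
  ratio : ∀ y ∈ cube d, ∀ y' ∈ cube d, f y ≤ Q₁ * f y'
  local_ratio : ∀ y ∈ cube d, ∀ y' ∈ cube d, ‖y - y'‖ ≤ w₀ → f y ≤ 9 / 8 * f y'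

theorem exists_densityRatio {f : Cov d → ℝ} (hfc : ContinuousOn f (cube d)) {fmin fmax : ℝ}
    (hfmin : 0 < fmin) (hf : ∀ x ∈ cube d, fmin ≤ f x ∧ f x ≤ fmax) :
    ∃ Q₁ w₀, 0 < w₀ ∧ DensityRatio f Q₁ w₀ := by
  have hu := isCompact_cube.uniformContinuousOn_of_continuous hfc
  -- A variation of at most `fmin / 8` is at most an eighth of any value of the density. The ratio
  -- `9 / 8` is chosen to turn `0.9 * ρ` into `0.8 * ρ`.
  obtain ⟨w, hw, h⟩ := Metric.uniformContinuousOn_iff.1 hu (fmin / 8) (by positivity)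
  have h0 : (0 : Cov d) ∈ cube d := fun j => by simp
  have hmm : fmin ≤ fmax := (hf 0 h0).1.trans (hf 0 h0).2
  refine ⟨fmax / fmin, w / 2, by positivity, ⟨(one_le_div hfmin).2 hmm, fun y hy y' hy' => ?_,
    fun y hy y' hy' hyy => ?_⟩⟩
  · rw [div_mul_eq_mul_div, le_div_iff₀ hfmin]
    have := hf y hy
    have := hf y' hy'
    nlinarith
  · have h1 := h y hy y' hy' (by rw [dist_eq_norm]; linarith)
    rw [Real.dist_eq] at h1
    have := (abs_lt.1 h1).2
    have := (hf y' hy').1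
    linarith

theorem norm_sub_eq_of_eq_off {y y' : Cov d} {j : Fin d} (h : ∀ i, i ≠ j → y i = y' i) :
    ‖y - y'‖ = |y j - y' j| := by
  rw [EuclideanSpace.norm_eq, Finset.sum_eq_single j]
  · simp [Real.sqrt_sq_eq_abs]
  · intro i _ hi
    simp [h i hi]
  · simp

/-- The width bound after `N` splits along a feature. -/
noncomputable def widthBound (κ₁ κ₂ : ℝ) (K₁ N : ℕ) : ℝ := κ₁ ^ min N K₁ * κ₂ ^ (N - K₁)

theorem widthBound_succ_of_lt {κ₁ κ₂ : ℝ} {K₁ N : ℕ} (h : N < K₁) :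
    widthBound κ₁ κ₂ K₁ (N + 1) = widthBound κ₁ κ₂ K₁ N * κ₁ := by
  unfold widthBound
  rw [min_eq_left h.le, min_eq_left (Nat.succ_le_of_lt h), Nat.sub_eq_zero_of_le h.le,
    Nat.sub_eq_zero_of_le (Nat.succ_le_of_lt h), Nat.succ_eq_add_one]
  ring

theorem widthBound_succ_of_le {κ₁ κ₂ : ℝ} {K₁ N : ℕ} (h : K₁ ≤ N) :
    widthBound κ₁ κ₂ K₁ (N + 1) = widthBound κ₁ κ₂ K₁ N * κ₂ := by
  unfold widthBound
  rw [min_eq_right h, min_eq_right (by omega), Nat.sub_add_comm h]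
  ring

theorem widthBound_le_pow {κ₁ κ₂ : ℝ} (h1 : 0 ≤ κ₁) (h2 : 0 ≤ κ₂) (h2' : κ₂ ≤ 1)
    {K₁ N : ℕ} (h : K₁ ≤ N) : widthBound κ₁ κ₂ K₁ N ≤ κ₁ ^ K₁ := by
  unfold widthBound
  rw [min_eq_right h]
  exact mul_le_of_le_one_right (pow_nonneg h1 _) (pow_le_one₀ h2 h2')

/-- The slow initial factors are bounded by one. The constant `(κ₂ ^ K₁)⁻¹` pays for treating those
at most `K₁` splits as if they too had contracted by `κ₂`. -/
theorem widthBound_le {κ₁ κ₂ : ℝ} (h1 : 0 ≤ κ₁) (h1' : κ₁ ≤ 1) (h2 : 0 < κ₂) (h2' : κ₂ ≤ 1)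
    (K₁ N : ℕ) : widthBound κ₁ κ₂ K₁ N ≤ (κ₂ ^ K₁)⁻¹ * κ₂ ^ N := by
  unfold widthBound
  rw [← div_eq_inv_mul, le_div_iff₀ (by positivity), mul_assoc, ← pow_add]
  exact (mul_le_of_le_one_left (by positivity) (pow_le_one₀ h1 h1')).trans
    (pow_le_pow_of_le_one h2.le h2' (by omega))

/-- State of the path of `x` at depth `k`: the cell is a box whose widths are controlled. -/
def PathBox (σ : List Bool → Split d) (x : Cov d) (κ₁ κ₂ : ℝ) (K₁ k : ℕ) (lo hi : Fin d → ℝ) :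
    Prop :=
  (∀ j, 0 ≤ lo j) ∧ (∀ j, lo j ≤ hi j) ∧ (∀ j, hi j ≤ 1) ∧ (∀ j, lo j ≤ x j ∧ x j ≤ hi j) ∧
    (∀ y : Cov d, (∀ j, 0 < y j ∧ y j ≤ 1) → (y ∈ cell σ (node σ x k) ↔ y ∈ box lo hi)) ∧
    ∀ j, hi j - lo j ≤ widthBound κ₁ κ₂ K₁ (splitCount σ x j k)

theorem mem_side_true {c : Split d} {y : Cov d} : y ∈ side c true ↔ y c.1 ≤ c.2 := by
  simp [side]

theorem mem_side_false {c : Split d} {y : Cov d} : y ∈ side c false ↔ c.2 < y c.1 := by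
  simp [side]

theorem mem_box_update_hi {lo hi : Fin d → ℝ} {j : Fin d} {t : ℝ} (ht : t ≤ hi j) {y : Cov d} :
    y ∈ box lo (Function.update hi j t) ↔ y ∈ box lo hi ∧ y j ≤ t := by
  constructor
  · intro h
    have hj := h j
    rw [Function.update_self] at hj
    refine ⟨fun i => ?_, hj.2⟩
    rcases eq_or_ne i j with rfl | hij
    · exact ⟨hj.1, hj.2.trans ht⟩
    · have := h i
      rwa [Function.update_of_ne hij] at this
  · rintro ⟨h, hj⟩ i
    rcases eq_or_ne i j with rfl | hij
    · rw [Function.update_self]; exact ⟨(h i).1, hj⟩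
    · rw [Function.update_of_ne hij]; exact h i

theorem mem_box_update_lo {lo hi : Fin d → ℝ} {j : Fin d} {t : ℝ} (ht : lo j ≤ t) {y : Cov d} :
    y ∈ box (Function.update lo j t) hi ↔ y ∈ box lo hi ∧ t < y j := by
  constructor
  · intro h
    have hj := h j
    rw [Function.update_self] at hj
    refine ⟨fun i => ?_, hj.1⟩
    rcases eq_or_ne i j with rfl | hij
    · exact ⟨ht.trans_lt hj.1, hj.2⟩
    · have := h i
      rwa [Function.update_of_ne hij] at this
  · rintro ⟨h, hj⟩ i
    rcases eq_or_ne i j with rfl | hij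
    · rw [Function.update_self]; exact ⟨hj, (h i).2⟩
    · rw [Function.update_of_ne hij]; exact h i

/-- Induction along the path. The side away from `x` takes a definite share of the width, hence the
cell of `x` loses it. While a direction has been split fewer than `K₁` times, the global density
ratio `Q₁` gives the factor `1 - 0.8 * ρ / Q₁`; afterwards the width is at most `w₀` and the local
ratio gives `1 - 0.8 * ρ`. Cell and half-open box are compared only at points with positive
coordinates, which holds for almost all observations, while `x` may lie on the boundary and is only
kept in the closed box. -/
theorem exists_pathBox {f : Cov d → ℝ} [IsProbabilityMeasure (covLaw f)]
    (hfc : ContinuousOn f (cube d)) {ρ Q₁ w₀ : ℝ} (hρ0 : 0 < ρ) (hρ : ρ ≤ 0.2)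
    (hQ : DensityRatio f Q₁ w₀) {N₀ : ℝ} (hN₀ : 0 < N₀) {K₁ : ℕ}
    (hK₁ : (1 - 0.8 * ρ / Q₁) ^ K₁ ≤ w₀)
    {S : Finset (Fin n)} {Z : Fin n → Obs d 𝒲} (hreg : BoxRegular f (ρ / 100) N₀ S Z)
    (hZ : ∀ i ∈ S, ∀ j, 0 < (Z i).1 j ∧ (Z i).1 j ≤ 1) {σ : List Bool → Split d} {x : Cov d}
    (hx : x ∈ cube d) {k₀ : ℕ}
    (hbig : ∀ k < k₀, N₀ ≤ ρ / 100 * (within Z S (cell σ (node σ x k))).card)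
    (hsplit : ∀ k < k₀, ∀ b, ρ * (within Z S (cell σ (node σ x k))).card ≤
      (within Z S (cell σ (b :: node σ x k))).card) {k : ℕ} (hk : k ≤ k₀) :
    ∃ lo hi, PathBox σ x (1 - 0.8 * ρ / Q₁) (1 - 0.8 * ρ) K₁ k lo hi := by
  have hQ1 := hQ.one_le
  have hQ0 : 0 < Q₁ := by linarith
  have hκ₁ : 0 ≤ 1 - 0.8 * ρ / Q₁ := by
    rw [sub_nonneg, div_le_one hQ0]; linarith
  have hκ₁' : 1 - 0.8 * ρ / Q₁ ≤ 1 := by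
    have : 0 ≤ 0.8 * ρ / Q₁ := by positivity
    linarith
  have hκ₂ : 0 ≤ 1 - 0.8 * ρ := by linarith
  have hκ₂' : 1 - 0.8 * ρ ≤ 1 := by linarith
  induction k with
  | zero =>
    refine ⟨fun _ => 0, fun _ => 1, fun _ => le_rfl, fun _ => zero_le_one, fun _ => le_rfl, hx,
      fun y hy => ?_, fun j => ?_⟩
    · simp only [node, cell, Set.mem_univ, true_iff]
      exact hy
    · simp [splitCount, widthBound]
  | succ k ih =>
    obtain ⟨lo, hi, h0, hle, h1, hxb, hcell, hw⟩ := ih (by omega)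
    set q := node σ x k with hq
    set j := (σ q).1 with hj
    set t := (σ q).2 with ht
    have hNk := hbig k (by omega)
    have hcount : boxCount S Z lo hi = (within Z S (cell σ q)).card := boxCount_eq_card hZ hcell
    have hNpos : 0 < ((within Z S (cell σ q)).card : ℝ) := by
      by_contra! hcon
      nlinarith
    -- Both children contain observations, so the threshold lies strictly inside the box and both
    -- children are boxes again.
    have hne : ∀ b, ∃ i ∈ S, (Z i).1 ∈ box lo hi ∧ (Z i).1 ∈ side (σ q) b := fun b => by
      have h2 := hsplit k (by omega) b
      have h3 : 0 < ((within Z S (cell σ (b :: q))).card : ℝ) := lt_of_lt_of_le (by positivity) h2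
      obtain ⟨i, hi'⟩ := Finset.card_pos.1 (by exact_mod_cast h3)
      rw [mem_within] at hi'
      exact ⟨i, hi'.1, (hcell _ (hZ i hi'.1)).1 hi'.2.1, hi'.2.2⟩
    have htlo : lo j < t := by
      obtain ⟨i, _, h2, h3⟩ := hne true
      exact (h2 j).1.trans_le (mem_side_true.1 h3)
    have hthi : t < hi j := by
      obtain ⟨i, _, h2, h3⟩ := hne false
      exact (mem_side_false.1 h3).trans_le (h2 j).2
    have hcT : ∀ y : Cov d, (∀ j, 0 < y j ∧ y j ≤ 1) →
        (y ∈ cell σ (true :: q) ↔ y ∈ box lo (Function.update hi j t)) := fun y hy => by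
      rw [mem_box_update_hi hthi.le, ← hcell y hy]
      exact and_congr_right fun _ => mem_side_true
    have hcF : ∀ y : Cov d, (∀ j, 0 < y j ∧ y j ≤ 1) →
        (y ∈ cell σ (false :: q) ↔ y ∈ box (Function.update lo j t) hi) := fun y hy => by
      rw [mem_box_update_lo htlo.le, ← hcell y hy]
      exact and_congr_right fun _ => mem_side_false
    -- Here `[a, b]` is the interval of the sibling, the part that is cut away from the cell of `x`.
    have hshrink : ∀ a b, lo j ≤ a → a ≤ b → b ≤ hi j →
        ρ * boxCount S Z lo hi ≤
          boxCount S Z (Function.update lo j a) (Function.update hi j b) →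
        hi j - lo j - (b - a) ≤
          widthBound (1 - 0.8 * ρ / Q₁) (1 - 0.8 * ρ) K₁ (splitCount σ x j k + 1) := by
      intro a b ha hab hb hch
      have hw0 : 0 ≤ hi j - lo j := by linarith [hle j]
      rcases lt_or_ge (splitCount σ x j k) K₁ with hlt | hge
      · have := slice_width_ge hfc hρ0 hρ hN₀ hreg h0 hle h1 j ha hab hb hQ0.le
          (fun y hy y' hy' _ _ => hQ.ratio y hy y' hy') (by rw [hcount]; exact hNk) hch
        rw [widthBound_succ_of_lt hlt]
        refine le_trans ?_ (mul_le_mul_of_nonneg_right (hw j) hκ₁)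
        have h3 : 0.8 * ρ / Q₁ * (hi j - lo j) ≤ b - a := by
          rw [div_mul_eq_mul_div, div_le_iff₀ hQ0]
          have : 0 ≤ ρ * (hi j - lo j) := by positivity
          linarith
        linarith
      · have hws : hi j - lo j ≤ w₀ :=
          (hw j).trans ((widthBound_le_pow hκ₁ hκ₂ hκ₂' hge).trans hK₁)
        have := slice_width_ge hfc hρ0 hρ hN₀ hreg h0 hle h1 j ha hab hb
          (Q := 9 / 8) (by norm_num)
          (fun y hy y' hy' hyy hoff => hQ.local_ratio y hy y' hy'
            (by rw [norm_sub_eq_of_eq_off hoff]; exact hyy.trans hws))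
          (by rw [hcount]; exact hNk) hch
        rw [widthBound_succ_of_le hge]
        refine le_trans ?_ (mul_le_mul_of_nonneg_right (hw j) hκ₂)
        linarith
    have hsc : ∀ i, i ≠ j → splitCount σ x i (k + 1) = splitCount σ x i k := fun i hij => by
      have h : (σ (node σ x k)).1 ≠ i := fun h => hij h.symm
      simp [splitCount, h]
    have hscj : splitCount σ x j (k + 1) = splitCount σ x j k + 1 := by
      have h : (σ (node σ x k)).1 = j := rfl
      simp [splitCount, h]
    by_cases hxt : x j ≤ t
    · have hnode : node σ x (k + 1) = true :: q := by
        have : dir (σ q) x = true := ((mem_side_iff _ _ _).1 (mem_side_true.2 hxt)).symm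
        simp only [node]
        rw [← hq, this]
      refine ⟨lo, Function.update hi j t, h0, fun i => ?_, fun i => ?_, fun i => ?_, ?_, fun i => ?_⟩
      · rcases eq_or_ne i j with rfl | hij
        · rw [Function.update_self]; exact htlo.le
        · rw [Function.update_of_ne hij]; exact hle i
      · rcases eq_or_ne i j with rfl | hij
        · rw [Function.update_self]; exact hthi.le.trans (h1 _)
        · rw [Function.update_of_ne hij]; exact h1 i
      · rcases eq_or_ne i j with rfl | hij
        · rw [Function.update_self]; exact ⟨(hxb _).1, hxt⟩
        · rw [Function.update_of_ne hij]; exact hxb i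
      · rw [hnode]; exact hcT
      · rcases eq_or_ne i j with rfl | hij
        · rw [Function.update_self, hscj]
          have := hshrink t (hi j) htlo.le hthi.le le_rfl (by
            rw [Function.update_eq_self, boxCount_eq_card hZ hcF, hcount]
            exact hsplit k (by omega) false)
          linarith
        · rw [Function.update_of_ne hij, hsc i hij]; exact hw i
    · have hnode : node σ x (k + 1) = false :: q := by
        have : dir (σ q) x = false :=
          ((mem_side_iff _ _ _).1 (mem_side_false.2 (not_le.1 hxt))).symm
        simp only [node]
        rw [← hq, this]
      refine ⟨Function.update lo j t, hi, fun i => ?_, fun i => ?_, h1, fun i => ?_, ?_, fun i => ?_⟩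
      · rcases eq_or_ne i j with rfl | hij
        · rw [Function.update_self]; exact (h0 _).trans htlo.le
        · rw [Function.update_of_ne hij]; exact h0 i
      · rcases eq_or_ne i j with rfl | hij
        · rw [Function.update_self]; exact hthi.le
        · rw [Function.update_of_ne hij]; exact hle i
      · rcases eq_or_ne i j with rfl | hij
        · rw [Function.update_self]; exact ⟨(not_le.1 hxt).le, (hxb _).2⟩
        · rw [Function.update_of_ne hij]; exact hxb i
      · rw [hnode]; exact hcF
      · rcases eq_or_ne i j with rfl | hij
        · rw [Function.update_self, hscj]
          have := hshrink (lo j) t le_rfl htlo.le hthi.le (by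
            rw [Function.update_eq_self, boxCount_eq_card hZ hcT, hcount]
            exact hsplit k (by omega) true)
          linarith
        · rw [Function.update_of_ne hij, hsc i hij]; exact hw i

end Width

/-! ### Random number of splits along a feature -/

section SplitCount

variable {d n s p : ℕ} {𝒲 : Type*}

theorem node_congr {σ σ' : List Bool → Split d} {x : Cov d} {j : Fin d} {k : ℕ}
    (h : ∀ q : List Bool, q.length < k → σ q = σ' q) :
    node σ x k = node σ' x k ∧ splitCount σ x j k = splitCount σ' x j k := by
  induction k with
  | zero => exact ⟨rfl, rfl⟩
  | succ k ih =>
    obtain ⟨h1, h2⟩ := ih fun q hq => h q (by omega)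
    have h3 : σ (node σ' x k) = σ' (node σ' x k) := h _ (by rw [node_length]; omega)
    simp only [node, splitCount, h1, h2, h3, and_self]

variable [MeasurableSpace 𝒲] {T : TreeLearner d n s 𝒲}

theorem measurable_node_eq (hT : T.Meas) (S : Halves n s) (Z : Fin n → Obs d 𝒲) (x : Cov d) (k : ℕ)
    (q : List Bool) : Measurable fun ξ : TreeRand => node (T.split S Z ξ) x k = q := by
  have h : (fun ξ : TreeRand => node (T.split S Z ξ) x k = q) =
      fun ξ => q.length = k ∧ x ∈ cell (T.split S Z ξ) q := by
    ext ξ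
    constructor
    · rintro rfl
      exact ⟨node_length _ _ _, mem_cell_node _ _ _⟩
    · rintro ⟨rfl, h⟩
      exact (eq_node_of_mem_cell h).symm
  rw [h]
  refine measurable_const.and (measurable_mem_cell (fun q => ?_) measurable_const q)
  exact Measurable.comp (f := fun ξ : TreeRand => (Z, ξ)) (hT S q) measurable_prodMk_left

theorem measurable_splitCount (hT : T.Meas) (S : Halves n s) (Z : Fin n → Obs d 𝒲) (x : Cov d)
    (j : Fin d) (k : ℕ) : Measurable fun ξ : TreeRand => splitCount (T.split S Z ξ) x j k := by
  induction k with
  | zero => exact measurable_const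
  | succ k ih =>
    refine ih.add (Measurable.ite ?_ measurable_const measurable_const)
    refine measurableSet_setOfPred.2 ?_
    have h : (fun ξ : TreeRand => (T.split S Z ξ (node (T.split S Z ξ) x k)).1 = j) =
        fun ξ => ∃ q, node (T.split S Z ξ) x k = q ∧ (T.split S Z ξ q).1 = j := by
      ext ξ; simp
    rw [h]
    refine Measurable.exists fun q => (measurable_node_eq hT S Z x k q).and ?_
    exact measurableSet_setOfPred.1 (measurableSet_eq_fun (measurable_fst.comp
      (Measurable.comp (f := fun ξ : TreeRand => (Z, ξ)) (hT S q) measurable_prodMk_left))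
      measurable_const)

/-- A supermartingale argument. The first `k` steps of the path use only variables at nodes of depth
less than `k`. Resampling the variable of the node reached at depth `k` thus leaves the past
unchanged, and the next split is along `j` with probability at least `ϖ / d`, so the expectation
gains the factor `1 - (1 - κ) * (ϖ / d)`. -/
theorem lintegral_pow_splitCount_le (hT : T.Meas) (hA : T.Adapted) (S : Halves n s)
    (Z : Fin n → Obs d 𝒲) {x : Cov d} {r : ℕ} {ρ ϖ : ℝ} (hZ : T.RegularAt ρ ϖ r Z) {κ : ℝ}
    (hκ0 : 0 ≤ κ) (hκ1 : κ ≤ 1) (j : Fin d) {k₀ : ℕ}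
    (hint : ∀ ξ, ∀ k < k₀, T.Internal r S Z ξ (node (T.split S Z ξ) x k)) {k : ℕ} (hk : k ≤ k₀) :
    ∫⁻ ξ, ENNReal.ofReal κ ^ splitCount (T.split S Z ξ) x j k ∂treeLaw ≤
      ENNReal.ofReal (1 - (1 - κ) * (ϖ / d)) ^ k := by
  classical
  induction k with
  | zero => simp [splitCount]
  | succ k ih =>
    have ih := ih (by omega)
    have hsm : ∀ q, Measurable fun ξ : TreeRand => T.split S Z ξ q := fun q =>
      Measurable.comp (f := fun ξ : TreeRand => (Z, ξ)) (hT S q) measurable_prodMk_left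
    let w : List Bool → TreeRand → ENNReal := fun q ξ =>
      if (T.split S Z ξ q).1 = j then ENNReal.ofReal κ else 1
    have hwm : ∀ q, Measurable (w q) := fun q =>
      Measurable.ite (measurableSet_eq_fun (measurable_fst.comp (hsm q)) measurable_const)
        measurable_const measurable_const
    -- The node reached at depth `k` is random; the expectation is split according to its countably
    -- many values, so that one fixed coordinate is resampled in each term.
    let Φ : List Bool → TreeRand → ENNReal := fun q ξ =>
      if node (T.split S Z ξ) x k = q then ENNReal.ofReal κ ^ splitCount (T.split S Z ξ) x j k else 0
    have hΦm : ∀ q, Measurable (Φ q) := fun q =>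
      Measurable.ite (measurableSet_setOfPred.2 (measurable_node_eq hT S Z x k q))
        (measurable_from_top.comp (measurable_splitCount hT S Z x j k)) measurable_const
    have hsum : ∀ (g : List Bool → ENNReal) ξ, ∑' q, Φ q ξ * g q =
        ENNReal.ofReal κ ^ splitCount (T.split S Z ξ) x j k * g (node (T.split S Z ξ) x k) :=
      fun g ξ => by
        rw [tsum_eq_single (node (T.split S Z ξ) x k)]
        · simp [Φ]
        · intro q hq
          simp [Φ, hq.symm]
    have hstep : ∀ ξ, ENNReal.ofReal κ ^ splitCount (T.split S Z ξ) x j (k + 1) =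
        ∑' q, Φ q ξ * w q ξ := fun ξ => by
      rw [hsum (fun q => w q ξ)]
      simp only [splitCount, w, pow_add]
      split_ifs <;> simp
    have hbase : ∀ ξ, ENNReal.ofReal κ ^ splitCount (T.split S Z ξ) x j k = ∑' q, Φ q ξ :=
      fun ξ => by simpa using (hsum (fun _ => 1) ξ).symm
    simp_rw [hstep]
    rw [lintegral_tsum (f := fun q ξ => Φ q ξ * w q ξ)
      fun q => ((hΦm q).mul (hwm q)).aemeasurable]
    have hq : ∀ q, ∫⁻ ξ, Φ q ξ * w q ξ ∂treeLaw ≤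
        (∫⁻ ξ, Φ q ξ ∂treeLaw) * ENNReal.ofReal (1 - (1 - κ) * (ϖ / d)) := by
      intro q
      by_cases hqk : q.length = k
      swap
      · have h0 : ∀ ξ, Φ q ξ = 0 := fun ξ => by
          refine if_neg ?_
          rintro rfl
          exact hqk (node_length _ _ _)
        simp [h0]
      -- The split at `q'` uses randomness at suffixes of `q'`, all of them shorter than `q`.
      have hcongr : ∀ ξ u q', q'.length < k →
          T.split S Z (Function.update ξ q u) q' = T.split S Z ξ q' := fun ξ u q' hq' =>
        hA S Z Z _ _ q' (fun _ _ => rfl) (fun _ _ => rfl) fun q'' hq'' =>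
          Function.update_of_ne (by
            rintro rfl
            have := hq''.length_le
            omega) _ _
      have hΦu : ∀ ξ u, Φ q (Function.update ξ q u) = Φ q ξ := fun ξ u => by
        obtain ⟨h1, h2⟩ := node_congr (x := x) (j := j) fun q' hq' => hcongr ξ u q' hq'
        simp only [Φ, h1, h2]
      rw [lintegral_infinitePi_update _ q (Φ := fun ξ => Φ q ξ * w q ξ) ((hΦm q).mul (hwm q)), ← lintegral_mul_const _ (hΦm q)]
      refine lintegral_mono fun ξ => ?_
      simp only [hΦu]
      rw [lintegral_const_mul _ (f := fun u => w q (Function.update ξ q u))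
        ((hwm q).comp (measurable_update ξ))]
      by_cases hn : node (T.split S Z ξ) x k = q
      swap
      · simp [Φ, hn]
      refine mul_le_mul_right ?_ _
      have hI : T.Internal r S Z ξ q := hn ▸ hint ξ k (by omega)
      have hp := (hZ S ξ q hI).2 j
      set D : Set unitInterval := {u | (T.split S Z (Function.update ξ q u) q).1 = j} with hD
      have hDm : MeasurableSet D :=
        measurableSet_eq_fun (measurable_fst.comp ((hsm q).comp (measurable_update ξ)))
          measurable_const
      have hpr : ϖ / d ≤ (volume : Measure unitInterval).real D := by
        rw [ENNReal.ofReal_le_iff_le_toReal (measure_ne_top _ _)] at hp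
        exact hp
      have hwe : ∀ u, w q (Function.update ξ q u) =
          ENNReal.ofReal (1 - (1 - κ) * D.indicator (fun _ => (1 : ℝ)) u) := fun u => by
        by_cases hu : u ∈ D
        · have : (T.split S Z (Function.update ξ q u) q).1 = j := hu
          simp [w, hu, this]
        · have : ¬ (T.split S Z (Function.update ξ q u) q).1 = j := hu
          simp [w, hu, this]
      simp_rw [hwe]
      have hInd : Integrable (D.indicator fun _ => (1 : ℝ)) (volume : Measure unitInterval) :=
        (integrable_const _).indicator hDm
      rw [← ofReal_integral_eq_lintegral_ofReal]
      · refine ENNReal.ofReal_le_ofReal ?_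
        rw [integral_sub (integrable_const _) (hInd.const_mul _), integral_const_mul,
          integral_indicator hDm]
        simp only [integral_const, probReal_univ, smul_eq_mul, mul_one, measureReal_restrict_apply,
          MeasurableSet.univ, Set.univ_inter]
        have := mul_le_mul_of_nonneg_left hpr (sub_nonneg.2 hκ1)
        linarith
      · exact (integrable_const _).sub (hInd.const_mul _)
      · refine Eventually.of_forall fun u => ?_
        by_cases hu : u ∈ D <;> simp [hu, hκ0]
    calc _ ≤ ∑' q, (∫⁻ ξ, Φ q ξ ∂treeLaw) * ENNReal.ofReal (1 - (1 - κ) * (ϖ / d)) :=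
          ENNReal.tsum_le_tsum hq
      _ = (∫⁻ ξ, ∑' q, Φ q ξ ∂treeLaw) * ENNReal.ofReal (1 - (1 - κ) * (ϖ / d)) := by
          rw [ENNReal.tsum_mul_right, lintegral_tsum fun q => (hΦm q).aemeasurable]
      _ ≤ _ := by
          simp_rw [← hbase]
          rw [pow_succ]
          exact mul_le_mul_left ih _

end SplitCount

end DRRF

namespace DRRF

/-! ### Expected distance between a point and its neighbours. -/

section Shrinkage

variable {d n s p : ℕ} {𝒲 : Type*}

theorem norm_le_sum_abs {p : ℕ} (v : EuclideanSpace ℝ (Fin p)) : ‖v‖ ≤ ∑ j, |v j| := by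
  rw [EuclideanSpace.norm_eq]
  refine Real.sqrt_le_iff.2 ⟨Finset.sum_nonneg fun _ _ => abs_nonneg _, ?_⟩
  simp only [Real.norm_eq_abs]
  exact Finset.sum_sq_le_sq_sum_of_nonneg fun _ _ => abs_nonneg _

/-- Distance to `x`, truncated at the trivial bound. -/
noncomputable def distTo (x : Cov d) (z : Obs d 𝒲) : ℝ := min ‖z.1 - x‖ d

theorem distTo_nonneg (x : Cov d) (z : Obs d 𝒲) : 0 ≤ distTo x z :=
  le_min (norm_nonneg _) (by positivity)

theorem abs_distTo_le (x : Cov d) (z : Obs d 𝒲) : |distTo x z| ≤ d := by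
  rw [abs_of_nonneg (distTo_nonneg x z)]
  exact min_le_right _ _

theorem distTo_eq {x : Cov d} (hx : x ∈ cube d) {z : Obs d 𝒲} (hz : z.1 ∈ cube d) :
    distTo x z = ‖z.1 - x‖ := by
  refine min_eq_left ((norm_le_sum_abs _).trans ?_)
  calc ∑ j, |(z.1 - x) j| ≤ ∑ _j : Fin d, (1 : ℝ) := by
        refine Finset.sum_le_sum fun j _ => ?_
        have h1 := hx j
        have h2 := hz j
        rw [PiLp.sub_apply, abs_le]
        constructor <;> linarith [h1.1, h1.2, h2.1, h2.2]
    _ = d := by simp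

variable [MeasurableSpace 𝒲] {T : TreeLearner d n s 𝒲}

theorem measurable_distTo (x : Cov d) : Measurable (distTo x : Obs d 𝒲 → ℝ) := by
  unfold distTo
  fun_prop

omit [MeasurableSpace 𝒲] in
-- Each split keeps at least the fraction `ρ` of `S²`, so the count after `k` levels is at least `ρ
-- ^ k` times the initial one. As long as this exceeds `2 * r` the path continues.
theorem path_internal {r : ℕ} {S : Halves n s} {Z : Fin n → Obs d 𝒲} {ρ ϖ : ℝ}
    (hZ : T.RegularAt ρ ϖ r Z) (hρ0 : 0 < ρ) (hρ1 : ρ ≤ 1) {k₀ : ℕ}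
    (h2r : 2 * (r : ℝ) ≤ ρ ^ k₀ * S.1.2.card) (ξ : TreeRand) (x : Cov d) {k : ℕ} (hk : k ≤ k₀) :
    ρ ^ k * S.1.2.card ≤ (within Z S.1.2 (cell (T.split S Z ξ) (node (T.split S Z ξ) x k))).card ∧
      T.Internal r S Z ξ (node (T.split S Z ξ) x k) := by
  have himp : ∀ k ≤ k₀, ρ ^ k * S.1.2.card ≤
      (within Z S.1.2 (cell (T.split S Z ξ) (node (T.split S Z ξ) x k))).card →
      T.Internal r S Z ξ (node (T.split S Z ξ) x k) := fun k hk h => by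
    have h1 : ρ ^ k₀ * (S.1.2.card : ℝ) ≤ ρ ^ k * S.1.2.card :=
      mul_le_mul_of_nonneg_right (pow_le_pow_of_le_one hρ0.le hρ1 hk) (by positivity)
    have h2 := h2r.trans (h1.trans h)
    exact_mod_cast h2
  induction k with
  | zero =>
    have h : ρ ^ 0 * (S.1.2.card : ℝ) ≤
        (within Z S.1.2 (cell (T.split S Z ξ) (node (T.split S Z ξ) x 0))).card := by
      simp [node, cell, within_univ]
    exact ⟨h, himp 0 hk h⟩
  | succ k ih =>
    obtain ⟨h1, h2⟩ := ih (by omega)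
    have h3 := ((hZ S ξ _ h2).1 (dir (T.split S Z ξ (node (T.split S Z ξ) x k)) x)).1
    have h : ρ ^ (k + 1) * (S.1.2.card : ℝ) ≤
        (within Z S.1.2 (cell (T.split S Z ξ) (node (T.split S Z ξ) x (k + 1)))).card := by
      refine le_trans ?_ h3
      rw [pow_succ']
      rw [mul_assoc]
      exact mul_le_mul_of_nonneg_left h1 hρ0.le
    exact ⟨h, himp _ hk h⟩

/-- The leaf lies in the cell at depth `k₀`, whose diameter is at most the sum of its widths. Each
width is a constant times `(1 - 0.8 * ρ)` to the number of splits along that feature, and the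
expectation of this power decays geometrically in `k₀`. -/
theorem integral_stat_dist_le (hT : T.Meas) (hA : T.Adapted) {f : Cov d → ℝ}
    [IsProbabilityMeasure (covLaw f)] (hfc : ContinuousOn f (cube d)) {r : ℕ} {S : Halves n s}
    {Z : Fin n → Obs d 𝒲} {ρ ϖ : ℝ} (hZ : T.RegularAt ρ ϖ r Z) (hρ0 : 0 < ρ) (hρ : ρ ≤ 0.2)
    (hϖd : ϖ / d ≤ 1) {Q₁ w₀ : ℝ} (hQ : DensityRatio f Q₁ w₀) {N₀ : ℝ} (hN₀ : 0 < N₀)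
    {K₁ : ℕ} (hK₁ : (1 - 0.8 * ρ / Q₁) ^ K₁ ≤ w₀)
    (hreg : BoxRegular f (ρ / 100) N₀ S.1.2 Z)
    (hpos : ∀ i ∈ S.1.2, ∀ j, 0 < (Z i).1 j ∧ (Z i).1 j ≤ 1) {x : Cov d} (hx : x ∈ cube d) {k₀ : ℕ}
    (h2r : 2 * (r : ℝ) ≤ ρ ^ k₀ * S.1.2.card)
    (hN : N₀ ≤ ρ / 100 * (ρ ^ k₀ * S.1.2.card)) :
    ∫ ξ, T.stat r S Z ξ x (distTo x) ∂treeLaw ≤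
      d * (((1 - 0.8 * ρ) ^ K₁)⁻¹ * (1 - 0.8 * ρ * (ϖ / d)) ^ k₀) := by
  have hQ1 := hQ.one_le
  have hQ0 : 0 < Q₁ := by linarith
  have hκ₁ : 0 ≤ 1 - 0.8 * ρ / Q₁ := by
    rw [sub_nonneg, div_le_one hQ0]; linarith
  have hκ₁' : 1 - 0.8 * ρ / Q₁ ≤ 1 := by
    have : 0 ≤ 0.8 * ρ / Q₁ := by positivity
    linarith
  have hκ₂ : 0 < 1 - 0.8 * ρ := by linarith
  have hκ₂' : 1 - 0.8 * ρ ≤ 1 := by linarith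
  set A : ℝ := ((1 - 0.8 * ρ) ^ K₁)⁻¹ with hAdef
  have hA0 : 0 ≤ A := by positivity
  have hpath := fun ξ k (hk : k ≤ k₀) => path_internal hZ hρ0 (by linarith) h2r ξ x hk
  have hpt : ∀ ξ, T.stat r S Z ξ x (distTo x) ≤
      ∑ j, A * (1 - 0.8 * ρ) ^ splitCount (T.split S Z ξ) x j k₀ := fun ξ => by
    obtain ⟨lo, hi, -, -, -, hxb, hcell, hw⟩ := exists_pathBox hfc hρ0 hρ hQ hN₀ hK₁ hreg hpos hx
      (σ := T.split S Z ξ) (k₀ := k₀) (fun k hk => hN.trans (mul_le_mul_of_nonneg_left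
        ((mul_le_mul_of_nonneg_right (pow_le_pow_of_le_one hρ0.le (by linarith) hk.le)
          (by positivity)).trans (hpath ξ k hk.le).1) (by positivity)))
      (fun k hk b => ((hZ S ξ _ (hpath ξ k hk.le).2).1 b).1) le_rfl
    set R : ℝ := ∑ j, A * (1 - 0.8 * ρ) ^ splitCount (T.split S Z ξ) x j k₀ with hR
    have hR0 : 0 ≤ R := Finset.sum_nonneg fun j _ => by positivity
    have hterm : ∀ i, T.baseKernel r S Z ξ x i * distTo x (Z i) ≤ T.baseKernel r S Z ξ x i * R := by
      intro i
      by_cases hi' : i ∈ within Z S.1.2 (T.leaf r S Z ξ x)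
      · refine mul_le_mul_of_nonneg_left ?_ (baseKernel_nonneg i)
        rw [mem_within] at hi'
        have hb := (hcell _ (hpos i hi'.1)).1
          (leaf_subset_cell T r S Z ξ x (fun k' hk' => (hpath ξ k' hk'.le).2) hi'.2)
        refine (min_le_left _ _).trans ((norm_le_sum_abs _).trans (Finset.sum_le_sum fun j _ => ?_))
        refine le_trans ?_ ((hw j).trans (widthBound_le hκ₁ hκ₁' hκ₂ hκ₂' K₁ _))
        rw [PiLp.sub_apply, abs_le]
        constructor <;> linarith [(hb j).1, (hb j).2, (hxb j).1, (hxb j).2]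
      · have : T.baseKernel r S Z ξ x i = 0 := by
          unfold TreeLearner.baseKernel
          rw [if_neg hi']
        rw [this, zero_mul, zero_mul]
    unfold TreeLearner.stat
    refine (Finset.sum_le_sum fun i _ => hterm i).trans ?_
    rw [← Finset.sum_mul]
    exact mul_le_of_le_one_left hR0 sum_baseKernel_le_one
  have hcm : ∀ j, Measurable fun ξ : TreeRand =>
      (1 - 0.8 * ρ) ^ splitCount (T.split S Z ξ) x j k₀ := fun j =>
    measurable_from_top.comp (measurable_splitCount hT S Z x j k₀)
  have hci : ∀ j, Integrable (fun ξ : TreeRand =>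
      (1 - 0.8 * ρ) ^ splitCount (T.split S Z ξ) x j k₀) treeLaw := fun j =>
    integrable_of_abs_le (c := 1) (hcm j) fun ξ => by
      rw [abs_of_nonneg (by positivity)]
      exact pow_le_one₀ hκ₂.le hκ₂'
  have hrate : 0 ≤ 1 - 0.8 * ρ * (ϖ / d) := by
    have : 0.8 * ρ * (ϖ / d) ≤ 0.8 * ρ * 1 := mul_le_mul_of_nonneg_left hϖd (by positivity)
    linarith
  have hc : ∀ j, ∫ ξ, (1 - 0.8 * ρ) ^ splitCount (T.split S Z ξ) x j k₀ ∂treeLaw ≤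
      (1 - 0.8 * ρ * (ϖ / d)) ^ k₀ := fun j => by
    rw [integral_eq_lintegral_of_nonneg_ae (Eventually.of_forall fun ξ => by positivity)
      (hcm j).aestronglyMeasurable]
    refine ENNReal.toReal_le_of_le_ofReal (by positivity) ?_
    have h := lintegral_pow_splitCount_le hT hA S Z hZ (κ := 1 - 0.8 * ρ) hκ₂.le hκ₂' j
      (k₀ := k₀) (x := x) (fun ξ k hk => (hpath ξ k hk.le).2) le_rfl
    simp_rw [ENNReal.ofReal_pow hκ₂.le, ENNReal.ofReal_pow hrate]
    convert h using 3
    ring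
  have hsm : Measurable fun ξ : TreeRand => T.stat r S Z ξ x (distTo x) :=
    Measurable.comp (f := fun ξ : TreeRand => (Z, ξ))
      (measurable_stat hT r S x (measurable_distTo x)) measurable_prodMk_left
  calc _ ≤ ∫ ξ, ∑ j, A * (1 - 0.8 * ρ) ^ splitCount (T.split S Z ξ) x j k₀ ∂treeLaw :=
        integral_mono (integrable_of_abs_le hsm fun ξ =>
          abs_stat_le (by positivity) (abs_distTo_le x))
          (integrable_finsetSum _ fun j _ => (hci j).const_mul _) hpt
    _ = ∑ j, A * ∫ ξ, (1 - 0.8 * ρ) ^ splitCount (T.split S Z ξ) x j k₀ ∂treeLaw := by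
        rw [integral_finsetSum _ fun j _ => (hci j).const_mul _]
        simp_rw [integral_const_mul]
    _ ≤ ∑ _j : Fin d, A * (1 - 0.8 * ρ * (ϖ / d)) ^ k₀ :=
        Finset.sum_le_sum fun j _ => mul_le_mul_of_nonneg_left (hc j) hA0
    _ = _ := by simp

theorem ae_covLaw_pos (f : Cov d → ℝ) : ∀ᵐ y ∂covLaw f, ∀ j, 0 < y j ∧ y j ≤ 1 := by
  have h1 : ∀ᵐ y ∂(volume : Measure (Cov d)).restrict (cube d), ∀ j, y j ≠ 0 := by
    rw [ae_all_iff]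
    intro j
    rw [← map_toLp_pi_unitLaw, ae_map_iff (by fun_prop)]
    · have h := Measure.pi_hyperplane (fun _ : Fin d => unitLaw) j (0 : ℝ)
      rw [ae_iff]
      simpa using h
    · have : {y : Cov d | y j ≠ 0} = (fun y : Cov d => y j) ⁻¹' {0}ᶜ := by ext; simp
      rw [this]
      exact (measurableSet_singleton _).compl.preimage (by fun_prop)
  have h2 : ∀ᵐ y ∂covLaw f, ∀ j, y j ≠ 0 := (withDensity_absolutelyContinuous _ _).ae_le h1
  filter_upwards [h2, ae_mem_cube f] with y hy hc j
  exact ⟨lt_of_le_of_ne (hc j).1 (hy j).symm, (hc j).2⟩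

theorem ae_obsLaw_of_ae_covLaw (M : Problem d p 𝒲) [IsMarkovKernel M.condLaw] {f : Cov d → ℝ}
    [IsProbabilityMeasure (covLaw f)] {P : Cov d → Prop} (h : ∀ᵐ y ∂covLaw f, P y) :
    ∀ᵐ z ∂M.obsLaw f, P z.1 := by
  have hfst : Measure.map Prod.fst (M.obsLaw f) = covLaw f := by
    unfold Problem.obsLaw
    exact Measure.fst_compProd _ _
  rw [← hfst] at h
  exact ae_of_ae_map measurable_fst.aemeasurable h

theorem ae_pi_of_ae {E : Type*} [MeasurableSpace E] {μ : Measure E} [IsProbabilityMeasure μ]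
    {P : E → Prop} (h : ∀ᵐ z ∂μ, P z) : ∀ᵐ Z ∂Measure.pi (fun _ : Fin n => μ), ∀ i, P (Z i) :=
  ae_all_iff.2 fun i => (measurePreserving_eval (fun _ : Fin n => μ) i).quasiMeasurePreserving.ae h

theorem integral_le_of_le_off {Ω : Type*} [MeasurableSpace Ω] {μ : Measure Ω}
    [IsProbabilityMeasure μ] {g : Ω → ℝ} (hg : Integrable g μ) {A c : ℝ} (hA : 0 ≤ A)
    (hc : 0 ≤ c) (hgc : ∀ a, g a ≤ c) {D : Set Ω} (h : ∀ᵐ a ∂μ, a ∉ D → g a ≤ A) {ε : ℝ}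
    (hε : 0 ≤ ε) (hD : μ D ≤ ENNReal.ofReal ε) : ∫ a, g a ∂μ ≤ A + c * ε := by
  -- The exceptional set quantifies over uncountably many boxes in its application; a measurable
  -- hull replaces a proof of measurability.
  set D' := toMeasurable μ D
  have hD' : MeasurableSet D' := measurableSet_toMeasurable _ _
  have hDε : μ.real D' ≤ ε := ENNReal.toReal_le_of_le_ofReal hε (by
    rw [measure_toMeasurable]; exact hD)
  have hi : Integrable (fun a => D'.indicator (fun _ => c) a) μ := (integrable_const c).indicator hD'
  calc ∫ a, g a ∂μ ≤ ∫ a, (A + D'.indicator (fun _ => c) a) ∂μ := by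
        refine integral_mono_ae hg ((integrable_const _).add hi) ?_
        filter_upwards [h] with a ha
        by_cases haD : a ∈ D'
        · simp only [haD, Set.indicator_of_mem]
          linarith [hgc a]
        · simp only [haD, not_false_eq_true, Set.indicator_of_notMem, add_zero]
          exact ha fun h' => haD (subset_toMeasurable μ D h')
    _ = A + c * μ.real D' := by
        rw [integral_add (integrable_const _) hi, integral_indicator hD']
        simp [mul_comm]
    _ ≤ _ := by gcongr

theorem integral_integral_stat_dist_le (hT : T.Meas) (hA : T.Adapted) (M : Problem d p 𝒲)
    [IsMarkovKernel M.condLaw] {f : Cov d → ℝ} [IsProbabilityMeasure (covLaw f)]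
    (hfc : ContinuousOn f (cube d)) {fmax : ℝ} (hf : ∀ x ∈ cube d, f x ≤ fmax) (hfm : 0 ≤ fmax)
    {r : ℕ} {S : Halves n s} {ρ ϖ : ℝ}
    (hZ : ∀ᵐ Z ∂Measure.pi (fun _ : Fin n => M.obsLaw f), T.RegularAt ρ ϖ r Z)
    (hρ0 : 0 < ρ) (hρ : ρ ≤ 0.2) (hϖd : ϖ / d ≤ 1) {Q₁ w₀ : ℝ}
    (hQ : DensityRatio f Q₁ w₀) {N₀ : ℝ} (hN₀ : 0 < N₀) {K₁ : ℕ}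
    (hK₁ : (1 - 0.8 * ρ / Q₁) ^ K₁ ≤ w₀) {x : Cov d} (hx : x ∈ cube d) {k₀ G : ℕ}
    (h2r : 2 * (r : ℝ) ≤ ρ ^ k₀ * (s - s / 2 : ℕ))
    (hN : N₀ ≤ ρ / 100 * (ρ ^ k₀ * (s - s / 2 : ℕ))) (hG : 1 ≤ G)
    (hGN : 2 * d * fmax * (s - s / 2 : ℕ) ≤ ρ / 300 * N₀ * G) :
    ∫ Z, ∫ ξ, T.stat r S Z ξ x (distTo x) ∂treeLaw ∂Measure.pi (fun _ : Fin n => M.obsLaw f) ≤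
      d * (((1 - 0.8 * ρ) ^ K₁)⁻¹ * (1 - 0.8 * ρ * (ϖ / d)) ^ k₀) +
        d * (((G : ℝ) + 1) ^ (2 * d) * (2 * Real.exp (-((ρ / 300) ^ 2 * N₀)))) := by
  have := isProbabilityMeasure_obsLaw M f
  have hcard := S.2.2.2
  have hst := measurable_stat hT r S x (measurable_distTo (𝒲 := 𝒲) x)
  have hbd : ∀ Z, |∫ ξ, T.stat r S Z ξ x (distTo x) ∂treeLaw| ≤ d := fun Z => by
    simpa using norm_integral_le_of_norm_le_const (μ := treeLaw)
      (f := fun ξ => T.stat r S Z ξ x (distTo x)) (C := d)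
      (Eventually.of_forall fun ξ => abs_stat_le (by positivity) (abs_distTo_le x))
  have hrate : 0 ≤ 1 - 0.8 * ρ * (ϖ / d) := by
    have : 0.8 * ρ * (ϖ / d) ≤ 0.8 * ρ * 1 := mul_le_mul_of_nonneg_left hϖd (by positivity)
    linarith
  have hκ₂ : 0 < 1 - 0.8 * ρ := by linarith
  have hpos := ae_pi_of_ae (n := n) (ae_obsLaw_of_ae_covLaw M (ae_covLaw_pos f))
  refine integral_le_of_le_off
    (integrable_of_abs_le hst.stronglyMeasurable.integral_prod_right'.measurable hbd)
    (by positivity) (by positivity) (fun Z => (le_abs_self _).trans (hbd Z))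
    (D := {Z | ¬ BoxRegular f (3 * (ρ / 300)) N₀ S.1.2 Z}) ?_ (by positivity)
    (measure_not_boxRegular_le M hf hfm S.1.2 (by positivity) (by linarith) hG
      (by rw [hcard]; exact hGN))
  filter_upwards [hZ, hpos] with Z hZ hpos hgood
  have hgood' : BoxRegular f (ρ / 100) N₀ S.1.2 Z := by
    have h : 3 * (ρ / 300) = ρ / 100 := by ring
    rw [h] at hgood
    exact not_not.1 hgood
  exact integral_stat_dist_le hT hA hfc hZ hρ0 hρ hϖd hQ hN₀ hK₁ hgood' (fun i _ => hpos i) hx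
    (by rw [hcard]; exact h2r) (by rw [hcard]; exact hN)

end Shrinkage

end DRRF

namespace DRRF

/-! ### Choice of the depth and the resulting exponent. -/

section Rate

theorem rateParam_pos {ρ ϖ : ℝ} (hρ0 : 0 < ρ) (hρ : ρ ≤ 0.2) (hϖ0 : 0 < ϖ) :
    0 < rateParam ρ ϖ := by
  unfold rateParam
  have h1 : 1 < ρ⁻¹ := (one_lt_inv₀ hρ0).2 (by linarith)
  have h2 : 1 < (1 - ρ)⁻¹ := (one_lt_inv₀ (by linarith)).2 (by linarith)
  have := Real.log_pos h1
  have := Real.log_pos h2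
  positivity

/-- For `ρ ≤ 0.2`, `log (1 - ρ)⁻¹ ≤ 1.25 * ρ`. Apart from the common factor `(ϖ / d) / log ρ⁻¹`, the
left side is at most `0.625 * ρ` and the right side is `0.72 * ρ`. This gap absorbs both the loss
`0.8` in the contraction and the loss `0.9` in the depth. -/
theorem exponent_lt {d : ℕ} (hd : 1 ≤ d) {ρ ϖ : ℝ} (hρ0 : 0 < ρ) (hρ : ρ ≤ 0.2) (hϖ0 : 0 < ϖ) :
    1 / (2 * rateParam ρ ϖ * d) < 0.9 * (0.8 * ρ * (ϖ / d)) / Real.log ρ⁻¹ := by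
  have h1 : 1 < ρ⁻¹ := (one_lt_inv₀ hρ0).2 (by linarith)
  have hℓ := Real.log_pos h1
  have h2 : 1 < (1 - ρ)⁻¹ := (one_lt_inv₀ (by linarith)).2 (by linarith)
  have hL := Real.log_pos h2
  have hd0 : (0 : ℝ) < d := by exact_mod_cast hd
  have hL2 : Real.log (1 - ρ)⁻¹ ≤ 1.25 * ρ := by
    refine (Real.log_le_sub_one_of_pos (by linarith)).trans ?_
    rw [sub_le_iff_le_add, inv_le_iff_one_le_mul₀ (by linarith)]
    nlinarith
  have e : 1 / (2 * rateParam ρ ϖ * d) =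
      (Real.log (1 - ρ)⁻¹ / 2) * (ϖ / d) / Real.log ρ⁻¹ := by
    unfold rateParam
    field_simp
  rw [e]
  refine div_lt_div_of_pos_right ?_ hℓ
  have : 0 < ϖ / d := by positivity
  nlinarith

/-- Take `N₀ = m ^ 0.1`, a depth `k₀` of about `0.9 * log m / log ρ⁻¹`, which leaves of order `m ^
0.1` observations in a cell, and a grid size `G` linear in `m`. The geometric term then has exponent
larger than required by `exponent_lt`, and the failure term is a power of `m` times `exp (-b * m ^
0.1)`. Each is eventually at most half of the target. -/
theorem eventually_exists_depth {d : ℕ} (hd : 1 ≤ d) {ρ ϖ : ℝ} (hρ0 : 0 < ρ) (hρ : ρ ≤ 0.2)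
    (hϖ0 : 0 < ϖ) (hϖ : ϖ ≤ 1) {fmax A : ℝ} (hfm : 0 ≤ fmax) (hA : 0 ≤ A) (r : ℕ) :
    ∀ᶠ m : ℝ in atTop, ∃ (N₀ : ℝ) (k₀ G : ℕ), 0 < N₀ ∧ 2 * (r : ℝ) ≤ ρ ^ k₀ * m ∧
      N₀ ≤ ρ / 100 * (ρ ^ k₀ * m) ∧ 1 ≤ G ∧ 2 * d * fmax * m ≤ ρ / 300 * N₀ * G ∧
      d * (A * (1 - 0.8 * ρ * (ϖ / d)) ^ k₀) +
        d * (((G : ℝ) + 1) ^ (2 * d) * (2 * Real.exp (-((ρ / 300) ^ 2 * N₀)))) ≤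
        (2 * m) ^ (-(1 / (2 * rateParam ρ ϖ * d))) := by
  have hd0 : (0 : ℝ) < d := by exact_mod_cast hd
  have hd1 : (1 : ℝ) ≤ d := by exact_mod_cast hd
  have h1 : 1 < ρ⁻¹ := (one_lt_inv₀ hρ0).2 (by linarith)
  have hℓ := Real.log_pos h1
  set ℓ := Real.log ρ⁻¹ with hℓdef
  set η := 0.8 * ρ * (ϖ / d) with hη
  have hη0 : 0 < η := by positivity
  set c := 1 / (2 * rateParam ρ ϖ * d) with hc
  have hc0 : 0 < c := by have := rateParam_pos hρ0 hρ hϖ0; positivity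
  have hce : c < 0.9 * η / ℓ := exponent_lt hd hρ0 hρ hϖ0
  set b := (ρ / 300) ^ 2 with hb
  have hb0 : 0 < b := by positivity
  set Cg : ℝ := 600 * d * fmax / ρ + 3 with hCg
  have hCg0 : 0 < Cg := by positivity
  set C1 : ℝ := d * (A * (Real.exp η * (ρ / 100) ^ (-(η / ℓ)))) with hC1
  set C2 : ℝ := d * (Cg ^ (2 * d) * 2) with hC2
  have hC10 : 0 ≤ C1 := by positivity
  have hC20 : 0 ≤ C2 := by positivity
  have t1 : Tendsto (fun m : ℝ => C1 * m ^ (-(0.9 * η / ℓ - c))) atTop (nhds 0) := by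
    simpa using (tendsto_rpow_neg_atTop (sub_pos.2 hce)).const_mul C1
  have t2 : Tendsto (fun m : ℝ => C2 * ((m ^ (0.1 : ℝ)) ^ (10 * (2 * d + c)) *
      Real.exp (-b * m ^ (0.1 : ℝ)))) atTop (nhds 0) := by
    have := (tendsto_rpow_mul_exp_neg_mul_atTop_nhds_zero (10 * (2 * d + c)) b hb0).comp
      (tendsto_rpow_atTop (show (0 : ℝ) < 0.1 by norm_num))
    simpa using this.const_mul C2
  have hpos : (0 : ℝ) < 2 ^ (-c) / 2 := by positivity
  have t3 : Tendsto (fun m : ℝ => 100 / ρ * m ^ (0.1 : ℝ)) atTop atTop :=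
    (tendsto_rpow_atTop (by norm_num)).const_mul_atTop (by positivity)
  have t4 : Tendsto (fun m : ℝ => ρ / 100 * m ^ (0.9 : ℝ)) atTop atTop :=
    (tendsto_rpow_atTop (by norm_num)).const_mul_atTop (by positivity)
  filter_upwards [t1.eventually_le_const hpos, t2.eventually_le_const hpos,
    t3.eventually_ge_atTop (2 * (r : ℝ)), t4.eventually_ge_atTop 1, eventually_ge_atTop 1]
    with m e1 e2 e3 e4 hm
  have hm0 : 0 < m := by linarith
  have hmsplit : m ^ (0.1 : ℝ) * m ^ (0.9 : ℝ) = m := by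
    rw [← Real.rpow_add hm0]; norm_num
  have hN1 : 1 ≤ m ^ (0.1 : ℝ) := Real.one_le_rpow hm (by norm_num)
  have hN0 : 0 < m ^ (0.1 : ℝ) := by positivity
  -- The largest depth with `ρ ^ k₀ ≥ (ρ / 100 * m ^ 0.9)⁻¹` is `⌊X / ℓ⌋`; it keeps `100 / ρ * m ^
  -- 0.1` observations, just what `N₀` demands.
  set X := Real.log (ρ / 100 * m ^ (0.9 : ℝ)) with hX
  have hX0 : 0 ≤ X := Real.log_nonneg e4
  set k₀ := ⌊X / ℓ⌋₊ with hk₀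
  have hk1 : (k₀ : ℝ) * ℓ ≤ X := by
    rw [← le_div_iff₀ hℓ]
    exact Nat.floor_le (by positivity)
  have hk2 : X / ℓ - 1 ≤ k₀ := by
    have := (Nat.lt_floor_add_one (X / ℓ)).le
    linarith
  have hρk : (ρ / 100 * m ^ (0.9 : ℝ))⁻¹ ≤ ρ ^ k₀ := by
    have h2 : ρ ^ k₀ = Real.exp (-(k₀ * ℓ)) := by
      rw [hℓdef, Real.log_inv, mul_neg, neg_neg, Real.exp_nat_mul, Real.exp_log hρ0]
    have h3 : (ρ / 100 * m ^ (0.9 : ℝ))⁻¹ = Real.exp (-X) := by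
      rw [Real.exp_neg, Real.exp_log (by positivity)]
    rw [h2, h3]
    exact Real.exp_le_exp.2 (by linarith)
  have hρkm : 100 / ρ * m ^ (0.1 : ℝ) ≤ ρ ^ k₀ * m := by
    refine le_trans (le_of_eq ?_) (mul_le_mul_of_nonneg_right hρk hm0.le)
    have h5 : (m ^ (0.9 : ℝ)) ≠ 0 := by positivity
    nth_rewrite 3 [← hmsplit]
    field_simp
  -- From the mesh condition `2 * d * fmax * m ≤ ρ / 300 * N₀ * G` with `N₀ ≥ 1`.
  set G := ⌈600 * d * fmax * m / ρ⌉₊ + 1 with hG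
  have hG1 : 600 * d * fmax * m / ρ ≤ G := by
    rw [hG]; push_cast
    linarith [Nat.le_ceil (600 * d * fmax * m / ρ)]
  have hG2 : (G : ℝ) + 1 ≤ Cg * m := by
    have h4 := (Nat.ceil_lt_add_one (show 0 ≤ 600 * d * fmax * m / ρ by positivity)).le
    have h5 : 600 * d * fmax * m / ρ = 600 * d * fmax / ρ * m := by ring
    rw [hG, hCg]; push_cast
    rw [h5] at h4 ⊢
    nlinarith
  refine ⟨m ^ (0.1 : ℝ), k₀, G, hN0, e3.trans hρkm, ?_, by omega, ?_, ?_⟩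
  · have := mul_le_mul_of_nonneg_left hρkm (show 0 ≤ ρ / 100 by positivity)
    refine le_trans (le_of_eq ?_) this
    field_simp
  · have h6 : 2 * d * fmax * m = ρ / 300 * 1 * (600 * d * fmax * m / ρ) := by
      field_simp; ring
    rw [h6]
    gcongr
  · have hη1 : η ≤ 1 := by
      have : ϖ / d ≤ 1 := (div_le_one hd0).2 (hϖ.trans hd1)
      calc η ≤ 0.8 * ρ * 1 := mul_le_mul_of_nonneg_left this (by positivity)
        _ ≤ 1 := by linarith
    have f1 : (1 - η) ^ k₀ ≤ Real.exp η * (ρ / 100) ^ (-(η / ℓ)) * m ^ (-(0.9 * η / ℓ)) := by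
      have h7 : (1 - η) ^ k₀ ≤ Real.exp (-(η * k₀)) := by
        have := pow_le_pow_left₀ (by linarith) (Real.one_sub_le_exp_neg η) k₀
        rwa [← Real.exp_nat_mul, mul_neg, mul_comm (k₀ : ℝ)] at this
      refine h7.trans ?_
      have h8 : Real.exp η * (ρ / 100) ^ (-(η / ℓ)) * m ^ (-(0.9 * η / ℓ)) =
          Real.exp (η - η / ℓ * X) := by
        rw [hX, Real.log_mul (by positivity) (by positivity), Real.log_rpow hm0,
          Real.rpow_def_of_pos (by positivity), Real.rpow_def_of_pos hm0, ← Real.exp_add,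
          ← Real.exp_add]
        congr 1
        ring
      rw [h8]
      refine Real.exp_le_exp.2 ?_
      have := mul_le_mul_of_nonneg_left hk2 hη0.le
      have h9 : η * (X / ℓ - 1) = η / ℓ * X - η := by ring
      linarith
    have f2 : d * (A * (1 - η) ^ k₀) ≤ 2 ^ (-c) / 2 * m ^ (-c) := by
      calc d * (A * (1 - η) ^ k₀) ≤
            d * (A * (Real.exp η * (ρ / 100) ^ (-(η / ℓ)) * m ^ (-(0.9 * η / ℓ)))) := by gcongr
        _ = C1 * m ^ (-(0.9 * η / ℓ - c)) * m ^ (-c) := by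
            have : m ^ (-(0.9 * η / ℓ)) = m ^ (-(0.9 * η / ℓ - c)) * m ^ (-c) := by
              rw [← Real.rpow_add hm0]; congr 1; ring
            rw [this, hC1]; ring
        _ ≤ _ := mul_le_mul_of_nonneg_right e1 (by positivity)
    have f3 : d * (((G : ℝ) + 1) ^ (2 * d) * (2 * Real.exp (-(b * m ^ (0.1 : ℝ))))) ≤
        2 ^ (-c) / 2 * m ^ (-c) := by
      calc d * (((G : ℝ) + 1) ^ (2 * d) * (2 * Real.exp (-(b * m ^ (0.1 : ℝ))))) ≤
            d * ((Cg * m) ^ (2 * d) * (2 * Real.exp (-(b * m ^ (0.1 : ℝ))))) := by gcongr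
        _ = C2 * ((m ^ (0.1 : ℝ)) ^ (10 * (2 * d + c)) *
              Real.exp (-b * m ^ (0.1 : ℝ))) * m ^ (-c) := by
            have h10 : (m ^ (0.1 : ℝ)) ^ (10 * (2 * d + c)) * m ^ (-c) = m ^ (2 * d) := by
              rw [← Real.rpow_mul hm0.le, ← Real.rpow_add hm0, ← Real.rpow_natCast]
              congr 1
              push_cast
              ring
            rw [mul_pow, ← h10, hC2, neg_mul]; ring
        _ ≤ _ := mul_le_mul_of_nonneg_right e2 (by positivity)
    rw [Real.mul_rpow (by norm_num) hm0.le]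
    linarith

end Rate

/-- Kernel shrinkage: the expected distance between `x` and the neighbours chosen by a tree. -/
theorem eventually_stat_dist_le {d : ℕ} (hd : 1 ≤ d) {f : Cov d → ℝ} {fmin fmax : ℝ}
    (hfmin : 0 < fmin) (hf : ∀ x ∈ cube d, fmin ≤ f x ∧ f x ≤ fmax) (hfc : ContinuousOn f (cube d))
    [IsProbabilityMeasure (covLaw f)] {ρ ϖ : ℝ} (hρ0 : 0 < ρ) (hρ : ρ ≤ 0.2) (hϖ0 : 0 < ϖ)
    (hϖ : ϖ ≤ 1) (r : ℕ) :
    ∀ᶠ s : ℕ in atTop, ∀ {n p : ℕ} {𝒲 : Type*} [MeasurableSpace 𝒲] (M : Problem d p 𝒲)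
      [IsMarkovKernel M.condLaw] (T : TreeLearner d n s 𝒲), T.Meas → T.Adapted →
      (∀ᵐ Z ∂Measure.pi (fun _ : Fin n => M.obsLaw f), T.RegularAt ρ ϖ r Z) →
      ∀ x ∈ cube d, ∀ S : Halves n s,
        ∫ Z, ∫ ξ, T.stat r S Z ξ x (distTo x) ∂treeLaw ∂Measure.pi (fun _ : Fin n => M.obsLaw f) ≤
          (s : ℝ) ^ (-(1 / (2 * rateParam ρ ϖ * d))) := by
  obtain ⟨Q₁, w₀, hw₀, hQ⟩ := exists_densityRatio hfc hfmin hf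
  have hd0 : (0 : ℝ) < d := by exact_mod_cast hd
  have hd1 : (1 : ℝ) ≤ d := by exact_mod_cast hd
  have hQ0 : 0 < Q₁ := by linarith [hQ.one_le]
  -- A fixed number of splits brings a direction into the local regime; it depends on `f` and `ρ`
  -- only, so its cost is a constant.
  obtain ⟨K₁, hK₁⟩ : ∃ K₁ : ℕ, (1 - 0.8 * ρ / Q₁) ^ K₁ < w₀ := by
    refine exists_pow_lt_of_lt_one hw₀ ?_
    have : 0 < 0.8 * ρ / Q₁ := by positivity
    linarith
  have h0 : (0 : Cov d) ∈ cube d := fun j => by simp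
  have hfm : 0 ≤ fmax := hfmin.le.trans ((hf 0 h0).1.trans (hf 0 h0).2)
  have hκ : 0 < 1 - 0.8 * ρ := by linarith
  have hev := eventually_exists_depth hd hρ0 hρ hϖ0 hϖ hfm
    (A := ((1 - 0.8 * ρ) ^ K₁)⁻¹) (by positivity) r
  have ht : Tendsto (fun s : ℕ => ((s - s / 2 : ℕ) : ℝ)) atTop atTop := by
    refine tendsto_natCast_atTop_atTop.comp (tendsto_atTop_mono (f := fun s : ℕ => s / 2)
      (fun s => by omega) ?_)
    exact Nat.tendsto_div_const_atTop (by norm_num)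
  have hc0 : 0 < 1 / (2 * rateParam ρ ϖ * d) := by
    have := rateParam_pos hρ0 hρ hϖ0
    positivity
  -- The threshold on `s` is fixed before the problem and the learner are introduced, so these may
  -- vary with the sample size.
  filter_upwards [ht.eventually hev, eventually_ge_atTop 1] with s hs hs1
  intro n p 𝒲 _ M _ T hT hA hZ x hx S
  obtain ⟨N₀, k₀, G, hN₀, h2r, hN, hG, hGN, hfin⟩ := hs
  refine (integral_integral_stat_dist_le hT hA M hfc (fun x hx => (hf x hx).2) hfm hZ hρ0 hρ
    ((div_le_one hd0).2 (hϖ.trans hd1)) hQ hN₀ hK₁.le hx h2r hN hG hGN).trans (hfin.trans ?_)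
  -- The estimate is in terms of `m`, the size of `S²`, and `2 * m ≥ s`.
  refine Real.rpow_le_rpow_of_nonpos (by exact_mod_cast hs1) ?_ (by linarith)
  have : s ≤ 2 * (s - s / 2) := by omega
  exact_mod_cast this

end DRRF

namespace DRRF

/-! ### Deterministic analysis of the weighted lasso. -/

section Lasso

variable {n p : ℕ}

theorem quad_eq_sum (A : Matrix (Fin p) (Fin p) ℝ) (u : Param p) :
    quad A u = ∑ a, ∑ b, u a * u b * A a b := by
  simp only [quad, dotProduct, Matrix.mulVec, Finset.mul_sum]
  exact Finset.sum_congr rfl fun a _ => Finset.sum_congr rfl fun b _ => by ring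

theorem abs_quad_le {A : Matrix (Fin p) (Fin p) ℝ} {η : ℝ} (hA : ∀ a b, |A a b| ≤ η)
    (u : Param p) : |quad A u| ≤ η * l1 u ^ 2 := by
  rw [quad_eq_sum]
  calc |∑ a, ∑ b, u a * u b * A a b| ≤ ∑ a, ∑ b, |u a| * |u b| * η := by
        refine (Finset.abs_sum_le_sum_abs _ _).trans (Finset.sum_le_sum fun a _ => ?_)
        refine (Finset.abs_sum_le_sum_abs _ _).trans (Finset.sum_le_sum fun b _ => ?_)
        rw [abs_mul, abs_mul]
        exact mul_le_mul_of_nonneg_left (hA a b) (by positivity)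
    _ = η * l1 u ^ 2 := by
        rw [l1, sq, Finset.sum_mul_sum, Finset.mul_sum]
        refine Finset.sum_congr rfl fun a _ => ?_
        rw [Finset.mul_sum]
        exact Finset.sum_congr rfl fun b _ => by ring

theorem sum_abs_le_sqrt_mul_norm {k : ℕ} (u : Param p) {S : Finset (Fin p)} (hS : S.card ≤ k) :
    ∑ j ∈ S, |u j| ≤ Real.sqrt k * ‖u‖ := by
  have h : (∑ j ∈ S, |u j|) ^ 2 ≤ (Real.sqrt k * ‖u‖) ^ 2 := by
    rw [mul_pow, Real.sq_sqrt (by positivity), EuclideanSpace.norm_sq_eq]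
    simp only [Real.norm_eq_abs]
    calc (∑ j ∈ S, |u j|) ^ 2 ≤ S.card * ∑ j ∈ S, |u j| ^ 2 := sq_sum_le_card_mul_sum_sq
      _ ≤ k * ∑ j, |u j| ^ 2 := by
          refine mul_le_mul (by exact_mod_cast hS) ?_ (by positivity) (by positivity)
          exact Finset.sum_le_sum_of_subset_of_nonneg (Finset.subset_univ _) fun _ _ _ => by
            positivity
  exact le_of_sq_le_sq h (by positivity)

/-- Deterministic error bound of a weighted lasso at an approximately sparse parameter `ν₀`. -/
theorem lasso_error_le {K : Fin n → ℝ} (hK : ∀ i, 0 ≤ K i)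
    {V : Set (Param p)} {ν₀ v : Param p} (hν₀ : ν₀ ∈ V)
    {lo : Fin n → Param p → ℝ} {g : Fin n → Fin p → ℝ} {H Hbar : Fin n → Matrix (Fin p) (Fin p) ℝ}
    {G : Fin p → ℝ} {lam τ η γ : ℝ} {k : ℕ} (hlam : 0 < lam) (hτ : 0 ≤ τ) (hγ : 0 < γ)
    (hmin : IsMinOn (fun u => ∑ i, K i * lo i u + lam * l1 u) V v)
    (htaylor : ∀ i, ∑ j, g i j * (v - ν₀) j + quad (H i) (v - ν₀) / 2 ≤ lo i v - lo i ν₀)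
    (hH : ∀ i, 0 ≤ quad (H i) (v - ν₀))
    (hfoc : 0 ≤ ∑ j, G j * (v - ν₀) j)
    (hnoise : ∀ j, |∑ i, K i * g i j - G j| ≤ lam / 3)
    (hentry : ∀ a b, |∑ i, K i * (H i a b - Hbar i a b)| ≤ η) (hη : η ≤ γ / (64 * (k + 1)))
    (hbar : ∀ i, 0 ≤ quad (Hbar i) (v - ν₀)) {N : Finset (Fin n)} (hN : 1 / 2 ≤ ∑ i ∈ N, K i)
    {S : Finset (Fin p)} (hS : S.card ≤ k) (hS' : ∑ j ∈ Sᶜ, |ν₀ j| ≤ k * τ)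
    (hre : ∀ i ∈ N, ∀ u ∈ cone S, γ * ‖u‖ ^ 2 ≤ quad (Hbar i) u) :
    ‖v - ν₀‖ ≤ 12 * k * τ + 16 * Real.sqrt k * lam / γ := by
  set u := v - ν₀ with hu
  set a := ∑ j ∈ S, |u j| with ha
  set b := ∑ j ∈ Sᶜ, |u j| with hb
  have ha0 : 0 ≤ a := Finset.sum_nonneg fun _ _ => abs_nonneg _
  have hb0 : 0 ≤ b := Finset.sum_nonneg fun _ _ => abs_nonneg _
  have hl1 : l1 u = a + b := (Finset.sum_add_sum_compl S _).symm
  set Q := ∑ i, K i * quad (H i) u with hQ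
  have hQ0 : 0 ≤ Q := Finset.sum_nonneg fun i _ => mul_nonneg (hK i) (hH i)
  have hbasic : ∑ i, K i * lo i v + lam * l1 v ≤ ∑ i, K i * lo i ν₀ + lam * l1 ν₀ := hmin hν₀
  have h1 : ∑ j, (∑ i, K i * g i j) * u j + Q / 2 ≤ ∑ i, K i * lo i v - ∑ i, K i * lo i ν₀ := by
    rw [← Finset.sum_sub_distrib]
    calc _ = ∑ i, K i * (∑ j, g i j * u j + quad (H i) u / 2) := by
          simp_rw [hQ, mul_add, Finset.sum_add_distrib, Finset.sum_mul, Finset.mul_sum]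
          rw [Finset.sum_comm, Finset.sum_div]
          congr 1
          · exact Finset.sum_congr rfl fun i _ => Finset.sum_congr rfl fun j _ => by ring
          · exact Finset.sum_congr rfl fun i _ => by ring
      _ ≤ ∑ i, (K i * lo i v - K i * lo i ν₀) := Finset.sum_le_sum fun i _ => by
          rw [← mul_sub]
          exact mul_le_mul_of_nonneg_left (htaylor i) (hK i)
  -- The empirical gradient is within `lam / 3` of `G`, and `G` pairs nonnegatively with `u` by the
  -- first-order condition; it need not vanish when `ν₀` is on the boundary of `V`.
  have h2 : -(lam / 3 * l1 u) ≤ ∑ j, (∑ i, K i * g i j) * u j := by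
    have h3 : -(lam / 3 * l1 u) ≤ ∑ j, (∑ i, K i * g i j - G j) * u j := by
      rw [l1, Finset.mul_sum, ← Finset.sum_neg_distrib]
      refine Finset.sum_le_sum fun j _ => ?_
      have h4 : |(∑ i, K i * g i j - G j) * u j| ≤ lam / 3 * |u j| := by
        rw [abs_mul]
        exact mul_le_mul_of_nonneg_right (hnoise j) (abs_nonneg _)
      linarith [neg_abs_le ((∑ i, K i * g i j - G j) * u j)]
    simp_rw [sub_mul, Finset.sum_sub_distrib] at h3
    linarith
  have h3 : b - a - 2 * (k * τ) ≤ l1 v - l1 ν₀ := by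
    have hS1 : -a ≤ ∑ j ∈ S, (|v j| - |ν₀ j|) := by
      rw [ha, ← Finset.sum_neg_distrib]
      refine Finset.sum_le_sum fun j _ => ?_
      have : u j = v j - ν₀ j := rfl
      rw [this]
      linarith [abs_sub_abs_le_abs_sub (ν₀ j) (v j), abs_sub_comm (ν₀ j) (v j)]
    have hS2 : b - 2 * ∑ j ∈ Sᶜ, |ν₀ j| ≤ ∑ j ∈ Sᶜ, (|v j| - |ν₀ j|) := by
      rw [hb, Finset.mul_sum, ← Finset.sum_sub_distrib]
      refine Finset.sum_le_sum fun j _ => ?_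
      have : u j = v j - ν₀ j := rfl
      rw [this]
      linarith [abs_sub (v j) (ν₀ j)]
    have : l1 v - l1 ν₀ = ∑ j ∈ S, (|v j| - |ν₀ j|) + ∑ j ∈ Sᶜ, (|v j| - |ν₀ j|) := by
      rw [Finset.sum_add_sum_compl, Finset.sum_sub_distrib]
      rfl
    linarith
  -- Optimality against `ν₀`, the Taylor bound, the noise bound, and the triangle inequality for the
  -- penalty, where the small coordinates of `ν₀` cost `2 * k * τ`.
  have hkey : Q / 2 + 2 * lam / 3 * b ≤ 4 * lam / 3 * a + 2 * lam * (k * τ) := by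
    have := mul_le_mul_of_nonneg_left h3 hlam.le
    rw [hl1] at h2
    nlinarith
  have hb2 : b ≤ 2 * a + 3 * (k * τ) := by
    have h5 : lam * b ≤ lam * (2 * a + 3 * (k * τ)) := by nlinarith
    exact le_of_mul_le_mul_left h5 hlam
  have hkτ : 0 ≤ k * τ := by positivity
  have hlast : 0 ≤ 16 * Real.sqrt k * lam / γ := by positivity
  -- Either the error on `S` is of the size of the neglected coordinates, and then `a + b ≤ 12 * k *
  -- τ`, or `3 * k * τ < a` and `hb2` places `u` in the cone.
  by_cases hcase : a ≤ 3 * (k * τ)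
  · have := norm_le_sum_abs u
    have h6 : ∑ j, |u j| = a + b := hl1
    nlinarith
  · push Not at hcase
    have hcone : u ∈ cone S := by
      show b ≤ 3 * a
      linarith
    -- The eigenvalue bound holds only at the near points `N`, which carry half of the weight; the
    -- other terms are nonnegative.
    have hbarsum : γ / 2 * ‖u‖ ^ 2 ≤ ∑ i, K i * quad (Hbar i) u := by
      calc γ / 2 * ‖u‖ ^ 2 = 1 / 2 * (γ * ‖u‖ ^ 2) := by ring
        _ ≤ (∑ i ∈ N, K i) * (γ * ‖u‖ ^ 2) := mul_le_mul_of_nonneg_right hN (by positivity)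
        _ = ∑ i ∈ N, K i * (γ * ‖u‖ ^ 2) := Finset.sum_mul _ _ _
        _ ≤ ∑ i ∈ N, K i * quad (Hbar i) u := Finset.sum_le_sum fun i hi =>
            mul_le_mul_of_nonneg_left (hre i hi u hcone) (hK i)
        _ ≤ _ := Finset.sum_le_sum_of_subset_of_nonneg (Finset.subset_univ _) fun i _ _ =>
            mul_nonneg (hK i) (hbar i)
    have herr : |Q - ∑ i, K i * quad (Hbar i) u| ≤ η * l1 u ^ 2 := by
      have : Q - ∑ i, K i * quad (Hbar i) u =
          quad (Matrix.of fun a b => ∑ i, K i * (H i a b - Hbar i a b)) u := by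
        simp only [hQ, quad_eq_sum, Matrix.of_apply]
        rw [← Finset.sum_sub_distrib]
        simp_rw [← mul_sub, ← Finset.sum_sub_distrib, Finset.mul_sum]
        rw [Finset.sum_comm]
        refine Finset.sum_congr rfl fun a _ => ?_
        rw [Finset.sum_comm]
        exact Finset.sum_congr rfl fun b _ => Finset.sum_congr rfl fun i _ => by ring
      rw [this]
      exact abs_quad_le hentry u
    have hau := sum_abs_le_sqrt_mul_norm u hS
    have hl4 : l1 u ^ 2 ≤ 16 * (k * ‖u‖ ^ 2) := by
      have h7 : l1 u ≤ 4 * (Real.sqrt k * ‖u‖) := by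
        rw [hl1]
        have : b ≤ 3 * a := hcone
        linarith
      calc l1 u ^ 2 ≤ (4 * (Real.sqrt k * ‖u‖)) ^ 2 := by
            apply pow_le_pow_left₀ (by rw [hl1]; positivity) h7
        _ = _ := by rw [mul_pow, mul_pow, Real.sq_sqrt (by positivity)]; ring
    -- On the cone `l1 u ^ 2 ≤ 16 * k * ‖u‖ ^ 2`, so the tolerance `γ / (64 * (k + 1))` per entry
    -- uses up at most half of the curvature.
    have hη16 : η * l1 u ^ 2 ≤ γ / 4 * ‖u‖ ^ 2 := by
      calc η * l1 u ^ 2 ≤ γ / (64 * (k + 1)) * (16 * (k * ‖u‖ ^ 2)) :=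
            mul_le_mul hη hl4 (by positivity) (by positivity)
        _ = γ / 4 * ‖u‖ ^ 2 * (k / (k + 1)) := by field_simp; ring
        _ ≤ γ / 4 * ‖u‖ ^ 2 * 1 := by
            refine mul_le_mul_of_nonneg_left ?_ (by positivity)
            rw [div_le_one (by positivity)]
            linarith
        _ = _ := mul_one _
    have hQlow : γ / 4 * ‖u‖ ^ 2 ≤ Q := by
      have := (abs_le.1 herr).1
      linarith
    have hup : Q / 2 ≤ 2 * lam * (Real.sqrt k * ‖u‖) := by
      have h8 : 2 * lam * a ≤ 2 * lam * (Real.sqrt k * ‖u‖) :=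
        mul_le_mul_of_nonneg_left hau (by positivity)
      nlinarith [mul_nonneg hlam.le hb0]
    have hfin : ‖u‖ ≤ 16 * Real.sqrt k * lam / γ := by
      rw [le_div_iff₀ hγ]
      by_cases hu0 : ‖u‖ = 0
      · rw [hu0, zero_mul]; positivity
      · have hup0 : 0 < ‖u‖ := lt_of_le_of_ne (norm_nonneg _) (Ne.symm hu0)
        have : ‖u‖ * (‖u‖ * γ) ≤ ‖u‖ * (16 * Real.sqrt k * lam) := by nlinarith
        exact le_of_mul_le_mul_left this hup0
    have : 0 ≤ 12 * k * τ := by positivity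
    linarith

theorem fderiv_apply_eq_sum_gradient (f : Param p → ℝ) (v u : Param p) :
    fderiv ℝ f v u = ∑ j, gradient f v j * u j := by
  rw [← inner_gradient_left, PiLp.inner_apply]
  simp [mul_comm]

/-- Two integrations along the segment from `v` to `w`, each in the form of monotonicity of a
function with nonnegative derivative. The segment stays in `V` by convexity, so curvature is needed
on `V` only. -/
theorem taylor_lower {f : Param p → ℝ} (hf : ContDiff ℝ 2 f) {V : Set (Param p)}
    (hV : Convex ℝ V) {v w : Param p} (hv : v ∈ V) (hw : w ∈ V) {q : ℝ}
    (hq : ∀ y ∈ V, q ≤ fderiv ℝ (fderiv ℝ f) y (w - v) (w - v)) :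
    fderiv ℝ f v (w - v) + q / 2 ≤ f w - f v := by
  set u := w - v with hu
  have hseg : ∀ t ∈ Set.Icc (0 : ℝ) 1, v + t • u ∈ V := fun t ht =>
    hV.add_smul_sub_mem hv hw ht
  have hline : ∀ t : ℝ, HasDerivAt (fun t : ℝ => v + t • u) u t := fun t => by
    simpa using ((hasDerivAt_id t).smul_const u).const_add v
  have hd1 : ∀ y, HasFDerivAt f (fderiv ℝ f y) y := fun y =>
    (hf.differentiable (by norm_num) y).hasFDerivAt
  have hd2 : ∀ y, HasFDerivAt (fderiv ℝ f) (fderiv ℝ (fderiv ℝ f) y) y := fun y =>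
    ((hf.fderiv_right (m := 1) (by norm_num)).differentiable (by norm_num) y).hasFDerivAt
  have hφ1 : ∀ t : ℝ, HasDerivAt (fun t : ℝ => fderiv ℝ f (v + t • u) u - q * t)
      (fderiv ℝ (fderiv ℝ f) (v + t • u) u u - q) t := fun t => by
    have h0 : HasDerivAt (fun t : ℝ => fderiv ℝ f (v + t • u))
        (fderiv ℝ (fderiv ℝ f) (v + t • u) u) t := (hd2 (v + t • u)).comp_hasDerivAt t (hline t)
    have h1 : HasDerivAt (fun t : ℝ => fderiv ℝ f (v + t • u) u)
        (fderiv ℝ (fderiv ℝ f) (v + t • u) u u) t :=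
      (ContinuousLinearMap.apply ℝ ℝ u).hasFDerivAt.comp_hasDerivAt t h0
    have h2 : HasDerivAt (fun t : ℝ => q * t) q t := by
      simpa using (hasDerivAt_id t).const_mul q
    exact h1.sub h2
  have hφ0 : ∀ t : ℝ, HasDerivAt
      (fun t : ℝ => f (v + t • u) - fderiv ℝ f v u * t - q * t ^ 2 / 2)
      (fderiv ℝ f (v + t • u) u - fderiv ℝ f v u - q * t) t := fun t => by
    have h1 : HasDerivAt (fun t : ℝ => f (v + t • u)) (fderiv ℝ f (v + t • u) u) t :=
      (hd1 (v + t • u)).comp_hasDerivAt t (hline t)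
    have h2 : HasDerivAt (fun t : ℝ => fderiv ℝ f v u * t) (fderiv ℝ f v u) t := by
      simpa using (hasDerivAt_id t).const_mul (fderiv ℝ f v u)
    have h3 : HasDerivAt (fun t : ℝ => q * t ^ 2 / 2) (q * t) t := by
      refine (((hasDerivAt_pow 2 t).const_mul q).div_const 2).congr_deriv ?_
      push_cast
      ring
    exact (h1.sub h2).sub h3
  have hmono1 : MonotoneOn (fun t : ℝ => fderiv ℝ f (v + t • u) u - q * t) (Set.Icc 0 1) := by
    refine monotoneOn_of_deriv_nonneg (convex_Icc _ _)
      (fun t _ => (hφ1 t).continuousAt.continuousWithinAt)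
      (fun t _ => (hφ1 t).differentiableAt.differentiableWithinAt) fun t ht => ?_
    rw [(hφ1 t).deriv]
    linarith [hq _ (hseg t (interior_subset ht))]
  have hmono0 : MonotoneOn (fun t : ℝ => f (v + t • u) - fderiv ℝ f v u * t - q * t ^ 2 / 2)
      (Set.Icc 0 1) := by
    refine monotoneOn_of_deriv_nonneg (convex_Icc _ _)
      (fun t _ => (hφ0 t).continuousAt.continuousWithinAt)
      (fun t _ => (hφ0 t).differentiableAt.differentiableWithinAt) fun t ht => ?_
    rw [(hφ0 t).deriv]
    have ht' := interior_subset ht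
    have := hmono1 (Set.left_mem_Icc.2 zero_le_one) ht' ht'.1
    simp only [zero_smul, add_zero, mul_zero, sub_zero] at this
    linarith
  have := hmono0 (Set.left_mem_Icc.2 zero_le_one) (Set.right_mem_Icc.2 zero_le_one) zero_le_one
  simp only [zero_smul, add_zero, mul_zero, sub_zero, one_smul, mul_one, one_pow] at this
  have hvw : v + u = w := by rw [hu]; abel
  rw [hvw] at this
  norm_num at this
  linarith

end Lasso

end DRRF

namespace DRRF

/-! ### Local losses: gradients, curvature and changing supports. -/

section LocalLoss

variable {d p : ℕ} {𝒲 : Type*} [MeasurableSpace 𝒲] {M : Problem d p 𝒲}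
  {l : Obs d 𝒲 → Param p → ℝ} {ν : Cov d → Param p} {H : Obs d 𝒲 → Matrix (Fin p) (Fin p) ℝ}
  {k : ℕ} {γ L C : ℝ}

theorem ae_obsLaw_of_forall_cube (M : Problem d p 𝒲) [IsMarkovKernel M.condLaw] (f : Cov d → ℝ)
    [IsProbabilityMeasure (covLaw f)] {P : Obs d 𝒲 → Prop} (hP : MeasurableSet {z | P z})
    (h : ∀ x ∈ cube d, ∀ᵐ q ∂M.condLaw x, P (x, q)) : ∀ᵐ z ∂M.obsLaw f, P z := by
  unfold Problem.obsLaw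
  rw [Measure.ae_compProd_iff hP]
  filter_upwards [ae_mem_cube f] with x hx using h x hx

theorem gradient_apply (f : Param p → ℝ) (v : Param p) (j : Fin p) :
    gradient f v j = fderiv ℝ f v (EuclideanSpace.single j 1) := by
  rw [fderiv_apply_eq_sum_gradient]
  simp

theorem LossOK.differentiableAt (hl : LossOK M l ν C) (z : Obs d 𝒲) (v : Param p) :
    DifferentiableAt ℝ (l z) v := (hl.smooth z).differentiable (by norm_num) v

theorem tendsto_difference_quotient {f : Param p → ℝ} {v : Param p} (hf : DifferentiableAt ℝ f v)
    (u : Param p) : Tendsto (fun m : ℕ => ((m : ℝ) + 1) * (f (v + ((m : ℝ) + 1)⁻¹ • u) - f v)) atTop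
      (nhds (fderiv ℝ f v u)) := by
  have h1 : Tendsto (fun m : ℕ => ‖((m : ℝ) + 1)‖) atTop atTop :=
    tendsto_norm_atTop_atTop.comp (tendsto_atTop_add_const_right _ _ tendsto_natCast_atTop_atTop)
  simpa using hf.hasFDerivAt.lim u h1

/-- Only the loss is assumed measurable in the observation; its derivative is a limit of difference
quotients. -/
theorem LossOK.measurable_fderiv_apply (hl : LossOK M l ν C) (v u : Param p) :
    Measurable fun z => fderiv ℝ (l z) v u := by
  refine measurable_of_tendsto_metrizable
    (f := fun (m : ℕ) z => ((m : ℝ) + 1) * (l z (v + ((m : ℝ) + 1)⁻¹ • u) - l z v))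
    (fun m => ((hl.meas _).sub (hl.meas _)).const_mul _) ?_
  rw [tendsto_pi_nhds]
  exact fun z => tendsto_difference_quotient (hl.differentiableAt z v) u

theorem LossOK.measurable_gradient (hl : LossOK M l ν C) (v : Param p) (j : Fin p) :
    Measurable fun z => gradient (l z) v j := by
  simp_rw [gradient_apply]
  exact hl.measurable_fderiv_apply v _

theorem abs_sum_mul_le_l1 {g : Fin p → ℝ} (hg : ∀ j, |g j| ≤ C) (u : Param p) :
    |∑ j, g j * u j| ≤ C * l1 u := by
  rw [l1, Finset.mul_sum]
  refine (Finset.abs_sum_le_sum_abs _ _).trans (Finset.sum_le_sum fun j _ => ?_)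
  rw [abs_mul]
  exact mul_le_mul_of_nonneg_right (hg j) (abs_nonneg _)

theorem abs_sub_le_of_gradient_bdd {f : Param p → ℝ} (hf : Differentiable ℝ f)
    {V : Set (Param p)} (hV : Convex ℝ V) (hC : ∀ v ∈ V, ∀ j, |gradient f v j| ≤ C)
    {v w : Param p} (hv : v ∈ V) (hw : w ∈ V) : |f w - f v| ≤ C * l1 (w - v) := by
  obtain ⟨y, hy, hfy⟩ := domain_mvt (fun x _ => (hf x).hasFDerivAt.hasFDerivWithinAt) hV hv hw
  rw [hfy, fderiv_apply_eq_sum_gradient]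
  exact abs_sum_mul_le_l1 (hC y (hV.segment_subset hv hw hy)) _

theorem continuous_quad (A : Matrix (Fin p) (Fin p) ℝ) : Continuous (quad A) := by
  have : quad A = fun u : Param p => ∑ a, ∑ b, u a * u b * A a b := funext (quad_eq_sum A)
  rw [this]
  fun_prop

section

variable [IsMarkovKernel M.condLaw]

theorem LossOK.integrable_gradient (hl : LossOK M l ν C) {x : Cov d} (hx : x ∈ cube d)
    {v : Param p} (hv : v ∈ M.V) (j : Fin p) :
    Integrable (fun q => gradient (l (x, q)) v j) (M.condLaw x) :=
  Integrable.of_bound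
    (((hl.measurable_gradient v j).comp measurable_prodMk_left).aestronglyMeasurable) C
    (by filter_upwards [hl.grad_bdd x hx] with q hq using hq v hv j)

/-- Minimality over a convex set makes the difference quotients of the risk in direction `v - ν x`
nonnegative. Their limit is taken under the integral, with domination by the bound on the gradients
along the segment. -/
theorem LossOK.first_order (hl : LossOK M l ν C) (hV : Convex ℝ M.V) {x : Cov d} (hx : x ∈ cube d)
    {v : Param p} (hv : v ∈ M.V) :
    0 ≤ ∑ j, M.cexp x (fun z => gradient (l z) (ν x) j) * (v - ν x) j := by
  have hν := hl.mem x hx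
  set u := v - ν x with hu
  have hmem : ∀ m : ℕ, ν x + ((m : ℝ) + 1)⁻¹ • u ∈ M.V := fun m =>
    hV.add_smul_sub_mem hν hv ⟨by positivity, inv_le_one_of_one_le₀ (by
      have : (0 : ℝ) ≤ m := by positivity
      linarith)⟩
  have hlim : Tendsto (fun m : ℕ => ∫ q,
      ((m : ℝ) + 1) * (l (x, q) (ν x + ((m : ℝ) + 1)⁻¹ • u) - l (x, q) (ν x)) ∂M.condLaw x) atTop
      (nhds (∫ q, fderiv ℝ (l (x, q)) (ν x) u ∂M.condLaw x)) := by
    refine tendsto_integral_of_dominated_convergence (fun _ => C * l1 u) (fun m => ?_)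
      (integrable_const _) (fun m => ?_) (Eventually.of_forall fun q =>
        tendsto_difference_quotient (hl.differentiableAt _ _) u)
    · exact ((((hl.meas _).sub (hl.meas _)).const_mul _).comp
        measurable_prodMk_left).aestronglyMeasurable
    · filter_upwards [hl.grad_bdd x hx] with q hq
      have h1 := abs_sub_le_of_gradient_bdd (fun v => hl.differentiableAt (x, q) v) hV hq hν
        (hmem m)
      have h2 : l1 (ν x + ((m : ℝ) + 1)⁻¹ • u - ν x) = ((m : ℝ) + 1)⁻¹ * l1 u := by
        rw [add_sub_cancel_left, l1, l1, Finset.mul_sum]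
        refine Finset.sum_congr rfl fun j _ => ?_
        rw [PiLp.smul_apply, smul_eq_mul, abs_mul, abs_of_nonneg (by positivity)]
      have hm : (0 : ℝ) < (m : ℝ) + 1 := by positivity
      rw [h2] at h1
      rw [Real.norm_eq_abs, abs_mul, abs_of_pos hm]
      calc _ ≤ ((m : ℝ) + 1) * (C * (((m : ℝ) + 1)⁻¹ * l1 u)) :=
            mul_le_mul_of_nonneg_left h1 hm.le
        _ = C * l1 u := by field_simp
  have h0 : 0 ≤ ∫ q, fderiv ℝ (l (x, q)) (ν x) u ∂M.condLaw x := by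
    refine ge_of_tendsto' hlim fun m => ?_
    rw [integral_const_mul, integral_sub (hl.integrable x hx _ (hmem m)) (hl.integrable x hx _ hν)]
    exact mul_nonneg (by positivity) (sub_nonneg.2 (hl.argmin x hx (hmem m)))
  calc 0 ≤ _ := h0
    _ = ∫ q, ∑ j, gradient (l (x, q)) (ν x) j * u j ∂M.condLaw x := by
        simp_rw [fderiv_apply_eq_sum_gradient]
    _ = _ := by
        rw [integral_finsetSum _ fun j _ => (hl.integrable_gradient hx hν j).mul_const _]
        simp_rw [integral_mul_const]
        rfl

theorem SparseRegular.abs_cexp_gradient_sub_le (hs : SparseRegular M l ν H k γ L C)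
    (hl : LossOK M l ν C) {x x' : Cov d} (hx : x ∈ cube d) (hx' : x' ∈ cube d) {v : Param p}
    (hv : v ∈ M.V) (j : Fin p) :
    |M.cexp x' (fun z => gradient (l z) v j) - M.cexp x (fun z => gradient (l z) v j)| ≤
      L * ‖x' - x‖ := by
  have hcoord : ∀ y ∈ cube d, M.cexp y (fun z => gradient (l z) v j) =
      (∫ q, gradient (l (y, q)) v ∂M.condLaw y) j := fun y hy => by
    rw [eval_integral_piLp fun j => hl.integrable_gradient hy hv j]
    rfl
  rw [hcoord x hx, hcoord x' hx', ← PiLp.sub_apply]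
  exact (PiLp.norm_apply_le _ j).trans (hs.lip_grad v hv x' hx' x hx)

/-- The exceptional null set must not depend on `v`, and passing from the conditional laws to the
joint law requires a measurable event. Both are achieved on a countable dense subset of `V`; the
inequality is closed in `v` and extends. -/
theorem ae_taylor (hs : SparseRegular M l ν H k γ L C) (hl : LossOK M l ν C) (hV : Convex ℝ M.V)
    (f : Cov d → ℝ) [IsProbabilityMeasure (covLaw f)] {v₀ : Param p} (hv₀ : v₀ ∈ M.V) :
    ∀ᵐ z ∂M.obsLaw f, ∀ v ∈ M.V,
      ∑ j, gradient (l z) v₀ j * (v - v₀) j + quad (H z) (v - v₀) / 2 ≤ l z v - l z v₀ := by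
  have : Nonempty M.V := ⟨⟨v₀, hv₀⟩⟩
  obtain ⟨e, he⟩ := TopologicalSpace.exists_dense_seq M.V
  have hquad : ∀ u, Measurable fun z => quad (H z) u := fun u => by
    simp_rw [quad_eq_sum]
    exact Finset.measurable_fun_sum _ fun a _ => Finset.measurable_fun_sum _ fun b _ =>
      (hs.meas_H a b).const_mul _
  have hgrad : ∀ u : Param p, Measurable fun z => ∑ j, gradient (l z) v₀ j * u j := fun u =>
    Finset.measurable_fun_sum _ fun j _ => (hl.measurable_gradient v₀ j).mul_const _
  have key : ∀ᵐ z ∂M.obsLaw f, ∀ m, ∑ j, gradient (l z) v₀ j * ((e m : Param p) - v₀) j +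
      quad (H z) (e m - v₀) / 2 ≤ l z (e m) - l z v₀ := by
    rw [ae_all_iff]
    intro m
    refine ae_obsLaw_of_forall_cube M f (measurableSet_le ((hgrad _).add ((hquad _).div_const _))
      ((hl.meas _).sub (hl.meas _))) fun x hx => ?_
    filter_upwards [hs.hessian x hx] with q hq
    rw [← fderiv_apply_eq_sum_gradient]
    exact taylor_lower (hl.smooth _) hV hv₀ (e m).2 fun y hy => hq.2 y hy _
  filter_upwards [key] with z hz v hv
  have hc : IsClosed {w : M.V | ∑ j, gradient (l z) v₀ j * ((w : Param p) - v₀) j +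
      quad (H z) (w - v₀) / 2 ≤ l z w - l z v₀} := by
    have hlc : Continuous (l z) := (hl.smooth z).continuous
    have hq : Continuous fun w : M.V => quad (H z) ((w : Param p) - v₀) :=
      (continuous_quad _).comp (by fun_prop)
    exact isClosed_le (by fun_prop) (by fun_prop)
  exact isClosed_property he hc hz ⟨v, hv⟩

theorem ae_quad_nonneg (hs : SparseRegular M l ν H k γ L C)
    (f : Cov d → ℝ) [IsProbabilityMeasure (covLaw f)] :
    ∀ᵐ z ∂M.obsLaw f, ∀ u, 0 ≤ quad (H z) u := by
  obtain ⟨e, he⟩ := TopologicalSpace.exists_dense_seq (Param p)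
  have hquad : ∀ u, Measurable fun z => quad (H z) u := fun u => by
    simp_rw [quad_eq_sum]
    exact Finset.measurable_fun_sum _ fun a _ => Finset.measurable_fun_sum _ fun b _ =>
      (hs.meas_H a b).const_mul _
  have key : ∀ᵐ z ∂M.obsLaw f, ∀ m, 0 ≤ quad (H z) (e m) := by
    rw [ae_all_iff]
    intro m
    refine ae_obsLaw_of_forall_cube M f (measurableSet_le measurable_const (hquad _)) fun x hx => ?_
    filter_upwards [hs.hessian x hx] with q hq
    simpa [quad] using hq.1.dotProduct_mulVec_nonneg (e m).ofLp
  filter_upwards [key] with z hz u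
  have hc : IsClosed {u | 0 ≤ quad (H z) u} := isClosed_le continuous_const (continuous_quad _)
  exact isClosed_property he hc hz u

theorem SparseRegular.quad_cexpMat_nonneg (hs : SparseRegular M l ν H k γ L C) {x : Cov d}
    (hx : x ∈ cube d) (u : Param p) : 0 ≤ quad (M.cexpMat x H) u := by
  have hi : ∀ a b, Integrable (fun q => u a * u b * H (x, q) a b) (M.condLaw x) := fun a b =>
    (Integrable.of_bound ((hs.meas_H a b).comp measurable_prodMk_left).aestronglyMeasurable C
      (by filter_upwards [hs.bdd_H x hx] with q hq using hq a b)).const_mul _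
  have : quad (M.cexpMat x H) u = ∫ q, quad (H (x, q)) u ∂M.condLaw x := by
    simp_rw [quad_eq_sum]
    rw [integral_finsetSum _ fun a _ => integrable_finsetSum _ fun b _ => hi a b]
    refine Finset.sum_congr rfl fun a _ => ?_
    rw [integral_finsetSum _ fun b _ => hi a b]
    refine Finset.sum_congr rfl fun b _ => ?_
    rw [integral_const_mul]
    rfl
  rw [this]
  refine integral_nonneg_of_ae ?_
  filter_upwards [hs.hessian x hx] with q hq
  simpa [quad] using hq.1.dotProduct_mulVec_nonneg u.ofLp

end

theorem cone_mono {S S' : Finset (Fin p)} (h : S ⊆ S') : cone S ⊆ (cone S' : Set (Param p)) := by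
  intro u hu
  have h1 : ∑ j ∈ S'ᶜ, |u j| ≤ ∑ j ∈ Sᶜ, |u j| :=
    Finset.sum_le_sum_of_subset_of_nonneg (Finset.compl_subset_compl.2 h) fun _ _ _ => abs_nonneg _
  have h2 : ∑ j ∈ S, |u j| ≤ ∑ j ∈ S', |u j| :=
    Finset.sum_le_sum_of_subset_of_nonneg h fun _ _ _ => abs_nonneg _
  have h3 : ∑ j ∈ Sᶜ, |u j| ≤ 3 * ∑ j ∈ S, |u j| := hu
  show ∑ j ∈ S'ᶜ, |u j| ≤ 3 * ∑ j ∈ S', |u j|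
  linarith

/-- The coordinates of size larger than `τ`. -/
noncomputable def largeSupp (τ : ℝ) (v : Param p) : Finset (Fin p) := {j | τ < |v j|}

/-- A coordinate larger than `τ` cannot vanish after a perturbation of norm at most `τ`. -/
theorem largeSupp_subset_supp {τ : ℝ} {v v' : Param p} (h : ‖v - v'‖ ≤ τ) :
    largeSupp τ v ⊆ supp v' := by
  intro j hj
  simp only [largeSupp, supp, Finset.mem_filter, Finset.mem_univ, true_and] at hj ⊢
  intro h0
  have := (PiLp.norm_apply_le (v - v') j).trans h
  rw [PiLp.sub_apply, h0, sub_zero, Real.norm_eq_abs] at this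
  linarith

theorem card_largeSupp_le {τ : ℝ} (hτ : 0 ≤ τ) {v : Param p} (h : (supp v).card ≤ k) :
    (largeSupp τ v).card ≤ k :=
  (Finset.card_le_card (largeSupp_subset_supp (by simpa using hτ))).trans h

theorem sum_compl_largeSupp_le {τ : ℝ} (hτ : 0 ≤ τ) {v : Param p} (h : (supp v).card ≤ k) :
    ∑ j ∈ (largeSupp τ v)ᶜ, |v j| ≤ k * τ := by
  calc ∑ j ∈ (largeSupp τ v)ᶜ, |v j| = ∑ j ∈ (largeSupp τ v)ᶜ ∩ supp v, |v j| := by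
        refine (Finset.sum_subset Finset.inter_subset_left fun j hj hj' => ?_).symm
        rw [Finset.mem_inter, not_and] at hj'
        have := hj' hj
        simp only [supp, Finset.mem_filter, Finset.mem_univ, true_and, not_not] at this
        rw [this, abs_zero]
    _ ≤ ((largeSupp τ v)ᶜ ∩ supp v).card • τ := Finset.sum_le_card_nsmul _ _ _ fun j hj => by
        simpa [largeSupp] using (Finset.mem_inter.1 hj).1
    _ ≤ k * τ := by
        rw [nsmul_eq_mul]
        refine mul_le_mul_of_nonneg_right ?_ hτ
        exact_mod_cast (Finset.card_le_card Finset.inter_subset_right).trans h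

/-- The support of `ν` may change with the covariate, and the eigenvalue condition at `x'` concerns
the support at `x'`. The large coordinates of `ν x` persist at all nearby `x'`, and cones grow with
the index set. Hence one cone, built from the large coordinates at `x`, works for all neighbours at
once. -/
theorem SparseRegular.restricted_eigenvalue_near (hs : SparseRegular M l ν H k γ L C)
    {x x' : Cov d} (hx : x ∈ cube d) (hx' : x' ∈ cube d) {τ : ℝ} (hτ : L * ‖x' - x‖ ≤ τ)
    {u : Param p} (hu : u ∈ cone (largeSupp τ (ν x))) : γ * ‖u‖ ^ 2 ≤ quad (M.cexpMat x' H) u := by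
  refine hs.restricted_eigenvalue x' hx' u (cone_mono (largeSupp_subset_supp ?_) hu)
  have := hs.lip x hx x' hx'
  rw [norm_sub_rev x x'] at this
  linarith

/-- Truncation to `[-c, c]`. -/
noncomputable def clip (c a : ℝ) : ℝ := max (-c) (min c a)

theorem abs_clip_le {c : ℝ} (hc : 0 ≤ c) (a : ℝ) : |clip c a| ≤ c := by
  rw [abs_le]
  exact ⟨le_max_left _ _, max_le (by linarith) (min_le_left _ _)⟩

/-- Concentration is proved for functions bounded everywhere, while gradients, Hessian bounds and
moments are bounded almost surely. Clipping bridges the two without changing values almost surely.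
-/
theorem clip_eq {c a : ℝ} (h : |a| ≤ c) : clip c a = a := by
  rw [abs_le] at h
  rw [clip, min_eq_right h.2, max_eq_right h.1]

theorem measurable_clip (c : ℝ) : Measurable (clip c) := by
  unfold clip
  fun_prop

end LocalLoss

end DRRF

namespace DRRF

/-! ### Tail bounds for kernel averages and for the forest lasso. -/

section LassoTail

variable {d p n s : ℕ} {𝒲 : Type*} [MeasurableSpace 𝒲]

/-- The properties of a forest used for kernel averages; `ε` bounds the expected distance between a
point and its neighbours. -/
structure ForestOK (M : Problem d p 𝒲) (f : Cov d → ℝ) (T : TreeLearner d n s 𝒲) (ρ ϖ : ℝ)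
    (r B : ℕ) (ε : ℝ) : Prop where
  meas : T.Meas
  adapted : T.Adapted
  regular : ∀ᵐ Z ∂Measure.pi (fun _ : Fin n => M.obsLaw f), T.RegularAt ρ ϖ r Z
  one_le_r : 1 ≤ r
  r_le : r ≤ s - s / 2
  one_le : 1 ≤ s
  le : s ≤ n
  trees : (n : ℝ) / s ≤ B
  pos : 0 < ε
  shrink : ∀ x ∈ cube d, ∀ S : Halves n s,
    ∫ Z, ∫ ξ, T.stat r S Z ξ x (distTo x) ∂treeLaw ∂Measure.pi (fun _ : Fin n => M.obsLaw f) ≤ ε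

variable {M : Problem d p 𝒲} {f : Cov d → ℝ} {T : TreeLearner d n s 𝒲} {ρ ϖ : ℝ} {r B : ℕ} {ε : ℝ}

theorem ForestOK.B_ne_zero (h : ForestOK M f T ρ ϖ r B ε) : B ≠ 0 := by
  have h0 : (0 : ℝ) < s := by exact_mod_cast h.one_le
  have h1 : (0 : ℝ) < n := lt_of_lt_of_le h0 (by exact_mod_cast h.le)
  have h2 : (0 : ℝ) < B := lt_of_lt_of_le (by positivity) h.trees
  rintro rfl
  simp at h2

section

variable [IsMarkovKernel M.condLaw] [IsProbabilityMeasure (covLaw f)]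

theorem ForestOK.isProbabilityMeasure (h : ForestOK M f T ρ ϖ r B ε) :
    IsProbabilityMeasure (halfLaw M f n s B) := isProbabilityMeasure_halfLaw h.le M f B

theorem ForestOK.ae_halfLaw (h : ForestOK M f T ρ ϖ r B ε) {P : (Fin n → Obs d 𝒲) → Prop}
    (hP : ∀ᵐ Z ∂Measure.pi (fun _ : Fin n => M.obsLaw f), P Z) :
    ∀ᵐ ω ∂halfLaw M f n s B, P ω.1 := by
  have := isProbabilityMeasure_forestRandLaw h.le B
  have := isProbabilityMeasure_obsLaw M f
  exact Measure.quasiMeasurePreserving_fst.ae hP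

theorem ForestOK.ae_forall (h : ForestOK M f T ρ ϖ r B ε) {P : Obs d 𝒲 → Prop}
    (hP : ∀ᵐ z ∂M.obsLaw f, P z) : ∀ᵐ ω ∂halfLaw M f n s B, ∀ i, P (ω.1 i) := by
  have := isProbabilityMeasure_obsLaw M f
  exact h.ae_halfLaw (ae_pi_of_ae hP)

theorem ForestOK.ae_sum_kernel (h : ForestOK M f T ρ ϖ r B ε) (x : Cov d) :
    ∀ᵐ ω ∂halfLaw M f n s B, ∑ i, T.kernel r ω.2 ω.1 x i = 1 := by
  filter_upwards [h.ae_halfLaw h.regular] with ω hω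
  exact sum_kernel_eq_one hω h.one_le_r h.r_le h.B_ne_zero ω.2

/-- The mean of one tree is at most `D * ε`: after exchanging data and tree randomness, honesty
replaces `F` by its conditional mean, which is at most `D` times the distance to `x`, and kernel
shrinkage bounds the expected distance. Fluctuations are those of `forest_tail`. -/
theorem ForestOK.tail (h : ForestOK M f T ρ ϖ r B ε) {x : Cov d} (hx : x ∈ cube d)
    {F : Obs d 𝒲 → ℝ} (hF : Measurable F) {c D u : ℝ} (hc : 0 < c) (hFc : ∀ z, |F z| ≤ c)
    (hD : 0 ≤ D) (hu : 0 ≤ u) (hbias : ∀ x' ∈ cube d, M.cexp x' F ≤ D * ‖x' - x‖) :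
    halfLaw M f n s B {ω | D * ε + u ≤ ∑ i, T.kernel r ω.2 ω.1 x i * F (ω.1 i)} ≤
      ENNReal.ofReal (Real.exp (-(u ^ 2 * n / (6 * c ^ 2 * s)))) := by
  have := isProbabilityMeasure_obsLaw M f
  refine forest_tail h.meas h.adapted M f r x hF hc hFc hu h.one_le h.le h.trees fun S => ?_
  have hI : ∀ {G : Obs d 𝒲 → ℝ} {c : ℝ}, Measurable G → 0 ≤ c → (∀ z, |G z| ≤ c) → Integrable
      (fun a : (Fin n → Obs d 𝒲) × TreeRand => T.stat r S a.1 a.2 x G)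
      ((Measure.pi fun _ : Fin n => M.obsLaw f).prod treeLaw) := fun hG hc hGc =>
    integrable_of_abs_le (measurable_stat h.meas r S x hG) fun a => abs_stat_le hc hGc
  have hFi := hI hF hc.le hFc
  have hdm := measurable_distTo (𝒲 := 𝒲) x
  have hdi := hI hdm (by positivity) (abs_distTo_le x)
  have hcm := measurable_cexp M hF
  have hci := hI (hcm.comp measurable_fst) hc.le fun z => abs_cexp_le M hFc z.1
  have hcube := ae_pi_of_ae (n := n) (ae_obsLaw_of_ae_covLaw M (ae_mem_cube f))
  calc ∫ Z, ∫ ξ, T.stat r S Z ξ x F ∂treeLaw ∂Measure.pi (fun _ : Fin n => M.obsLaw f)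
      = ∫ ξ, ∫ Z, T.stat r S Z ξ x F ∂Measure.pi (fun _ : Fin n => M.obsLaw f) ∂treeLaw :=
        integral_integral_swap hFi
    _ = ∫ ξ, ∫ Z, T.stat r S Z ξ x (fun z => M.cexp z.1 F)
          ∂Measure.pi (fun _ : Fin n => M.obsLaw f) ∂treeLaw := by
        simp_rw [integral_stat_eq h.meas h.adapted M f r S _ x hF hFc]
    _ = ∫ Z, ∫ ξ, T.stat r S Z ξ x (fun z => M.cexp z.1 F) ∂treeLaw
          ∂Measure.pi (fun _ : Fin n => M.obsLaw f) := (integral_integral_swap hci).symm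
    _ ≤ ∫ Z, D * ∫ ξ, T.stat r S Z ξ x (distTo x) ∂treeLaw
          ∂Measure.pi (fun _ : Fin n => M.obsLaw f) := by
        refine integral_mono_ae hci.integral_prod_left (hdi.integral_prod_left.const_mul D) ?_
        filter_upwards [hcube, hci.prod_right_ae, hdi.prod_right_ae] with Z hZ h1 h2
        rw [← integral_const_mul]
        refine integral_mono h1 (h2.const_mul D) fun ξ => ?_
        simp only [TreeLearner.stat, Finset.mul_sum]
        refine Finset.sum_le_sum fun i _ => ?_
        rw [mul_left_comm, distTo_eq hx (hZ i)]
        exact mul_le_mul_of_nonneg_left (hbias _ (hZ i)) (baseKernel_nonneg i)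
    _ = D * _ := integral_const_mul _ _
    _ ≤ D * ε := mul_le_mul_of_nonneg_left (h.shrink x hx S) hD

theorem ForestOK.abs_tail (h : ForestOK M f T ρ ϖ r B ε) {x : Cov d} (hx : x ∈ cube d)
    {F : Obs d 𝒲 → ℝ} (hF : Measurable F) {c D u : ℝ} (hc : 0 < c) (hFc : ∀ z, |F z| ≤ c)
    (hD : 0 ≤ D) (hu : 0 ≤ u) (hbias : ∀ x' ∈ cube d, |M.cexp x' F| ≤ D * ‖x' - x‖) :
    halfLaw M f n s B {ω | D * ε + u ≤ |∑ i, T.kernel r ω.2 ω.1 x i * F (ω.1 i)|} ≤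
      ENNReal.ofReal (2 * Real.exp (-(u ^ 2 * n / (6 * c ^ 2 * s)))) := by
  have h1 := h.tail hx hF hc hFc hD hu fun x' hx' => (le_abs_self _).trans (hbias x' hx')
  have h2 := h.tail hx hF.neg hc (fun z => by rw [Pi.neg_apply, abs_neg]; exact hFc z) hD hu
    fun x' hx' => by
      refine le_trans ?_ (hbias x' hx')
      have : M.cexp x' (-F) = -M.cexp x' F := integral_neg _
      rw [this]
      exact neg_le_abs _
  refine (measure_mono (fun ω hω => ?_)).trans ((measure_union_le _ _).trans (add_le_add h1 h2) |>.trans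
    (le_of_eq ?_))
  · rw [Set.mem_ofPred_eq, le_abs] at hω
    refine hω.imp id fun h' => ?_
    simpa [Finset.sum_neg_distrib] using h'
  · rw [← ENNReal.ofReal_add (by positivity) (by positivity), two_mul]

end

theorem measure_iUnion_le_ofReal {Ω ι : Type*} [MeasurableSpace Ω] [Fintype ι] {μ : Measure Ω}
    {A : ι → Set Ω} {c : ℝ} (h : ∀ i, μ (A i) ≤ ENNReal.ofReal c) :
    μ (⋃ i, A i) ≤ ENNReal.ofReal (Fintype.card ι * c) := by
  refine (measure_iUnion_fintype_le _ _).trans ((Finset.sum_le_sum fun i _ => h i).trans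
    (le_of_eq ?_))
  rw [Finset.sum_const, nsmul_eq_mul, ENNReal.ofReal_mul (by positivity), ENNReal.ofReal_natCast,
    Finset.card_univ]

variable {l : Obs d 𝒲 → Param p → ℝ} {ν : Cov d → Param p} {H : Obs d 𝒲 → Matrix (Fin p) (Fin p) ℝ}
  {k : ℕ} {γ L C : ℝ}

theorem cexp_congr_ae {x : Cov d} {F G : Obs d 𝒲 → ℝ}
    (h : ∀ᵐ q ∂M.condLaw x, F (x, q) = G (x, q)) : M.cexp x F = M.cexp x G := integral_congr_ae h

theorem cexp_sub_const [IsMarkovKernel M.condLaw] (x : Cov d) {F : Obs d 𝒲 → ℝ} (hF : Measurable F)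
    {c : ℝ} (hc : ∀ z, |F z| ≤ c) (a : ℝ) : M.cexp x (fun z => F z - a) = M.cexp x F - a := by
  unfold Problem.cexp
  have hi : Integrable (fun q => F (x, q)) (M.condLaw x) :=
    integrable_of_abs_le (hF.comp measurable_prodMk_left) fun q => hc _
  rw [integral_sub hi (integrable_const _)]
  simp

/-- The probability bound for the exceptional set of the forest lasso. -/
noncomputable def lassoFail (p n s : ℕ) (C L γ lam ε : ℝ) (k : ℕ) : ℝ :=
  p * (2 * Real.exp (-((lam / 3 - (|L| + 1) * ε) ^ 2 * n / (6 * (2 * (|C| + 1)) ^ 2 * s)))) +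
    (p * (p * (2 * Real.exp (-((γ / (64 * (k + 1))) ^ 2 * n / (6 * (2 * (|C| + 1)) ^ 2 * s))))) +
      Real.exp (-((1 / 4) ^ 2 * n / (6 * 1 ^ 2 * s))))

/-- The exceptional set is a union of three kinds of events: a gradient coordinate off its value at
`x`, a Hessian entry off its local means, and half of the kernel mass beyond distance `4 * ε`.
Outside it the deterministic lasso bound applies with the large coordinates of `ν x` as support. -/
theorem exists_lassoFail [IsMarkovKernel M.condLaw] [IsProbabilityMeasure (covLaw f)]
    (h : ForestOK M f T ρ ϖ r B ε) (hs : SparseRegular M l ν H k γ L C) (hl : LossOK M l ν C)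
    (hV : Convex ℝ M.V) (hγ : 0 < γ) {lam : ℝ} (hlam0 : 0 < lam)
    (hlam : (|L| + 1) * ε ≤ lam / 3) {x : Cov d} (hx : x ∈ cube d) :
    ∃ D : Set (HalfSample d n s B 𝒲),
      halfLaw M f n s B D ≤ ENNReal.ofReal (lassoFail p n s C L γ lam ε k) ∧
      ∀ᵐ ω ∂halfLaw M f n s B, ω ∉ D → ∀ v, IsLasso M.V ω.1 l (T.kernel r ω.2 ω.1 x) lam v →
        ‖v - ν x‖ ≤ 48 * k * (|L| + 1) * ε + 16 * Real.sqrt k * lam / γ := by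
  have hprob := isProbabilityMeasure_obsLaw M f
  set C' := |C| + 1 with hC'
  set L' := |L| + 1 with hL'
  have hC'0 : 0 < C' := by positivity
  have hL'0 : 0 < L' := by positivity
  have hCC : C ≤ C' := by linarith [le_abs_self C]
  have hLL : L ≤ L' := by linarith [le_abs_self L]
  have hε := h.pos
  have hν := hl.mem x hx
  -- gradients
  set gr : Fin p → Obs d 𝒲 → ℝ := fun j z => clip C' (gradient (l z) (ν x) j) with hgr
  have hgrm : ∀ j, Measurable (gr j) := fun j =>
    (measurable_clip C').comp (hl.measurable_gradient _ j)
  have hgrc : ∀ j z, |gr j z| ≤ C' := fun j z => abs_clip_le hC'0.le _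
  have hgr_cexp : ∀ j, ∀ y ∈ cube d, M.cexp y (gr j) = M.cexp y fun z => gradient (l z) (ν x) j :=
    fun j y hy => cexp_congr_ae (by
      filter_upwards [hl.grad_bdd y hy] with q hq using clip_eq ((hq _ hν j).trans hCC))
  set G : Fin p → ℝ := fun j => M.cexp x fun z => gradient (l z) (ν x) j with hG
  have hGc : ∀ j, |G j| ≤ C' := fun j => by
    rw [hG]
    simp only
    rw [← hgr_cexp j x hx]
    exact abs_cexp_le M (hgrc j) x
  have hgrad_ae : ∀ᵐ z ∂M.obsLaw f, ∀ j, gr j z = gradient (l z) (ν x) j := by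
    rw [ae_all_iff]
    intro j
    refine ae_obsLaw_of_forall_cube M f
      (measurableSet_eq_fun (hgrm j) (hl.measurable_gradient _ j)) fun y hy => ?_
    filter_upwards [hl.grad_bdd y hy] with q hq using clip_eq ((hq _ hν j).trans hCC)
  -- Hessians
  set hh : Fin p → Fin p → Obs d 𝒲 → ℝ := fun a b z => clip C' (H z a b) with hhh
  have hhm : ∀ a b, Measurable (hh a b) := fun a b => (measurable_clip C').comp (hs.meas_H a b)
  have hhc : ∀ a b z, |hh a b z| ≤ C' := fun a b z => abs_clip_le hC'0.le _
  have hh_cexp : ∀ a b, ∀ y ∈ cube d, M.cexp y (hh a b) = M.cexpMat y H a b :=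
    fun a b y hy => cexp_congr_ae (G := fun z => H z a b) (by
      filter_upwards [hs.bdd_H y hy] with q hq using clip_eq ((hq a b).trans hCC))
  have hh_ae : ∀ᵐ z ∂M.obsLaw f, ∀ a b, hh a b z = H z a b := by
    rw [ae_all_iff]
    intro a
    rw [ae_all_iff]
    intro b
    refine ae_obsLaw_of_forall_cube M f
      (measurableSet_eq_fun (hhm a b) (hs.meas_H a b)) fun y hy => ?_
    filter_upwards [hs.bdd_H y hy] with q hq using clip_eq ((hq a b).trans hCC)
  -- far points
  set far : Obs d 𝒲 → ℝ := fun z => if 4 * ε < ‖z.1 - x‖ then 1 else 0 with hfar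
  have hfarm : Measurable far := Measurable.ite
    (measurableSet_lt measurable_const (by fun_prop)) measurable_const measurable_const
  have hfarc : ∀ z, |far z| ≤ 1 := fun z => by
    simp only [hfar]
    split_ifs <;> simp
  -- exceptional events
  have hA := fun j => h.abs_tail hx (F := fun z => gr j z - G j) ((hgrm j).sub_const _)
    (c := 2 * C') (D := L') (u := lam / 3 - L' * ε) (by positivity)
    (fun z => (abs_sub _ _).trans (by linarith [hgrc j z, hGc j])) hL'0.le (by linarith)
    (fun x' hx' => by
      rw [cexp_sub_const x' (hgrm j) (hgrc j), hgr_cexp j x' hx']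
      exact (hs.abs_cexp_gradient_sub_le hl hx hx' hν j).trans
        (mul_le_mul_of_nonneg_right hLL (norm_nonneg _)))
  -- Entries are centred at the conditional mean at their own covariate, hence `D = 0`. No
  -- smoothness of the Hessian in the covariate is needed.
  have hE := fun a b => h.abs_tail hx (F := fun z => hh a b z - M.cexp z.1 (hh a b))
    ((hhm a b).sub ((measurable_cexp M (hhm a b)).comp measurable_fst))
    (c := 2 * C') (D := 0) (u := γ / (64 * (k + 1))) (by positivity)
    (fun z => (abs_sub _ _).trans (by linarith [hhc a b z, abs_cexp_le M (hhc a b) z.1])) le_rfl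
    (by positivity)
    (fun x' hx' => by
      have : M.cexp x' (fun z => hh a b z - M.cexp z.1 (hh a b)) =
          M.cexp x' (fun z => hh a b z - M.cexp x' (hh a b)) := rfl
      rw [this, cexp_sub_const x' (hhm a b) (hhc a b)]
      simp)
  -- Markov's inequality in disguise: the indicator of distance above `4 * ε` is at most distance
  -- over `4 * ε`. The far mass has mean at most `1 / 4`, and a deviation of `1 / 4` still leaves
  -- half of the mass near.
  have hF := h.tail hx hfarm (c := 1) (D := 1 / (4 * ε)) (u := 1 / 4) one_pos hfarc (by positivity)
    (by norm_num) (fun x' hx' => by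
      by_cases h2 : 4 * ε < ‖x' - x‖
      · have h1 : M.cexp x' far = 1 := by simp [Problem.cexp, hfar, h2]
        rw [h1, one_div, inv_mul_eq_div, one_le_div (by positivity)]
        exact h2.le
      · have h1 : M.cexp x' far = 0 := by simp [Problem.cexp, hfar, h2]
        rw [h1]
        positivity)
  refine ⟨_, (measure_union_le _ _).trans ((add_le_add (measure_iUnion_le_ofReal hA)
    ((measure_union_le _ _).trans (add_le_add (measure_iUnion_le_ofReal
      fun a => measure_iUnion_le_ofReal (hE a)) hF))).trans (le_of_eq ?_)), ?_⟩
  · rw [← ENNReal.ofReal_add (by positivity) (by positivity),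
      ← ENNReal.ofReal_add (by positivity) (by positivity), Fintype.card_fin]
    rfl
  filter_upwards [h.ae_sum_kernel x, h.ae_forall hgrad_ae, h.ae_forall hh_ae,
    h.ae_forall (ae_taylor hs hl hV f hν), h.ae_forall (ae_quad_nonneg hs f),
    h.ae_forall (ae_obsLaw_of_ae_covLaw M (ae_mem_cube f))] with ω hK hgω hhω htω hqω hcω
  intro hωD v hv
  simp only [Set.mem_union, Set.mem_iUnion, Set.mem_ofPred_eq, not_or, not_exists, not_le] at hωD
  obtain ⟨hD1, hD2, hD3⟩ := hωD
  -- This `τ` bounds the movement of `ν` within distance `4 * ε` of `x`, and `12 * k * τ` becomes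
  -- the term with `48`.
  have hτ : (0 : ℝ) ≤ 4 * L' * ε := by positivity
  have hmain := lasso_error_le (K := T.kernel r ω.2 ω.1 x) (fun i => kernel_nonneg ω.2 i)
    hν (lo := fun i => l (ω.1 i)) (g := fun i j => gradient (l (ω.1 i)) (ν x) j)
    (H := fun i => H (ω.1 i)) (Hbar := fun i => M.cexpMat (ω.1 i).1 H) (G := G) (τ := 4 * L' * ε)
    (η := γ / (64 * (k + 1))) (γ := γ) (k := k) hlam0 hτ hγ hv.2 (fun i => htω i v hv.1)
    (fun i => hqω i _) (hl.first_order hV hx hv.1) (fun j => ?_) (fun a b => ?_) le_rfl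
    (fun i => hs.quad_cexpMat_nonneg (hcω i) _)
    (N := {i | ‖(ω.1 i).1 - x‖ ≤ 4 * ε}) ?_ (S := largeSupp (4 * L' * ε) (ν x))
    (card_largeSupp_le hτ (hs.sparse x hx)) (sum_compl_largeSupp_le hτ (hs.sparse x hx))
    (fun i hi u hu => ?_)
  · convert hmain using 2
    ring
  · have h1 := hD1 j
    have h2 : ∑ i, T.kernel r ω.2 ω.1 x i * (gr j (ω.1 i) - G j) =
        ∑ i, T.kernel r ω.2 ω.1 x i * gradient (l (ω.1 i)) (ν x) j - G j := by
      simp_rw [mul_sub, Finset.sum_sub_distrib, ← Finset.sum_mul, hK, one_mul, hgω _ j]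
    rw [h2] at h1
    linarith
  · have h1 := hD2 a b
    have h2 : ∑ i, T.kernel r ω.2 ω.1 x i * (hh a b (ω.1 i) - M.cexp (ω.1 i).1 (hh a b)) =
        ∑ i, T.kernel r ω.2 ω.1 x i * (H (ω.1 i) a b - M.cexpMat (ω.1 i).1 H a b) :=
      Finset.sum_congr rfl fun i _ => by rw [hhω i a b, hh_cexp a b _ (hcω i)]
    rw [h2] at h1
    linarith
  · have h1 : 1 / (4 * ε) * ε + 1 / 4 = 1 / 2 := by
      field_simp
      norm_num
    rw [h1] at hD3
    have h2 : ∑ i, T.kernel r ω.2 ω.1 x i * far (ω.1 i) +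
        ∑ i ∈ ({i | ‖(ω.1 i).1 - x‖ ≤ 4 * ε} : Finset (Fin n)), T.kernel r ω.2 ω.1 x i = 1 := by
      rw [← hK, Finset.sum_filter, ← Finset.sum_add_distrib]
      refine Finset.sum_congr rfl fun i _ => ?_
      by_cases h3 : ‖(ω.1 i).1 - x‖ ≤ 4 * ε
      · simp [hfar, h3, not_lt.2 h3]
      · simp [hfar, h3, not_le.1 h3]
    linarith
  · simp only [Finset.mem_filter, Finset.mem_univ, true_and] at hi
    refine hs.restricted_eigenvalue_near hx (hcω i) ?_ hu
    calc L * ‖(ω.1 i).1 - x‖ ≤ L' * (4 * ε) :=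
          mul_le_mul hLL hi (norm_nonneg _) hL'0.le
      _ = _ := by ring

end LassoTail

end DRRF

namespace DRRF

/-! ### Orthogonality of the debiased moment. -/

section Moment

variable {d p : ℕ} {𝒲 : Type*} [MeasurableSpace 𝒲] {M : Problem d p 𝒲} {C ψmax L γ : ℝ} {k : ℕ}

theorem Setting.measurable_h_uncurry (hset : Setting M C) (hnui : NuisanceRegularity M k γ L C) :
    Measurable fun a : 𝒲 × Param p => M.h a.1 a.2 := by
  have hc : ∀ w, Continuous fun v => M.h w v := fun w => by
    have hL : LipschitzWith (Real.toNNReal L) fun v => M.h w v :=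
      LipschitzWith.of_dist_le' fun v v' => by
        rw [Real.dist_eq, dist_eq_norm]
        exact hnui.lip_h w v v'
    exact hL.continuous
  have h1 : Measurable (Function.uncurry fun (v : Param p) (w : 𝒲) => M.h w v) :=
    measurable_uncurry_of_continuous_of_measurable hc hset.meas_h
  exact h1.comp measurable_swap

theorem Setting.measurable_ψ {Ω : Type*} [MeasurableSpace Ω] (hset : Setting M C)
    (hnui : NuisanceRegularity M k γ L C) {z : Ω → Obs d 𝒲} (hz : Measurable z)
    {a b : Ω → Param p} (ha : Measurable a) (hb : Measurable b) :
    Measurable fun ω => M.ψ (z ω) (fun w => M.h w (a ω)) (fun w => M.h w (b ω)) := by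
  unfold Problem.ψ
  have hh := hset.measurable_h_uncurry hnui
  have hw : Measurable fun ω => (z ω).2.2 := hz.snd.snd
  have h1 : Measurable fun ω => M.m (z ω) fun w => M.h w (b ω) :=
    Measurable.comp (g := fun q : Obs d 𝒲 × Param p => M.m q.1 fun w => M.h w q.2)
      (f := fun ω => (z ω, b ω)) hset.meas_m (hz.prodMk hb)
  have h2 : Measurable fun ω => M.h (z ω).2.2 (a ω) :=
    Measurable.comp (g := fun q : 𝒲 × Param p => M.h q.1 q.2)
      (f := fun ω => ((z ω).2.2, a ω)) hh (hw.prodMk ha)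
  have h3 : Measurable fun ω => M.h (z ω).2.2 (b ω) :=
    Measurable.comp (g := fun q : 𝒲 × Param p => M.h q.1 q.2)
      (f := fun ω => ((z ω).2.2, b ω)) hh (hw.prodMk hb)
  exact h1.add (h2.mul (hz.snd.fst.sub h3))

/-- The debiased moment is insensitive to first order errors of the nuisance parameters. -/
theorem cexp_ψ_sub_θ0 (hset : Setting M C) (hmom : MomentRegularity M ψmax L)
    (hnui : NuisanceRegularity M k γ L C) {x : Cov d} (hx : x ∈ cube d) {a b : Param p}
    (ha : a ∈ M.V) (hb : b ∈ M.V) :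
    M.cexp x (fun z => M.ψ z (fun w => M.h w a) (fun w => M.h w b)) - M.θ0 x =
      -∫ q : ℝ × 𝒲, (M.h q.2 a - M.h q.2 (M.να x)) * (M.h q.2 b - M.h q.2 (M.νg x))
        ∂M.condLaw x := by
  have := hset.markov
  set μ := M.condLaw x with hμ
  have hνg := hset.loss_g.mem x hx
  have hνα := hset.loss_α.mem x hx
  have hmul : ∀ v ∈ M.V, ∀ v' ∈ M.V, Integrable (fun q : ℝ × 𝒲 => M.h q.2 v * M.h q.2 v') μ :=
    fun v hv v' hv' => (hset.memG x hx v hv).integrable_mul (hset.memG x hx v' hv')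
  obtain ⟨hmb, hRb⟩ := hset.riesz x hx b (hset.memG x hx b hb)
  obtain ⟨hmg, hRg⟩ := hset.riesz x hx (M.νg x) (hset.memG x hx _ hνg)
  have hψm : Measurable fun q : ℝ × 𝒲 => M.ψ (x, q) (fun w => M.h w a) (fun w => M.h w b) :=
    hset.measurable_ψ hnui measurable_prodMk_left measurable_const measurable_const
  have hψi : Integrable (fun q : ℝ × 𝒲 => M.ψ (x, q) (fun w => M.h w a) (fun w => M.h w b)) μ :=
    Integrable.of_bound hψm.aestronglyMeasurable ψmax
      (by filter_upwards [hmom.bdd x hx] with q hq using hq a ha b hb)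
  -- Square integrability of `Y` is not assumed; integrability of this product follows by solving
  -- the definition of the bounded `ψ` for it.
  have hY : Integrable (fun q : ℝ × 𝒲 => M.h q.2 a * q.1) μ := by
    refine ((hψi.sub hmb).add (hmul a ha b hb)).congr (Eventually.of_forall fun q => ?_)
    simp only [Pi.add_apply, Pi.sub_apply, Problem.ψ]
    ring
  obtain ⟨hYi, hYc⟩ := hset.regression x hx
  have hle : MeasurableSpace.comap (Prod.snd : ℝ × 𝒲 → 𝒲) inferInstance ≤
      (inferInstance : MeasurableSpace (ℝ × 𝒲)) := measurable_snd.comap_le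
  -- Pulling the `W`-measurable factor out of the conditional expectation replaces `Y` by the
  -- regression function. With the Riesz identity at `b` and at `νg x`, everything becomes second
  -- moments of `h`.
  have hYeq : ∫ q : ℝ × 𝒲, M.h q.2 a * q.1 ∂μ = ∫ q : ℝ × 𝒲, M.h q.2 a * M.h q.2 (M.νg x) ∂μ := by
    have hsm : StronglyMeasurable[MeasurableSpace.comap (Prod.snd : ℝ × 𝒲 → 𝒲) inferInstance]
        fun q : ℝ × 𝒲 => M.h q.2 a :=
      ((hset.meas_h a).comp (comap_measurable _)).stronglyMeasurable
    have h1 := condExp_mul_of_stronglyMeasurable_left (μ := μ)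
      (f := fun q : ℝ × 𝒲 => M.h q.2 a) (g := fun q : ℝ × 𝒲 => q.1) hsm hY hYi
    rw [← integral_condExp hle]
    refine integral_congr_ae ?_
    filter_upwards [h1, hYc] with q h1 h2
    rw [show (fun q : ℝ × 𝒲 => M.h q.2 a * q.1) =
      (fun q : ℝ × 𝒲 => M.h q.2 a) * fun q : ℝ × 𝒲 => q.1 from rfl, h1, Pi.mul_apply, h2]
    rfl
  have hψ : M.cexp x (fun z => M.ψ z (fun w => M.h w a) (fun w => M.h w b)) =
      ∫ q : ℝ × 𝒲, M.h q.2 b * M.h q.2 (M.να x) ∂μ + (∫ q : ℝ × 𝒲, M.h q.2 a * q.1 ∂μ -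
        ∫ q : ℝ × 𝒲, M.h q.2 a * M.h q.2 b ∂μ) := by
    have h2 : ∫ q : ℝ × 𝒲, M.m (x, q) (fun w => M.h w b) ∂μ =
        ∫ q : ℝ × 𝒲, M.h q.2 b * M.h q.2 (M.να x) ∂μ := hRb
    have hsub : Integrable (fun q : ℝ × 𝒲 => M.h q.2 a * q.1 - M.h q.2 a * M.h q.2 b) μ :=
      hY.sub (hmul a ha b hb)
    rw [← h2, ← integral_sub hY (hmul a ha b hb), ← integral_add hmb hsub]
    refine integral_congr_ae (Eventually.of_forall fun q => ?_)
    simp only [Problem.ψ]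
    ring
  have hθ : M.θ0 x = ∫ q : ℝ × 𝒲, M.h q.2 (M.νg x) * M.h q.2 (M.να x) ∂μ := hRg
  rw [hψ, hθ, hYeq]
  have e1 := hmul b hb _ hνα
  have e2 := hmul a ha _ hνg
  have e3 := hmul a ha b hb
  have e4 := hmul _ hνg _ hνα
  have e : ∫ q : ℝ × 𝒲, (M.h q.2 a - M.h q.2 (M.να x)) * (M.h q.2 b - M.h q.2 (M.νg x)) ∂μ =
      ∫ q : ℝ × 𝒲, (((M.h q.2 a * M.h q.2 b - M.h q.2 a * M.h q.2 (M.νg x)) -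
        M.h q.2 b * M.h q.2 (M.να x)) + M.h q.2 (M.νg x) * M.h q.2 (M.να x)) ∂μ :=
    integral_congr_ae (Eventually.of_forall fun q => by ring)
  have e5 : Integrable (fun q : ℝ × 𝒲 => M.h q.2 a * M.h q.2 b - M.h q.2 a * M.h q.2 (M.νg x)) μ :=
    e3.sub e2
  have e6 : Integrable (fun q : ℝ × 𝒲 => M.h q.2 a * M.h q.2 b - M.h q.2 a * M.h q.2 (M.νg x) -
    M.h q.2 b * M.h q.2 (M.να x)) μ := e5.sub e1
  rw [e, integral_add e6 e4, integral_sub e5 e1, integral_sub e3 e2]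
  ring

theorem abs_cexp_ψ_sub_θ0_le (hset : Setting M C) (hmom : MomentRegularity M ψmax L)
    (hnui : NuisanceRegularity M k γ L C) {x : Cov d} (hx : x ∈ cube d) {a b : Param p}
    (ha : a ∈ M.V) (hb : b ∈ M.V) :
    |M.cexp x (fun z => M.ψ z (fun w => M.h w a) (fun w => M.h w b)) - M.θ0 x| ≤
      L ^ 2 * (‖a - M.να x‖ * ‖b - M.νg x‖) := by
  have := hset.markov
  rw [cexp_ψ_sub_θ0 hset hmom hnui hx ha hb, abs_neg]
  have := norm_integral_le_of_norm_le_const (μ := M.condLaw x) (f := fun q : ℝ × 𝒲 =>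
    (M.h q.2 a - M.h q.2 (M.να x)) * (M.h q.2 b - M.h q.2 (M.νg x)))
    (C := L ^ 2 * (‖a - M.να x‖ * ‖b - M.νg x‖)) (Eventually.of_forall fun q => by
      have h1 := hnui.lip_h q.2 a (M.να x)
      have h2 := hnui.lip_h q.2 b (M.νg x)
      rw [Real.norm_eq_abs, abs_mul]
      calc _ ≤ (L * ‖a - M.να x‖) * (L * ‖b - M.νg x‖) :=
            mul_le_mul h1 h2 (abs_nonneg _) ((abs_nonneg _).trans h1)
        _ = _ := by ring)
  simpa using this

theorem norm_sub_le_of_mem_cube {x y : Cov d} (hx : x ∈ cube d) (hy : y ∈ cube d) :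
    ‖y - x‖ ≤ d := by
  have h := distTo_eq (𝒲 := Unit) hx (z := (y, (0, ()))) hy
  rw [← h]
  exact min_le_right _ _

/-- Lipschitz continuity is assumed for moments at fixed nuisances. Freeze them at their values at
`x`: the moment equals `θ0 x` at `x`, moves at Lipschitz rate, and at `x'` differs from `θ0 x'` by a
product of two nuisance drifts, which is quadratic in the distance. -/
theorem abs_θ0_sub_le (hset : Setting M C) (hmom : MomentRegularity M ψmax L)
    (hnui : NuisanceRegularity M k γ L C) {x x' : Cov d} (hx : x ∈ cube d) (hx' : x' ∈ cube d) :
    |M.θ0 x' - M.θ0 x| ≤ (|L| + L ^ 4 * d) * ‖x' - x‖ := by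
  have ha := hset.loss_α.mem x hx
  have hb := hset.loss_g.mem x hx
  have h0 := cexp_ψ_sub_θ0 hset hmom hnui hx ha hb
  simp only [sub_self, mul_zero, integral_zero, neg_zero] at h0
  have h1 := abs_cexp_ψ_sub_θ0_le hset hmom hnui hx' ha hb
  have h2 := hmom.smooth _ ha _ hb x' hx' x hx
  have h3 := hnui.α.lip x hx x' hx'
  have h4 := hnui.g.lip x hx x' hx'
  rw [norm_sub_rev x x'] at h3 h4
  have h5 : L ^ 2 * (‖M.να x - M.να x'‖ * ‖M.νg x - M.νg x'‖) ≤ L ^ 4 * d * ‖x' - x‖ := by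
    calc _ ≤ L ^ 2 * ((L * ‖x' - x‖) * (L * ‖x' - x‖)) := by
          refine mul_le_mul_of_nonneg_left ?_ (by positivity)
          exact mul_le_mul h3 h4 (norm_nonneg _) ((norm_nonneg _).trans h3)
      _ = L ^ 4 * ‖x' - x‖ * ‖x' - x‖ := by ring
      _ ≤ L ^ 4 * ‖x' - x‖ * d :=
          mul_le_mul_of_nonneg_left (norm_sub_le_of_mem_cube hx hx') (by positivity)
      _ = _ := by ring
  have h6 : L * ‖x' - x‖ ≤ |L| * ‖x' - x‖ :=
    mul_le_mul_of_nonneg_right (le_abs_self L) (norm_nonneg _)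
  rw [sub_eq_zero] at h0
  rw [h0] at h2
  set A := M.cexp x' (fun z => M.ψ z (fun w => M.h w (M.να x)) (fun w => M.h w (M.νg x)))
  have h7 : |M.θ0 x' - M.θ0 x| ≤ |A - M.θ0 x'| + |A - M.θ0 x| := by
    rw [abs_sub_comm A (M.θ0 x')]
    exact abs_sub_le _ _ _
  linarith

end Moment

/-! ### Mean squared error of the forest lasso at a point. -/

section SquaredError

variable {d p n s : ℕ} {𝒲 : Type*} [MeasurableSpace 𝒲] {M : Problem d p 𝒲} {f : Cov d → ℝ}
  {T : TreeLearner d n s 𝒲} {ρ ϖ : ℝ} {r B : ℕ} {ε : ℝ}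
  {l : Obs d 𝒲 → Param p → ℝ} {ν : Cov d → Param p} {H : Obs d 𝒲 → Matrix (Fin p) (Fin p) ℝ}
  {k : ℕ} {γ L C : ℝ}

/-- Bound for the mean squared error of the forest lasso. -/
noncomputable def lassoRisk (p n s : ℕ) (C L γ lam ε : ℝ) (k : ℕ) : ℝ :=
  (48 * k * (|L| + 1) * ε + 16 * Real.sqrt k * lam / γ) ^ 2 +
    (2 * C) ^ 2 * lassoFail p n s C L γ lam ε k

theorem lassoFail_nonneg (p n s : ℕ) (C L γ lam ε : ℝ) (k : ℕ) :
    0 ≤ lassoFail p n s C L γ lam ε k := by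
  unfold lassoFail
  positivity

/-- A bound in expectation, unlike one in probability, can be averaged over covariates. On the
exceptional set the error is at most the diameter `2 * C` allowed by the bounded parameter set. -/
theorem lintegral_sq_error_le [IsMarkovKernel M.condLaw] [IsProbabilityMeasure (covLaw f)]
    (h : ForestOK M f T ρ ϖ r B ε) (hs : SparseRegular M l ν H k γ L C) (hl : LossOK M l ν C)
    (hV : Convex ℝ M.V) (hVC : ∀ v ∈ M.V, ‖v‖ ≤ C) (hγ : 0 < γ) {lam : ℝ} (hlam0 : 0 < lam)
    (hlam : (|L| + 1) * ε ≤ lam / 3) {est : HalfSample d n s B 𝒲 → Cov d → Param p}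
    (hest : IsForestLasso M f r B T l lam est) {x : Cov d} (hx : x ∈ cube d) :
    ∫⁻ ω, ENNReal.ofReal (‖est ω x - ν x‖ ^ 2) ∂halfLaw M f n s B ≤
      ENNReal.ofReal (lassoRisk p n s C L γ lam ε k) := by
  have := h.isProbabilityMeasure
  obtain ⟨D, hD, hbd⟩ := exists_lassoFail h hs hl hV hγ hlam0 hlam hx
  set R := 48 * k * (|L| + 1) * ε + 16 * Real.sqrt k * lam / γ with hR
  have hε := h.pos
  have hR0 : 0 ≤ R := by positivity
  set D' := toMeasurable (halfLaw M f n s B) D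
  have hD' : MeasurableSet D' := measurableSet_toMeasurable _ _
  calc ∫⁻ ω, ENNReal.ofReal (‖est ω x - ν x‖ ^ 2) ∂halfLaw M f n s B
      ≤ ∫⁻ ω, (ENNReal.ofReal (R ^ 2) +
          D'.indicator (fun _ => ENNReal.ofReal ((2 * C) ^ 2)) ω) ∂halfLaw M f n s B := by
        refine lintegral_mono_ae ?_
        filter_upwards [hbd, hest.lasso] with ω h1 h2
        by_cases hω : ω ∈ D'
        · rw [Set.indicator_of_mem hω]
          refine le_add_of_le_right (ENNReal.ofReal_le_ofReal ?_)
          refine pow_le_pow_left₀ (norm_nonneg _) ?_ 2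
          refine (norm_sub_le _ _).trans ?_
          linarith [hVC _ (h2 x hx).1, hVC _ (hl.mem x hx)]
        · refine le_add_of_le_left (ENNReal.ofReal_le_ofReal ?_)
          exact pow_le_pow_left₀ (norm_nonneg _)
            (h1 (fun h' => hω (subset_toMeasurable _ _ h')) _ (h2 x hx)) 2
    _ = ENNReal.ofReal (R ^ 2) + ENNReal.ofReal ((2 * C) ^ 2) * halfLaw M f n s B D := by
        rw [lintegral_add_left measurable_const, lintegral_indicator_const hD',
          measure_toMeasurable]
        simp
    _ ≤ ENNReal.ofReal (R ^ 2) +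
          ENNReal.ofReal ((2 * C) ^ 2) * ENNReal.ofReal (lassoFail p n s C L γ lam ε k) := by
        gcongr
    _ = _ := by
        rw [← ENNReal.ofReal_mul (by positivity), ← ENNReal.ofReal_add (by positivity)
          (mul_nonneg (by positivity) (lassoFail_nonneg ..))]
        rfl

end SquaredError

end DRRF

namespace DRRF

/-! ### Tail bound for the debiased estimator. -/

section Debiased

variable {d p n s : ℕ} {𝒲 : Type*} [MeasurableSpace 𝒲] {M : Problem d p 𝒲} {f : Cov d → ℝ}
  {T : TreeLearner d n s 𝒲} {ρ ϖ : ℝ} {r B : ℕ} {ε : ℝ} {k : ℕ} {γ L C ψmax : ℝ}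

/-- A Lipschitz constant of the target. -/
noncomputable def targetLip (d : ℕ) (L : ℝ) : ℝ := |L| + L ^ 4 * d

theorem targetLip_nonneg (d : ℕ) (L : ℝ) : 0 ≤ targetLip d L := by
  unfold targetLip
  positivity

theorem exists_measurable_eqOn_cube {ν : Cov d → Param p} (h : ∀ x ∈ cube d, ∀ x' ∈ cube d,
    ‖ν x - ν x'‖ ≤ L * ‖x - x'‖) : ∃ ν' : Cov d → Param p, Measurable ν' ∧
      ∀ x ∈ cube d, ν' x = ν x := by
  classical
  have hc : ContinuousOn ν (cube d) := by
    have hL : LipschitzOnWith (Real.toNNReal L) ν (cube d) :=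
      LipschitzOnWith.of_dist_le' fun x hx y hy => by
        rw [dist_eq_norm, dist_eq_norm]
        exact h x hx y hy
    exact hL.continuousOn
  exact ⟨(cube d).piecewise ν 0, hc.measurable_piecewise continuousOn_const measurableSet_cube,
    fun x hx => Set.piecewise_eq_of_mem _ _ _ hx⟩

variable [IsProbabilityMeasure (covLaw f)]

/-- With frozen nuisances the error splits into centred noise, the average of the product bias `e`,
and the Lipschitz constant of the target times the average distance. The first and third are forest
averages with exponential tails; the second is handled by Markov's inequality, its expectation being
kept for a later exchange of integrals. -/
theorem halfLaw_debiased_tail (h : ForestOK M f T ρ ϖ r B ε) (hset : Setting M C)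
    (hmom : MomentRegularity M ψmax L) (hnui : NuisanceRegularity M k γ L C)
    {a b : Cov d → Param p} (ha : Measurable a) (hb : Measurable b)
    (haV : ∀ x ∈ cube d, a x ∈ M.V) (hbV : ∀ x ∈ cube d, b x ∈ M.V) {e : Cov d → ℝ}
    (he : Measurable e)
    (heq : ∀ x ∈ cube d, e x = L ^ 2 * (‖a x - M.να x‖ ^ 2 + ‖b x - M.νg x‖ ^ 2))
    {x : Cov d} (hx : x ∈ cube d) {u v : ℝ} (hu : 0 ≤ u) (hv : 0 < v) :
    halfLaw M f n s B {ω | u + targetLip d L * (ε + u) + v <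
      |∑ i, T.kernel r ω.2 ω.1 x i * M.ψ (ω.1 i) (fun w => M.h w (a (ω.1 i).1))
        (fun w => M.h w (b (ω.1 i).1)) - M.θ0 x|} ≤
      ENNReal.ofReal (2 * Real.exp (-(u ^ 2 * n / (6 * (2 * (|ψmax| + 1)) ^ 2 * s)))) +
        (ENNReal.ofReal (Real.exp (-(u ^ 2 * n / (6 * ((d : ℝ) + 1) ^ 2 * s)))) +
          (∫⁻ ω, ∑ i, ENNReal.ofReal (T.kernel r ω.2 ω.1 x i * e (ω.1 i).1) ∂halfLaw M f n s B) /
            ENNReal.ofReal v) := by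
  have := hset.markov
  have := isProbabilityMeasure_obsLaw M f
  set c := |ψmax| + 1 with hc
  have hc0 : 0 < c := by positivity
  have hψc : ψmax ≤ c := by linarith [le_abs_self ψmax]
  set Ψ : Obs d 𝒲 → ℝ := fun z => M.ψ z (fun w => M.h w (a z.1)) (fun w => M.h w (b z.1)) with hΨ
  have hΨm : Measurable Ψ :=
    hset.measurable_ψ hnui measurable_id (ha.comp measurable_fst) (hb.comp measurable_fst)
  set F : Obs d 𝒲 → ℝ := fun z => clip c (Ψ z) with hF
  have hFm : Measurable F := (measurable_clip c).comp hΨm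
  have hFc : ∀ z, |F z| ≤ c := fun z => abs_clip_le hc0.le _
  have hFΨ : ∀ y ∈ cube d, ∀ᵐ q ∂M.condLaw y, F (y, q) = Ψ (y, q) := fun y hy => by
    filter_upwards [hmom.bdd y hy] with q hq
    exact clip_eq ((hq _ (haV y hy) _ (hbV y hy)).trans hψc)
  have hF_ae : ∀ᵐ z ∂M.obsLaw f, F z = Ψ z :=
    ae_obsLaw_of_forall_cube M f (measurableSet_eq_fun hFm hΨm) hFΨ
  have hFcexp : ∀ y ∈ cube d, |M.cexp y F - M.θ0 y| ≤ e y := fun y hy => by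
    have h1 : M.cexp y F = M.cexp y fun z =>
        M.ψ z (fun w => M.h w (a y)) (fun w => M.h w (b y)) := cexp_congr_ae (hFΨ y hy)
    rw [h1, heq y hy]
    refine (abs_cexp_ψ_sub_θ0_le hset hmom hnui hy (haV y hy) (hbV y hy)).trans
      (mul_le_mul_of_nonneg_left ?_ (sq_nonneg L))
    nlinarith [sq_nonneg (‖a y - M.να y‖ - ‖b y - M.νg y‖), sq_nonneg ‖a y - M.να y‖,
      sq_nonneg ‖b y - M.νg y‖]
  have h1 := h.abs_tail hx (F := fun z => F z - M.cexp z.1 F)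
    (hFm.sub ((measurable_cexp M hFm).comp measurable_fst)) (c := 2 * c) (D := 0) (u := u)
    (by positivity) (fun z => (abs_sub _ _).trans (by linarith [hFc z, abs_cexp_le M hFc z.1]))
    le_rfl hu (fun x' _ => by
      have : M.cexp x' (fun z => F z - M.cexp z.1 F) = M.cexp x' (fun z => F z - M.cexp x' F) := rfl
      rw [this, cexp_sub_const x' hFm hFc]
      simp)
  have h2 := h.tail hx (measurable_distTo x) (c := (d : ℝ) + 1) (D := 1) (u := u) (by positivity)
    (fun z => (abs_distTo_le x z).trans (by linarith)) zero_le_one hu (fun x' hx' => by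
      have : M.cexp x' (distTo x) = ∫ _q, ‖x' - x‖ ∂M.condLaw x' :=
        integral_congr_ae (Eventually.of_forall fun q => distTo_eq hx (z := (x', q)) hx')
      rw [this]
      simp)
  have hgm : Measurable fun ω : HalfSample d n s B 𝒲 =>
      ∑ i, ENNReal.ofReal (T.kernel r ω.2 ω.1 x i * e (ω.1 i).1) :=
    Finset.measurable_fun_sum _ fun i _ => ((measurable_kernel h.meas r x i).mul
      (he.comp ((measurable_pi_apply i).comp measurable_fst).fst)).ennreal_ofReal
  have h3 := meas_ge_le_lintegral_div (μ := halfLaw M f n s B) hgm.aemeasurable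
    (ε := ENNReal.ofReal v) (by simpa using hv) ENNReal.ofReal_ne_top
  refine le_trans (measure_mono_ae ?_) ((measure_union_le _ _).trans (add_le_add h1
    ((measure_union_le _ _).trans (add_le_add h2 h3))))
  filter_upwards [h.ae_sum_kernel x, h.ae_forall hF_ae,
    h.ae_forall (ae_obsLaw_of_ae_covLaw M (ae_mem_cube f))] with ω hK hFω hcω hω
  by_contra hnot
  change ¬ (_ ∨ _ ∨ _) at hnot
  simp only [Set.mem_ofPred_eq, not_or, not_le] at hnot
  obtain ⟨hn1, hn2, hn3⟩ := hnot
  have he0 : ∀ i, 0 ≤ e (ω.1 i).1 := fun i => (abs_nonneg _).trans (hFcexp _ (hcω i))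
  rw [← ENNReal.ofReal_sum_of_nonneg fun i _ => mul_nonneg (kernel_nonneg ω.2 i) (he0 i),
    ENNReal.ofReal_lt_ofReal_iff hv] at hn3
  change _ < |∑ i, T.kernel r ω.2 ω.1 x i * Ψ (ω.1 i) - M.θ0 x| at hω
  have hsplit : ∑ i, T.kernel r ω.2 ω.1 x i * Ψ (ω.1 i) - M.θ0 x =
      ∑ i, T.kernel r ω.2 ω.1 x i * (F (ω.1 i) - M.cexp (ω.1 i).1 F) +
        ∑ i, T.kernel r ω.2 ω.1 x i * (M.cexp (ω.1 i).1 F - M.θ0 x) := by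
    have h4 : M.θ0 x = ∑ i, T.kernel r ω.2 ω.1 x i * M.θ0 x := by
      rw [← Finset.sum_mul, hK, one_mul]
    rw [← Finset.sum_add_distrib]
    conv_lhs => rw [h4]
    rw [← Finset.sum_sub_distrib]
    exact Finset.sum_congr rfl fun i _ => by rw [hFω i]; ring
  have hsecond : |∑ i, T.kernel r ω.2 ω.1 x i * (M.cexp (ω.1 i).1 F - M.θ0 x)| ≤
      ∑ i, T.kernel r ω.2 ω.1 x i * e (ω.1 i).1 +
        targetLip d L * ∑ i, T.kernel r ω.2 ω.1 x i * distTo x (ω.1 i) := by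
    rw [Finset.mul_sum, ← Finset.sum_add_distrib]
    refine (Finset.abs_sum_le_sum_abs _ _).trans (Finset.sum_le_sum fun i _ => ?_)
    rw [abs_mul, abs_of_nonneg (kernel_nonneg ω.2 i), mul_left_comm, ← mul_add]
    refine mul_le_mul_of_nonneg_left ?_ (kernel_nonneg ω.2 i)
    rw [distTo_eq hx (hcω i)]
    exact (abs_sub_le _ (M.θ0 (ω.1 i).1) _).trans (add_le_add (hFcexp _ (hcω i))
      (abs_θ0_sub_le hset hmom hnui hx (hcω i)))
  have h5 := mul_le_mul_of_nonneg_left hn2.le (targetLip_nonneg d L)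
  rw [hsplit] at hω
  have h6 := abs_add_le (∑ i, T.kernel r ω.2 ω.1 x i * (F (ω.1 i) - M.cexp (ω.1 i).1 F))
    (∑ i, T.kernel r ω.2 ω.1 x i * (M.cexp (ω.1 i).1 F - M.θ0 x))
  linarith

/-- For fixed second half the conditional tail bound applies. Integrating over the second half, the
Markov term is exchanged by Fubini: for a fixed first half the points `X_i` are fixed, each receives
the pointwise risk, and weights summing to one reproduce that risk. -/
theorem sampleLaw_thetaHat_tail (h : ForestOK M f T ρ ϖ r B ε) (hset : Setting M C)
    (hmom : MomentRegularity M ψmax L) (hnui : NuisanceRegularity M k γ L C) (hγ : 0 < γ)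
    {lamg lamα : ℝ} (hg0 : 0 < lamg) (hα0 : 0 < lamα) (hg : (|L| + 1) * ε ≤ lamg / 3)
    (hα : (|L| + 1) * ε ≤ lamα / 3) {estg estα : HalfSample d n s B 𝒲 → Cov d → Param p}
    (hestg : IsForestLasso M f r B T M.lg lamg estg)
    (hestα : IsForestLasso M f r B T M.lα lamα estα)
    {x : Cov d} (hx : x ∈ cube d) {u v : ℝ} (hu : 0 ≤ u) (hv : 0 < v) :
    sampleLaw M f n s B {ω | u + targetLip d L * (ε + u) + v <
      |thetaHat M r T estg estα ω x - M.θ0 x|} ≤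
      ENNReal.ofReal (2 * Real.exp (-(u ^ 2 * n / (6 * (2 * (|ψmax| + 1)) ^ 2 * s))) +
        Real.exp (-(u ^ 2 * n / (6 * ((d : ℝ) + 1) ^ 2 * s))) +
        L ^ 2 * (lassoRisk p n s C L γ lamα ε k + lassoRisk p n s C L γ lamg ε k) / v) := by
  have := hset.markov
  have := isProbabilityMeasure_obsLaw M f
  have := h.isProbabilityMeasure
  obtain ⟨νg, hνgm, hνg⟩ := exists_measurable_eqOn_cube hnui.g.lip
  obtain ⟨να, hναm, hνα⟩ := exists_measurable_eqOn_cube hnui.α.lip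
  set μ := halfLaw M f n s B with hμ
  set e : HalfSample d n s B 𝒲 × Cov d → ℝ := fun a =>
    L ^ 2 * (‖estα a.1 a.2 - να a.2‖ ^ 2 + ‖estg a.1 a.2 - νg a.2‖ ^ 2) with he
  have hem : Measurable e :=
    (((hestα.meas.sub (hναm.comp measurable_snd)).norm.pow_const 2).add
      ((hestg.meas.sub (hνgm.comp measurable_snd)).norm.pow_const 2)).const_mul _
  have hX : ∀ i, Measurable fun ω : HalfSample d n s B 𝒲 => (ω.1 i).1 := fun i =>
    ((measurable_pi_apply i).comp measurable_fst).fst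
  have hsec : ∀ {E : Type _} [MeasurableSpace E] {g : HalfSample d n s B 𝒲 × Cov d → E},
      Measurable g → ∀ ω, Measurable fun y => g (ω, y) := fun hg ω => hg.comp measurable_prodMk_left
  have hjoint : ∀ i, Measurable fun ω : HalfSample d n s B 𝒲 × HalfSample d n s B 𝒲 =>
      (ω.2, (ω.1.1 i).1) := fun i => measurable_snd.prodMk ((hX i).comp measurable_fst)
  set g : HalfSample d n s B 𝒲 → HalfSample d n s B 𝒲 → ENNReal := fun ω₁ ω₂ =>
    ∑ i, ENNReal.ofReal (T.kernel r ω₁.2 ω₁.1 x i * e (ω₂, (ω₁.1 i).1)) with hgdef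
  have hgm : Measurable fun ω : HalfSample d n s B 𝒲 × HalfSample d n s B 𝒲 => g ω.1 ω.2 :=
    Finset.measurable_fun_sum _ fun i _ => (((measurable_kernel h.meas r x i).comp
      measurable_fst).mul (hem.comp (hjoint i))).ennreal_ofReal
  have hθm : Measurable fun ω : HalfSample d n s B 𝒲 × HalfSample d n s B 𝒲 =>
      thetaHat M r T estg estα ω x := by
    unfold thetaHat
    refine Finset.measurable_fun_sum _ fun i _ =>
      ((measurable_kernel h.meas r x i).comp measurable_fst).mul ?_
    exact hset.measurable_ψ hnui ((measurable_pi_apply i).comp measurable_fst.fst)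
      (hestα.meas.comp (hjoint i)) (hestg.meas.comp (hjoint i))
  have hA : MeasurableSet {ω : HalfSample d n s B 𝒲 × HalfSample d n s B 𝒲 |
      u + targetLip d L * (ε + u) + v < |thetaHat M r T estg estα ω x - M.θ0 x|} :=
    measurableSet_lt measurable_const
      (continuous_abs.measurable.comp (hθm.sub_const _))
  set p₁ := 2 * Real.exp (-(u ^ 2 * n / (6 * (2 * (|ψmax| + 1)) ^ 2 * s))) with hp₁
  set p₂ := Real.exp (-(u ^ 2 * n / (6 * ((d : ℝ) + 1) ^ 2 * s))) with hp₂
  set R := L ^ 2 * (lassoRisk p n s C L γ lamα ε k + lassoRisk p n s C L γ lamg ε k) with hR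
  have hrisk0 : ∀ lam, 0 ≤ lassoRisk p n s C L γ lam ε k := fun lam => by
    have := lassoFail_nonneg p n s C L γ lam ε k
    unfold lassoRisk
    positivity
  have hR0 : 0 ≤ R := mul_nonneg (sq_nonneg _) (add_nonneg (hrisk0 _) (hrisk0 _))
  have hsection : ∀ᵐ ω₂ ∂μ, μ ((fun ω₁ => (ω₁, ω₂)) ⁻¹' {ω | u + targetLip d L * (ε + u) + v <
      |thetaHat M r T estg estα ω x - M.θ0 x|}) ≤
      ENNReal.ofReal p₁ + (ENNReal.ofReal p₂ + (∫⁻ ω₁, g ω₁ ω₂ ∂μ) / ENNReal.ofReal v) := by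
    filter_upwards [hestg.lasso, hestα.lasso] with ω₂ hω₂g hω₂α
    exact halfLaw_debiased_tail h hset hmom hnui (hsec hestα.meas ω₂) (hsec hestg.meas ω₂)
      (fun y hy => (hω₂α y hy).1) (fun y hy => (hω₂g y hy).1) (e := fun y => e (ω₂, y))
      (hsec hem ω₂) (fun y hy => by simp only [he, hνα y hy, hνg y hy]) hx hu hv
  -- The points are independent of the nuisance estimates, so a bound at each point of the cube is
  -- enough.
  have hinner : ∀ᵐ ω₁ ∂μ, ∫⁻ ω₂, g ω₁ ω₂ ∂μ ≤ ENNReal.ofReal R := by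
    filter_upwards [h.ae_sum_kernel x,
      h.ae_forall (ae_obsLaw_of_ae_covLaw M (ae_mem_cube f))] with ω₁ hK hc
    have hone : ∀ y ∈ cube d, ∫⁻ ω₂, ENNReal.ofReal (e (ω₂, y)) ∂μ ≤ ENNReal.ofReal R := by
      intro y hy
      have e1 := lintegral_sq_error_le h hnui.α hset.loss_α hset.convex_V hset.bdd_V hγ hα0 hα hestα hy
      have e2 := lintegral_sq_error_le h hnui.g hset.loss_g hset.convex_V hset.bdd_V hγ hg0 hg hestg hy
      have m1 : Measurable fun ω : HalfSample d n s B 𝒲 =>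
          ENNReal.ofReal (‖estα ω y - M.να y‖ ^ 2) :=
        (((hestα.meas.comp measurable_prodMk_right).sub_const _).norm.pow_const 2).ennreal_ofReal
      calc ∫⁻ ω₂, ENNReal.ofReal (e (ω₂, y)) ∂μ
          = ∫⁻ ω₂, ENNReal.ofReal (L ^ 2) * (ENNReal.ofReal (‖estα ω₂ y - M.να y‖ ^ 2) +
              ENNReal.ofReal (‖estg ω₂ y - M.νg y‖ ^ 2)) ∂μ := by
            refine lintegral_congr fun ω₂ => ?_
            simp only [he, hνα y hy, hνg y hy]
            rw [ENNReal.ofReal_mul (by positivity), ENNReal.ofReal_add (by positivity)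
              (by positivity)]
        _ = ENNReal.ofReal (L ^ 2) * (∫⁻ ω₂, ENNReal.ofReal (‖estα ω₂ y - M.να y‖ ^ 2) ∂μ +
              ∫⁻ ω₂, ENNReal.ofReal (‖estg ω₂ y - M.νg y‖ ^ 2) ∂μ) := by
            rw [lintegral_const_mul' _ _ ENNReal.ofReal_ne_top, lintegral_add_left m1]
        _ ≤ ENNReal.ofReal (L ^ 2) * (ENNReal.ofReal (lassoRisk p n s C L γ lamα ε k) +
              ENNReal.ofReal (lassoRisk p n s C L γ lamg ε k)) := by gcongr
        _ = _ := by
            rw [← ENNReal.ofReal_add (hrisk0 _) (hrisk0 _), ← ENNReal.ofReal_mul (by positivity)]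
    calc ∫⁻ ω₂, g ω₁ ω₂ ∂μ
        = ∑ i, ENNReal.ofReal (T.kernel r ω₁.2 ω₁.1 x i) *
            ∫⁻ ω₂, ENNReal.ofReal (e (ω₂, (ω₁.1 i).1)) ∂μ := by
          simp only [hgdef, ENNReal.ofReal_mul (kernel_nonneg ω₁.2 _)]
          have hm : ∀ i, Measurable fun ω₂ => ENNReal.ofReal (T.kernel r ω₁.2 ω₁.1 x i) *
              ENNReal.ofReal (e (ω₂, (ω₁.1 i).1)) := fun i =>
            Measurable.const_mul (Measurable.ennreal_ofReal
              (hem.comp (measurable_prodMk_right (y := (ω₁.1 i).1)))) _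
          rw [lintegral_finsetSum _ fun i _ => hm i]
          exact Finset.sum_congr rfl fun i _ => lintegral_const_mul' _ _ ENNReal.ofReal_ne_top
      _ ≤ ∑ i, ENNReal.ofReal (T.kernel r ω₁.2 ω₁.1 x i) * ENNReal.ofReal R := by
          gcongr with i
          exact hone _ (hc i)
      _ = ENNReal.ofReal R := by
          rw [← Finset.sum_mul, ← ENNReal.ofReal_sum_of_nonneg fun i _ => kernel_nonneg ω₁.2 i, hK]
          simp
  unfold sampleLaw
  rw [Measure.prod_apply_symm hA]
  calc _ ≤ ∫⁻ ω₂, (ENNReal.ofReal p₁ + (ENNReal.ofReal p₂ +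
        (∫⁻ ω₁, g ω₁ ω₂ ∂μ) / ENNReal.ofReal v)) ∂μ := lintegral_mono_ae hsection
    _ = ENNReal.ofReal p₁ + (ENNReal.ofReal p₂ +
        (∫⁻ ω₁, ∫⁻ ω₂, g ω₁ ω₂ ∂μ ∂μ) / ENNReal.ofReal v) := by
        rw [lintegral_add_left measurable_const, lintegral_add_left measurable_const,
          lintegral_lintegral_swap hgm.aemeasurable]
        simp_rw [div_eq_mul_inv]
        rw [lintegral_mul_const' _ _ (by simpa using hv)]
        simp
    _ ≤ ENNReal.ofReal p₁ + (ENNReal.ofReal p₂ + ENNReal.ofReal R / ENNReal.ofReal v) := by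
        gcongr
        refine (lintegral_mono_ae hinner).trans (le_of_eq ?_)
        simp
    _ = _ := by
        rw [← ENNReal.ofReal_div_of_pos hv, ← ENNReal.ofReal_add (by positivity) (by positivity),
          ← ENNReal.ofReal_add (by positivity) (by positivity), add_assoc]

end Debiased

end DRRF

namespace DRRF

/-! ### Asymptotic orders of penalties, failure probabilities and risks. -/

section Rates

theorem exists_bounds_of_isTheta {s : ℕ → ℕ} {β : ℝ}
    (hs : (fun n => (s n : ℝ)) =Θ[atTop] fun n : ℕ => (n : ℝ) ^ β) :
    ∃ c₁ > 0, ∃ c₂ > 0, ∀ᶠ n : ℕ in atTop,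
      c₁ * (n : ℝ) ^ β ≤ s n ∧ (s n : ℝ) ≤ c₂ * (n : ℝ) ^ β := by
  obtain ⟨c₂, hc₂, h2⟩ := hs.1.exists_pos
  obtain ⟨c₁, hc₁, h1⟩ := hs.2.exists_pos
  refine ⟨c₁⁻¹, by positivity, c₂, hc₂, ?_⟩
  filter_upwards [h1.bound, h2.bound] with n h1 h2
  have e1 : ‖(n : ℝ) ^ β‖ = (n : ℝ) ^ β := Real.norm_of_nonneg (by positivity)
  have e2 : ‖(s n : ℝ)‖ = s n := Real.norm_of_nonneg (by positivity)
  rw [e1, e2] at h1 h2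
  exact ⟨by rwa [inv_mul_le_iff₀ hc₁], h2⟩

theorem exists_pos_bound_of_isBigO {a b : ℕ → ℝ} (h : a =O[atTop] b) (hb : ∀ n, 0 ≤ b n) :
    ∃ c > 0, ∀ᶠ n in atTop, a n ≤ c * b n := by
  obtain ⟨c, hc, h⟩ := h.exists_pos
  refine ⟨c, hc, ?_⟩
  filter_upwards [h.bound] with n h
  rw [Real.norm_of_nonneg (hb n)] at h
  exact (le_abs_self _).trans h

theorem exists_rpow_neg_le {s : ℕ → ℕ} {β κ c₁ : ℝ} (hc₁ : 0 < c₁) (hκ : 0 < κ)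
    (hβκ : (1 - β) / 2 ≤ β * κ) (hs : ∀ᶠ n : ℕ in atTop, c₁ * (n : ℝ) ^ β ≤ s n) :
    ∀ᶠ n : ℕ in atTop, (s n : ℝ) ^ (-κ) ≤ c₁ ^ (-κ) * (n : ℝ) ^ ((β - 1) / 2) := by
  filter_upwards [hs, eventually_ge_atTop 1] with n hs hn
  have hn' : (1 : ℝ) ≤ n := by exact_mod_cast hn
  have hn0 : (0 : ℝ) < n := by linarith
  calc (s n : ℝ) ^ (-κ) ≤ (c₁ * (n : ℝ) ^ β) ^ (-κ) :=
        Real.rpow_le_rpow_of_nonpos (by positivity) hs (by linarith)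
    _ = c₁ ^ (-κ) * (n : ℝ) ^ (β * -κ) := by
        rw [Real.mul_rpow hc₁.le (by positivity), ← Real.rpow_mul hn0.le]
    _ ≤ c₁ ^ (-κ) * (n : ℝ) ^ ((β - 1) / 2) := by
        refine mul_le_mul_of_nonneg_left (Real.rpow_le_rpow_of_exponent_le hn' ?_) (by positivity)
        linarith

theorem exists_log_le {p : ℕ → ℕ} {D : ℕ} {c δ : ℝ} (hc : 0 < c) (hδ : 0 < δ)
    (hp : ∀ᶠ n : ℕ in atTop, (p n : ℝ) ≤ c * (n : ℝ) ^ D) :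
    ∃ K > 0, ∀ᶠ n : ℕ in atTop, Real.log ((n : ℝ) ^ δ * p n) ≤ K * (n : ℝ) ^ δ := by
  -- Chosen so that the power `η` of `n ^ (δ + D)` is `n ^ δ`; with `log y ≤ y ^ η / η` the
  -- logarithm costs a small power only.
  set η : ℝ := δ / (δ + D) with hη
  have hη0 : 0 < η := by positivity
  refine ⟨c ^ η / η, by positivity, ?_⟩
  filter_upwards [hp, eventually_ge_atTop 1] with n hp hn
  have hn0 : (0 : ℝ) < n := by exact_mod_cast hn
  have h1 : (n : ℝ) ^ δ * p n ≤ c * (n : ℝ) ^ (δ + D) := by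
    calc (n : ℝ) ^ δ * p n ≤ (n : ℝ) ^ δ * (c * (n : ℝ) ^ D) :=
          mul_le_mul_of_nonneg_left hp (by positivity)
      _ = _ := by rw [Real.rpow_add hn0, Real.rpow_natCast]; ring
  calc Real.log ((n : ℝ) ^ δ * p n) ≤ ((n : ℝ) ^ δ * p n) ^ η / η :=
        Real.log_le_rpow_div (by positivity) hη0
    _ ≤ (c * (n : ℝ) ^ (δ + D)) ^ η / η := by gcongr
    _ = c ^ η / η * (n : ℝ) ^ δ := by
        rw [Real.mul_rpow hc.le (by positivity), ← Real.rpow_mul hn0.le,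
          show (δ + D) * η = δ by rw [hη]; field_simp]
        ring

theorem exp_neg_mul_rpow_le {c δ b : ℝ} (hc : 0 < c) (hδ : 0 < δ) :
    ∀ᶠ n : ℕ in atTop, Real.exp (-(c * (n : ℝ) ^ δ)) ≤ (n : ℝ) ^ b := by
  have h := (isLittleO_exp_neg_mul_rpow_atTop hc (b / δ)).bound one_pos
  have ht : Tendsto (fun n : ℕ => (n : ℝ) ^ δ) atTop atTop :=
    (tendsto_rpow_atTop hδ).comp tendsto_natCast_atTop_atTop
  filter_upwards [ht.eventually h, eventually_ge_atTop 1] with n hn hn1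
  rw [one_mul, Real.norm_of_nonneg (by positivity), Real.norm_of_nonneg (by positivity),
    ← Real.rpow_mul (by positivity), mul_div_cancel₀ _ hδ.ne'] at hn
  rwa [neg_mul] at hn

theorem rpow_div_self_le {n s : ℕ} {β c₂ A t : ℝ} (hn : 0 < n) (hs0 : 0 < s)
    (hA : 0 < A) (ht : 0 ≤ t) (hs : (s : ℝ) ≤ c₂ * (n : ℝ) ^ β) :
    t / (A * c₂) * (n : ℝ) ^ (1 - β) ≤ t * n / (A * s) := by
  have hn0 : (0 : ℝ) < n := by exact_mod_cast hn
  have hs0' : (0 : ℝ) < s := by exact_mod_cast hs0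
  rw [Real.rpow_sub hn0, Real.rpow_one, div_mul_div_comm]
  refine div_le_div_of_nonneg_left (by positivity) (by positivity) ?_
  rw [mul_assoc]
  exact mul_le_mul_of_nonneg_left hs hA.le

/-- Only the square of the penalty has to match the target. The stochastic part is at most of order
`n ^ (β - 1) * n ^ ((1 - β) / 2)`, and the bias part is already within the target before squaring.
-/
theorem exists_sq_lassoRate_le {d : ℕ} {a β c₁ c₂ c : ℝ} {D : ℕ} {p s : ℕ → ℕ} (hc₁ : 0 < c₁)
    (hc₂ : 0 < c₂) (hc : 0 < c) (hβ1 : β < 1) (hκ : 0 < 1 / (2 * a * d))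
    (hβκ : (1 - β) / 2 ≤ β * (1 / (2 * a * d)))
    (hs : ∀ᶠ n : ℕ in atTop, c₁ * (n : ℝ) ^ β ≤ s n ∧ (s n : ℝ) ≤ c₂ * (n : ℝ) ^ β)
    (hp : ∀ᶠ n : ℕ in atTop, (p n : ℝ) ≤ c * (n : ℝ) ^ D) :
    ∃ K > 0, ∀ᶠ n : ℕ in atTop,
      lassoRate a β d n (s n) (p n) ^ 2 ≤ K * (n : ℝ) ^ ((β - 1) / 2) := by
  obtain ⟨K, hK, hlog⟩ := exists_log_le hc (δ := (1 - β) / 2) (by linarith) hp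
  have hε := exists_rpow_neg_le hc₁ hκ hβκ (hs.mono fun n h => h.1)
  refine ⟨2 * ((c₁ ^ (-(1 / (2 * a * d)))) ^ 2 + c₂ * K), by positivity, ?_⟩
  filter_upwards [hs, hlog, hε, eventually_ge_atTop 1] with n hs hlog hε hn
  have hn' : (1 : ℝ) ≤ n := by exact_mod_cast hn
  have hn0 : (0 : ℝ) < n := by linarith
  set E := (n : ℝ) ^ ((β - 1) / 2) with hE
  have hE0 : 0 < E := by positivity
  have hE1 : E ≤ 1 := Real.rpow_le_one_of_one_le_of_nonpos hn' (by linarith)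
  have h1 : ((s n : ℝ) ^ (-(1 / (2 * a * d)))) ^ 2 ≤ (c₁ ^ (-(1 / (2 * a * d)))) ^ 2 * E := by
    calc _ ≤ (c₁ ^ (-(1 / (2 * a * d))) * E) ^ 2 := pow_le_pow_left₀ (by positivity) hε 2
      _ = (c₁ ^ (-(1 / (2 * a * d)))) ^ 2 * (E * E) := by ring
      _ ≤ (c₁ ^ (-(1 / (2 * a * d)))) ^ 2 * (E * 1) := by gcongr
      _ = _ := by rw [mul_one]
  have h2 : Real.sqrt (s n * Real.log ((n : ℝ) ^ ((1 - β) / 2) * p n) / n) ^ 2 ≤ c₂ * K * E := by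
    have h3 : (s n * Real.log ((n : ℝ) ^ ((1 - β) / 2) * p n) / n) ≤ c₂ * K * E := by
      calc _ ≤ (c₂ * (n : ℝ) ^ β) * (K * (n : ℝ) ^ ((1 - β) / 2)) / n := by
            refine div_le_div_of_nonneg_right ?_ hn0.le
            exact (mul_le_mul_of_nonneg_left hlog (by positivity)).trans
              (mul_le_mul_of_nonneg_right hs.2 (by positivity))
        _ = c₂ * K * ((n : ℝ) ^ β * (n : ℝ) ^ ((1 - β) / 2) / (n : ℝ) ^ (1 : ℝ)) := by
            rw [Real.rpow_one]; ring
        _ = _ := by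
            rw [← Real.rpow_add hn0, ← Real.rpow_sub hn0, hE]
            congr 2
            ring
    refine (pow_le_pow_left₀ (Real.sqrt_nonneg _) (Real.sqrt_le_sqrt h3) 2).trans ?_
    rw [Real.sq_sqrt (by positivity)]
  unfold lassoRate
  nlinarith [sq_nonneg ((s n : ℝ) ^ (-(1 / (2 * a * d))) -
    Real.sqrt (s n * Real.log ((n : ℝ) ^ ((1 - β) / 2) * p n) / n))]

/-- The constant below which the penalties must not fall. -/
noncomputable def penaltyConst (C L : ℝ) : ℝ := 3 * (|L| + 1) + 15 * (|C| + 1)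

/-- The factor `n ^ ((1 - β) / 2)` inside the logarithm of the penalty is there for this bound: the
tail of one coordinate is at most the inverse of `n ^ ((1 - β) / 2) * p`, and the union over `p`
coordinates cancels `p`. -/
theorem union_exp_le {n s p : ℕ} {C L lam ε β a : ℝ} {d : ℕ} (hn : 1 ≤ n) (hs : 1 ≤ s)
    (hβ1 : β < 1) (hε : ε = (s : ℝ) ^ (-(1 / (2 * a * d))))
    (hlam : penaltyConst C L * lassoRate a β d n s p ≤ lam) :
    p * (2 * Real.exp (-((lam / 3 - (|L| + 1) * ε) ^ 2 * n / (6 * (2 * (|C| + 1)) ^ 2 * s)))) ≤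
      2 * (n : ℝ) ^ ((β - 1) / 2) := by
  rcases Nat.eq_zero_or_pos p with rfl | hp
  · simp only [Nat.cast_zero, zero_mul]
    positivity
  have hn' : (1 : ℝ) ≤ n := by exact_mod_cast hn
  have hn0 : (0 : ℝ) < n := by linarith
  have hs0 : (0 : ℝ) < s := by exact_mod_cast hs
  have hp0 : (1 : ℝ) ≤ p := by exact_mod_cast hp
  set X := (n : ℝ) ^ ((1 - β) / 2) * p with hX
  have hn1 : 1 ≤ (n : ℝ) ^ ((1 - β) / 2) := Real.one_le_rpow hn' (by linarith)
  have hX1 : 1 ≤ X := by nlinarith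
  have hlog : 0 ≤ Real.log X := Real.log_nonneg hX1
  set q := Real.sqrt (s * Real.log X / n) with hq
  have hq0 : 0 ≤ q := Real.sqrt_nonneg _
  have hq2 : q ^ 2 = s * Real.log X / n := Real.sq_sqrt (by positivity)
  have hrate : lassoRate a β d n s p = ε + q := by rw [hε]; rfl
  have hε0 : 0 ≤ ε := by rw [hε]; positivity
  have hC : 0 < |C| + 1 := by positivity
  have hL : 0 < |L| + 1 := by positivity
  -- A third of `penaltyConst` pays `|L| + 1` for the bias and `5 * (|C| + 1)` for the noise; the
  -- latter suffices because `25` exceeds the `24 = 6 * 2 ^ 2` of the tail bound.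
  have h1 : 5 * (|C| + 1) * q ≤ lam / 3 - (|L| + 1) * ε := by
    rw [hrate, penaltyConst] at hlam
    nlinarith [mul_nonneg hC.le hε0, mul_nonneg hL.le hq0]
  have h2 : Real.log X ≤
      (lam / 3 - (|L| + 1) * ε) ^ 2 * n / (6 * (2 * (|C| + 1)) ^ 2 * s) := by
    rw [le_div_iff₀ (by positivity)]
    have h3 : (5 * (|C| + 1) * q) ^ 2 ≤ (lam / 3 - (|L| + 1) * ε) ^ 2 :=
      pow_le_pow_left₀ (by positivity) h1 2
    have h4 : (5 * (|C| + 1) * q) ^ 2 * n = 25 * (|C| + 1) ^ 2 * (s * Real.log X) := by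
      rw [mul_pow, hq2]
      field_simp
      ring
    have h5 := mul_le_mul_of_nonneg_right h3 hn0.le
    rw [h4] at h5
    refine le_trans ?_ h5
    have : 0 ≤ (|C| + 1) ^ 2 * (s * Real.log X) := by positivity
    nlinarith
  have h3 : Real.exp (-((lam / 3 - (|L| + 1) * ε) ^ 2 * n / (6 * (2 * (|C| + 1)) ^ 2 * s))) ≤
      X⁻¹ := by
    rw [← Real.exp_log (inv_pos.2 (by linarith : 0 < X)), Real.log_inv]
    exact Real.exp_le_exp.2 (neg_le_neg h2)
  calc _ ≤ (p : ℝ) * (2 * X⁻¹) := by gcongr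
    _ = 2 * (n : ℝ) ^ ((β - 1) / 2) := by
        rw [hX, mul_inv, ← Real.rpow_neg hn0.le]
        have : -((1 - β) / 2) = (β - 1) / 2 := by ring
        rw [this]
        field_simp

theorem exists_lassoFail_le {d : ℕ} {a β c₁ c₂ c C L γ : ℝ} {D k : ℕ} {p s : ℕ → ℕ} {lam : ℕ → ℝ}
    (hγ : 0 < γ) (hc₂ : 0 < c₂) (hc : 0 < c) (hβ1 : β < 1)
    (hs : ∀ᶠ n : ℕ in atTop, c₁ * (n : ℝ) ^ β ≤ s n ∧ (s n : ℝ) ≤ c₂ * (n : ℝ) ^ β)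
    (hs1 : ∀ᶠ n in atTop, 1 ≤ s n)
    (hp : ∀ᶠ n : ℕ in atTop, (p n : ℝ) ≤ c * (n : ℝ) ^ D)
    (hlam : ∀ᶠ n in atTop, penaltyConst C L * lassoRate a β d n (s n) (p n) ≤ lam n) :
    ∀ᶠ n : ℕ in atTop,
      lassoFail (p n) n (s n) C L γ (lam n) ((s n : ℝ) ^ (-(1 / (2 * a * d)))) k ≤
        (3 + 2 * c ^ 2) * (n : ℝ) ^ ((β - 1) / 2) := by
  have hC : 0 < |C| + 1 := by positivity
  -- The extra power `-2 * D` absorbs the union over `p ^ 2` matrix entries.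
  have h1 := exp_neg_mul_rpow_le (c := (γ / (64 * (k + 1))) ^ 2 / (6 * (2 * (|C| + 1)) ^ 2 * c₂))
    (δ := 1 - β) (b := (β - 1) / 2 - 2 * D) (by positivity) (by linarith)
  have h2 := exp_neg_mul_rpow_le (c := (1 / 4) ^ 2 / (6 * 1 ^ 2 * c₂))
    (δ := 1 - β) (b := (β - 1) / 2) (by positivity) (by linarith)
  filter_upwards [hs, hs1, hp, hlam, h1, h2, eventually_ge_atTop 1] with n hs hs1 hp hlam h1 h2 hn
  have hn0 : (0 : ℝ) < n := by exact_mod_cast hn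
  have e1 := union_exp_le hn hs1 hβ1 rfl hlam
  have e2 : (p n : ℝ) * (p n * (2 * Real.exp (-((γ / (64 * (k + 1))) ^ 2 * n /
      (6 * (2 * (|C| + 1)) ^ 2 * s n))))) ≤ 2 * c ^ 2 * (n : ℝ) ^ ((β - 1) / 2) := by
    have h3 := rpow_div_self_le (t := (γ / (64 * (k + 1))) ^ 2) (A := 6 * (2 * (|C| + 1)) ^ 2)
      hn hs1 (by positivity) (by positivity) hs.2
    calc _ ≤ (c * (n : ℝ) ^ D) * ((c * (n : ℝ) ^ D) * (2 * (n : ℝ) ^ ((β - 1) / 2 - 2 * D))) := by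
          gcongr
          exact (Real.exp_le_exp.2 (neg_le_neg h3)).trans h1
      _ = 2 * c ^ 2 * ((n : ℝ) ^ (D : ℝ) * (n : ℝ) ^ (D : ℝ) *
            (n : ℝ) ^ ((β - 1) / 2 - 2 * D)) := by
          rw [Real.rpow_natCast]; ring
      _ = _ := by
          rw [← Real.rpow_add hn0, ← Real.rpow_add hn0]
          congr 2
          ring
  have e3 : Real.exp (-((1 / 4) ^ 2 * n / (6 * 1 ^ 2 * s n))) ≤ (n : ℝ) ^ ((β - 1) / 2) := by
    have h3 := rpow_div_self_le (t := (1 / 4) ^ 2) (A := 6 * 1 ^ 2)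
      hn hs1 (by positivity) (by positivity) hs.2
    exact (Real.exp_le_exp.2 (neg_le_neg h3)).trans h2
  unfold lassoFail
  linarith

theorem exists_lassoRisk_le {d : ℕ} {a β c₁ c₂ c C L γ : ℝ} {D k : ℕ} {p s : ℕ → ℕ} {lam : ℕ → ℝ}
    (hγ : 0 < γ) (hc₁ : 0 < c₁) (hc₂ : 0 < c₂) (hc : 0 < c) (hβ1 : β < 1)
    (hκ : 0 < 1 / (2 * a * d)) (hβκ : (1 - β) / 2 ≤ β * (1 / (2 * a * d)))
    (hs : ∀ᶠ n : ℕ in atTop, c₁ * (n : ℝ) ^ β ≤ s n ∧ (s n : ℝ) ≤ c₂ * (n : ℝ) ^ β)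
    (hs1 : ∀ᶠ n in atTop, 1 ≤ s n)
    (hp : ∀ᶠ n : ℕ in atTop, (p n : ℝ) ≤ c * (n : ℝ) ^ D)
    (hlam : ∀ᶠ n in atTop, penaltyConst C L * lassoRate a β d n (s n) (p n) ≤ lam n)
    (hlamO : lam =O[atTop] fun n => lassoRate a β d n (s n) (p n)) :
    ∃ K > 0, ∀ᶠ n : ℕ in atTop,
      lassoRisk (p n) n (s n) C L γ (lam n) ((s n : ℝ) ^ (-(1 / (2 * a * d)))) k ≤
        K * (n : ℝ) ^ ((β - 1) / 2) := by
  have hr0 : ∀ n, 0 ≤ lassoRate a β d n (s n) (p n) := fun n => by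
    unfold lassoRate
    positivity
  obtain ⟨K₁, hK₁, hrate⟩ := exists_sq_lassoRate_le hc₁ hc₂ hc hβ1 hκ hβκ hs hp
  obtain ⟨K₂, hK₂, hlam2⟩ := exists_pos_bound_of_isBigO hlamO hr0
  have hfail := exists_lassoFail_le (k := k) hγ hc₂ hc hβ1 hs hs1 hp hlam
  have hL : 0 < |L| + 1 := by positivity
  refine ⟨(48 * k * (|L| + 1) + 16 * Real.sqrt k * K₂ / γ) ^ 2 * K₁ + (2 * C) ^ 2 * (3 + 2 * c ^ 2) +
    1, by positivity, ?_⟩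
  filter_upwards [hrate, hlam2, hfail, hlam] with n hrate hlam2 hfail hlam
  set R := lassoRate a β d n (s n) (p n) with hR
  set E := (n : ℝ) ^ ((β - 1) / 2) with hE
  set ε := (s n : ℝ) ^ (-(1 / (2 * a * d))) with hε
  have hE0 : 0 ≤ E := by positivity
  have hε0 : 0 ≤ ε := by positivity
  have hεR : ε ≤ R := by
    rw [hR, lassoRate]
    exact le_add_of_nonneg_right (Real.sqrt_nonneg _)
  have hlam0 : 0 ≤ lam n := (mul_nonneg (by unfold penaltyConst; positivity) (hr0 n)).trans hlam
  have h1 : 48 * k * (|L| + 1) * ε + 16 * Real.sqrt k * lam n / γ ≤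
      (48 * k * (|L| + 1) + 16 * Real.sqrt k * K₂ / γ) * R := by
    have h2 : 48 * k * (|L| + 1) * ε ≤ 48 * k * (|L| + 1) * R := by gcongr
    have h3 : 16 * Real.sqrt k * lam n / γ ≤ 16 * Real.sqrt k * (K₂ * R) / γ := by gcongr
    calc _ ≤ _ := add_le_add h2 h3
      _ = _ := by ring
  have h2 : (48 * k * (|L| + 1) * ε + 16 * Real.sqrt k * lam n / γ) ^ 2 ≤
      (48 * k * (|L| + 1) + 16 * Real.sqrt k * K₂ / γ) ^ 2 * (K₁ * E) := by
    refine (pow_le_pow_left₀ (by positivity) h1 2).trans ?_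
    rw [mul_pow]
    gcongr
  have h3 := mul_le_mul_of_nonneg_left hfail (sq_nonneg (2 * C))
  unfold lassoRisk
  linarith

end Rates

end DRRF

/-! ### Choice of the constants and conclusion. -/

theorem corollary1
    -- target covariates: continuous density on the unit cube, bounded away from 0 and infinity
    {d : ℕ} (hd : 1 ≤ d) (f : DRRF.Cov d → ℝ) (fmin fmax : ℝ) (hfmin : 0 < fmin)
    (hf : ∀ x ∈ DRRF.cube d, fmin ≤ f x ∧ f x ≤ fmax) (hfc : ContinuousOn f (DRRF.cube d))
    (hfp : IsProbabilityMeasure (DRRF.covLaw f))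
    -- a sequence of conditional moment problems, of dimension growing at most polynomially
    {𝒲 : ℕ → Type*} [∀ n, MeasurableSpace (𝒲 n)] (p : ℕ → ℕ)
    (hp : ∃ D : ℕ, (fun n => (p n : ℝ)) =O[atTop] fun n => (n : ℝ) ^ D)
    (M : ∀ n, DRRF.Problem d (p n) (𝒲 n))
    (C ψmax L γ : ℝ) (hγ : 0 < γ) (k : ℕ)
    (hset : ∀ n, DRRF.Setting (M n) C)
    (hmom : ∀ n, DRRF.MomentRegularity (M n) ψmax L)
    (hnui : ∀ n, DRRF.NuisanceRegularity (M n) k γ L C)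
    -- parameters of the forest
    (ρ ϖ β : ℝ) (r : ℕ) (hρ0 : 0 < ρ) (hρ : ρ ≤ 0.2) (hϖ0 : 0 < ϖ) (hϖ : ϖ ≤ 1) (hr : 1 ≤ r)
    (hβ : (1 + 1 / (DRRF.rateParam ρ ϖ * d))⁻¹ < β) (hβ1 : β < 1) :
    ∃ C₀ > 0, ∀ (s B : ℕ → ℕ) (lamg lamα : ℕ → ℝ)
      (T : ∀ n, DRRF.TreeLearner d n (s n) (𝒲 n))
      (estg estα : ∀ n, DRRF.HalfSample d n (s n) (B n) (𝒲 n) → DRRF.Cov d → DRRF.Param (p n)),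
      (fun n => (s n : ℝ)) =Θ[atTop] (fun n => (n : ℝ) ^ β) →
      (∀ᶠ n : ℕ in atTop, (n : ℝ) / s n ≤ B n) →
      (∀ᶠ n in atTop,
        C₀ * DRRF.lassoRate (DRRF.rateParam ρ ϖ) β d n (s n) (p n) ≤ lamg n ∧
        C₀ * DRRF.lassoRate (DRRF.rateParam ρ ϖ) β d n (s n) (p n) ≤ lamα n) →
      lamg =O[atTop] (fun n => DRRF.lassoRate (DRRF.rateParam ρ ϖ) β d n (s n) (p n)) →
      lamα =O[atTop] (fun n => DRRF.lassoRate (DRRF.rateParam ρ ϖ) β d n (s n) (p n)) →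
      (∀ n, DRRF.FollowsAlgorithm (M n) f r (lamg n) (lamα n) (T n)) →
      (∀ n, DRRF.ForestRegular (M n) f ρ ϖ r (T n)) →
      (∀ n, DRRF.IsForestLasso (M n) f r (B n) (T n) (M n).lg (lamg n) (estg n)) →
      (∀ n, DRRF.IsForestLasso (M n) f r (B n) (T n) (M n).lα (lamα n) (estα n)) →
      ∀ x ∈ DRRF.cube d,
        DRRF.IsBigOp (fun n => DRRF.sampleLaw (M n) f n (s n) (B n))
          (fun n ω => DRRF.thetaHat (M n) r (T n) (estg n) (estα n) ω x - (M n).θ0 x)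
          (fun n => (n : ℝ) ^ ((β - 1) / 2)) := by
  have hd0 : (0 : ℝ) < d := by exact_mod_cast hd
  have ha := DRRF.rateParam_pos hρ0 hρ hϖ0
  set a := DRRF.rateParam ρ ϖ with hadef
  have hκ : 0 < 1 / (2 * a * d) := by positivity
  have hβ0 : 0 < β := lt_trans (by positivity) hβ
  -- The lower bound on `β` in its useful form: the smoothing bias `s ^ (-1 / (2 * a * d))` is of
  -- order at most `n ^ ((β - 1) / 2)`.
  have hβκ : (1 - β) / 2 ≤ β * (1 / (2 * a * d)) := by
    have h1 : 1 < β * (1 + 1 / (a * d)) := by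
      rwa [inv_eq_one_div, div_lt_iff₀ (by positivity)] at hβ
    have h2 : 1 / (2 * a * d) = 1 / (a * d) / 2 := by field_simp
    rw [h2]
    linarith
  obtain ⟨D, hpD⟩ := hp
  obtain ⟨c, hc, hp⟩ := DRRF.exists_pos_bound_of_isBigO hpD fun n => by positivity
  refine ⟨DRRF.penaltyConst C L, by unfold DRRF.penaltyConst; positivity, ?_⟩
  intro s B lamg lamα T estg estα hsθ hB hlam hlamgO hlamαO halg hreg hestg hestα x hx
  obtain ⟨c₁, hc₁, c₂, hc₂, hs⟩ := DRRF.exists_bounds_of_isTheta hsθ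
  have hsLim : Tendsto s atTop atTop := by
    rw [← tendsto_natCast_atTop_iff (R := ℝ)]
    refine tendsto_atTop_mono' _ (hs.mono fun n h => h.1) ?_
    exact ((tendsto_rpow_atTop hβ0).comp tendsto_natCast_atTop_atTop).const_mul_atTop hc₁
  have hs1 := hsLim.eventually_ge_atTop 1
  have hsn : ∀ᶠ n : ℕ in atTop, s n ≤ n := by
    have h1 : Tendsto (fun n : ℕ => (n : ℝ) ^ (1 - β)) atTop atTop :=
      (tendsto_rpow_atTop (by linarith)).comp tendsto_natCast_atTop_atTop
    filter_upwards [hs, h1.eventually_ge_atTop c₂, eventually_ge_atTop 1] with n hs h1 hn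
    have hn0 : (0 : ℝ) < n := by exact_mod_cast hn
    have h2 : (s n : ℝ) ≤ n := by
      calc (s n : ℝ) ≤ c₂ * (n : ℝ) ^ β := hs.2
        _ ≤ (n : ℝ) ^ (1 - β) * (n : ℝ) ^ β := by gcongr
        _ = n := by
            rw [← Real.rpow_add hn0]
            simp
    exact_mod_cast h2
  have hlamg := hlam.mono fun n h => h.1
  have hlamα := hlam.mono fun n h => h.2
  obtain ⟨Kg, hKg, hriskg⟩ := DRRF.exists_lassoRisk_le (k := k) hγ hc₁ hc₂ hc hβ1 hκ hβκ hs hs1 hp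
    hlamg hlamgO
  obtain ⟨Kα, hKα, hriskα⟩ := DRRF.exists_lassoRisk_le (k := k) hγ hc₁ hc₂ hc hβ1 hκ hβκ hs hs1 hp
    hlamα hlamαO
  have hε := DRRF.exists_rpow_neg_le hc₁ hκ hβκ (hs.mono fun n h => h.1)
  have hshrink := hsLim.eventually (DRRF.eventually_stat_dist_le hd hfmin hf hfc hρ0 hρ hϖ0 hϖ r)
  intro η hη
  set A := 6 * (2 * (|ψmax| + 1)) ^ 2 + 6 * ((d : ℝ) + 1) ^ 2 with hA
  have hA0 : 0 < A := by positivity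
  -- With deviation `t * E` both exponents are at least `6 / η`, and `exp y ≥ y` bounds each
  -- exponential by `η / 6`; counted with multiplicity they use `η / 2`.
  set t := Real.sqrt (6 / η * (A * c₂)) with ht
  have ht2 : t ^ 2 / (A * c₂) = 6 / η := by
    rw [ht, Real.sq_sqrt (by positivity)]
    field_simp
  -- Makes the Markov term at most `η / 3`, so the total failure probability stays below `η`. The
  -- added one keeps `w` positive when `L = 0`.
  set w := 3 * (L ^ 2 * (Kα + Kg) + 1) / η with hw
  have hw0 : 0 < w := by positivity
  refine ⟨t + DRRF.targetLip d L * (c₁ ^ (-(1 / (2 * a * d))) + t) + w, ?_⟩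
  filter_upwards [hs, hs1, hsn, hB, hlamg, hlamα, hriskg, hriskα, hε, hshrink,
    hsLim.eventually_ge_atTop (2 * r), eventually_ge_atTop 1]
    with n hs hs1 hsn hB hlamg hlamα hriskg hriskα hε hshrink hs2r hn
  have hn0 : (0 : ℝ) < n := by exact_mod_cast hn
  have hs0 : (0 : ℝ) < s n := by exact_mod_cast hs1
  have := (hset n).markov
  set ε := (s n : ℝ) ^ (-(1 / (2 * a * d))) with hεdef
  set E := (n : ℝ) ^ ((β - 1) / 2) with hE
  have hε0 : 0 < ε := by positivity
  have hE0 : 0 < E := by positivity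
  have hok : DRRF.ForestOK (M n) f (T n) ρ ϖ r (B n) ε :=
    { meas := (halg n).meas
      adapted := (halg n).adapted
      regular := hreg n
      one_le_r := hr
      r_le := by omega
      one_le := hs1
      le := hsn
      trees := hB
      pos := hε0
      shrink := hshrink (M n) (T n) (halg n).meas (halg n).adapted (hreg n) }
  have hpen : ∀ lam, DRRF.penaltyConst C L * DRRF.lassoRate a β d n (s n) (p n) ≤ lam →
      0 < lam ∧ (|L| + 1) * ε ≤ lam / 3 := fun lam h => by
    have h1 : ε ≤ DRRF.lassoRate a β d n (s n) (p n) :=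
      le_add_of_nonneg_right (Real.sqrt_nonneg _)
    have h2 : 3 * (|L| + 1) * ε ≤ DRRF.penaltyConst C L * DRRF.lassoRate a β d n (s n) (p n) := by
      refine mul_le_mul ?_ h1 hε0.le (by unfold DRRF.penaltyConst; positivity)
      unfold DRRF.penaltyConst
      have : 0 < 15 * (|C| + 1) := by positivity
      linarith
    have h3 : 0 < (|L| + 1) * ε := by positivity
    constructor <;> linarith
  obtain ⟨hg0, hg⟩ := hpen _ hlamg
  obtain ⟨hα0, hα⟩ := hpen _ hlamα
  have htail := DRRF.sampleLaw_thetaHat_tail hok (hset n) (hmom n) (hnui n) hγ hg0 hα0 hg hα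
    (hestg n) (hestα n) hx (u := t * E) (v := w * E) (by positivity) (by positivity)
  refine (measure_mono fun ω hω => ?_).trans (htail.trans (ENNReal.ofReal_le_ofReal ?_))
  · rw [Set.mem_ofPred_eq] at hω ⊢
    refine lt_of_le_of_lt ?_ hω
    have := mul_le_mul_of_nonneg_left hε (DRRF.targetLip_nonneg d L)
    nlinarith
  · have hexp : ∀ A', 0 < A' → A' ≤ A →
        Real.exp (-((t * E) ^ 2 * n / (A' * s n))) ≤ η / 6 := fun A' hA' hAA' => by
      have h1 : 6 / η ≤ (t * E) ^ 2 * n / (A' * s n) := by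
        have h2 := DRRF.rpow_div_self_le (n := n) (s := s n) (t := t ^ 2 * E ^ 2) (A := A)
          hn hs1 hA0 (by positivity) hs.2
        have h3 : E ^ 2 * (n : ℝ) ^ (1 - β) = 1 := by
          rw [hE, ← Real.rpow_natCast, ← Real.rpow_mul hn0.le, ← Real.rpow_add hn0]
          norm_num
        calc 6 / η = t ^ 2 * E ^ 2 / (A * c₂) * (n : ℝ) ^ (1 - β) := by
              rw [← ht2]
              calc t ^ 2 / (A * c₂) = t ^ 2 / (A * c₂) * (E ^ 2 * (n : ℝ) ^ (1 - β)) := by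
                    rw [h3, mul_one]
                _ = _ := by ring
          _ ≤ t ^ 2 * E ^ 2 * n / (A * s n) := h2
          _ ≤ t ^ 2 * E ^ 2 * n / (A' * s n) := by gcongr
          _ = _ := by rw [mul_pow]
      have h4 : 6 / η ≤ Real.exp ((t * E) ^ 2 * n / (A' * s n)) :=
        h1.trans ((by linarith : _ ≤ _ + (1 : ℝ)).trans (Real.add_one_le_exp _))
      rw [Real.exp_neg]
      calc _ ≤ (6 / η)⁻¹ := inv_anti₀ (by positivity) h4
        _ = η / 6 := inv_div _ _
    have e1 := hexp (6 * (2 * (|ψmax| + 1)) ^ 2) (by positivity)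
      (le_add_of_nonneg_right (by positivity))
    have e2 := hexp (6 * ((d : ℝ) + 1) ^ 2) (by positivity) (le_add_of_nonneg_left (by positivity))
    have e3 : L ^ 2 * (DRRF.lassoRisk (p n) n (s n) C L γ (lamα n) ε k +
        DRRF.lassoRisk (p n) n (s n) C L γ (lamg n) ε k) / (w * E) ≤ η / 3 := by
      rw [div_le_iff₀ (by positivity)]
      have h1 : L ^ 2 * (DRRF.lassoRisk (p n) n (s n) C L γ (lamα n) ε k +
          DRRF.lassoRisk (p n) n (s n) C L γ (lamg n) ε k) ≤ L ^ 2 * (Kα * E + Kg * E) := by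
        gcongr
      have h2 : η / 3 * (w * E) = (L ^ 2 * (Kα + Kg) + 1) * E := by
        rw [hw]
        field_simp
      rw [h2]
      linarith
    linarith
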